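/- Let $X(t)$, $t\ge 0$, be Brownian motion with known drift $\mu>0$, variance $1$ per unit time, continuous paths and $X(0)=0$, and let $\mathcal E_t=\sigma(X(s):s\le t)$. A *sampler* $\delta(a)$ with boundary $a>0$ is a sequence of nonnegative finite random stage sizes $T_1,T_2,\dots$ such that, with $T^k=T_1+\cdots+T_k$ and $T^0=0$, the variable $T_{k+1}1\{T^k\le t\}$ is $\mathcal E_t$-measurable for all $k\ge 0$ and $t\ge 0$ (so $T_1$ is non-random). Put $X_k=X(T^k)$, $M=\inf\{k\ge1: X_k\ge a\}$ and $T=T^M$. Given a cost function $h$, the risk of $\delta(a)$ is $R(\delta(a))=E(T-a/\mu)+h(a)\,EM\in(-\infty,+\infty]$. Put $h_0(x)=x$ and $h_m(x)=x^{2^{-m}}(\log x)^{1/2-2^{-m}}$ for $m\ge1$. For $m\ge 1$ let $\mathcal B_m^o$ be the set of $h:(0,\infty)\to(0,\infty)$ with $h_m\ll h\ll h_{m-1}$ at infinity (where $g_1\ll g_2$ means $g_1=o(g_2)$), let $\mathcal B_m^+$ be the set of those with $\lim_{x\to\infty} h(x)/h_m(x)\in(0,\infty)$, and let $\mathcal B_m=\mathcal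 B_m^o\cup\mathcal B_m^+$. For $y>0$ let $F_y(x)=\sqrt{x\log(x/y^2)}$ and let $F_h^{(k)}(x)$ be the $k$-fold iterate of $F_y$ at $x$ with $y=h(x)$ held fixed (defined for all large $x$ when $h\in\mathcal B_m$ and $k<m$). *The samplers.* For $x>0$ and $z\in\mathbb R$ let $t(x,z)>0$ be the unique solution of $(x-\mu t)/\sqrt t=z$. Geometric sampling $\dot\delta_z(a)$ has stages $T_k=t(a-X_{k-1},z)\,1\{X_{k-1}<a\}$. Let $f(x)=(6/\sqrt\mu)\sqrt{x\log(x+1)}$, an increasing bijection of $(0,\infty)$. Define $\delta_{1,h}^o(a)=\dot\delta_{\zeta(a)}(a)$ with $\zeta(x)=-\min(\sqrt{h(x)}/x^{1/4},\,x^{1/7})$, and let $\delta_{m+1,h}^o(a)$ have first stage $t(a,\sqrt{\log(a/h(a)^2+1)})$, followed, if $X_1<a$, by $\delta^o_{m,h\circ f^{-1}}(a-X_1)$ applied to the process restarted at the end of that stage. Let $\delta^+_{1,z}(a)$ have first stage $t(a,z)$, followed, if $X_1<a$, by $\dot\delta_{\nu(a-X_1)}(a-X_1)$ with $\nu(x)=-\sqrt{\log(x+1)}$,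 and let $\delta^+_{m+1,z}(a)$ have first stage $t(a,\sqrt{(1-2^{-m})\log(a+1)})$, followed, if $X_1<a$, by $\delta^+_{m,z}(a-X_1)$. **Theorem.** Let $m\ge1$ and $h\in\mathcal B_m$. If $h\in\mathcal B_m^o$, assume also that $h$ is Borel measurable and that there are constants $C,x_0$ with $h(x)\le C\,h(y)$ whenever $x_0\le x\le y$ (for instance, $h$ nondecreasing, with $C=1$). Let $\delta(a)=\delta^o_{m,h}(a)$ if $h\in\mathcal B_m^o$, and $\delta(a)=\delta^+_{m,z^*}(a)$ if $h\in\mathcal B_m^+$, where $z^*$ is the solution of $$\frac{\phi(z^*)}{1-\Phi(z^*)}=\lim_{x\to\infty}\frac{\kappa_m h_m(x)}{h(x)},\qquad \kappa_m=\mu^{-2+2^{-m}}\prod_{i=1}^{m-1}\bigl[2^{-(m-1-i)}-2^{-(m-1)}\bigr]^{2^{-(i+1)}},$$ with $\phi,\Phi$ the standard normal density and distribution function. Let $\delta'(a)$, $a>0$, be samplers, with $X_k$ and $M$ their sampled positions and numbers of stages. 1. If $a_i\to\infty$ and, for some $1\le k<m$ and some $\varepsilon>0$, the probabilities $$P\bigl(a_i-X_k\ge(1-\varepsilon)(1/\mu)^{1-2^{-k}}F_h^{(k)}(a_i)\bigr)$$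 for $\delta'(a_i)$ are bounded away from $1$ for all large $i$, then $$\frac{R(\delta'(a_i))-R(\delta(a_i))}{h(a_i)}\to+\infty\qquad(i\to\infty).\tag{$*$}$$ 2. In particular, $(*)$ holds along every sequence $a_i\to\infty$ along which $P(M\ge m)$ for $\delta'(a_i)$ is bounded away from $1$ for all large $i$; hence, if $P(M\ge m)\not\to1$ as $a\to\infty$, then $(*)$ holds along some sequence $a_i\to\infty$. -/

import Mathlib

open MeasureTheory ProbabilityTheory Filter Topology Asymptotics
open scoped NNReal ENNReal

noncomputable section

/-! ### Brownian motion with drift and multistage samplers -/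

/-- `X` is Brownian motion with drift `μ` and variance one per unit time, started at `0`
and with continuous paths. -/
structure IsDriftBrownian {Ω : Type*} [MeasurableSpace Ω] (P : Measure Ω) (μ : ℝ)
    (X : ℝ≥0 → Ω → ℝ) : Prop where
  brownian : IsBrownianReal (fun (t : ℝ≥0) ω => X t ω - μ * t) P
  measurable : ∀ t, Measurable (X t)
  continuous_path : ∀ ω, Continuous fun t => X t ω
  zero : ∀ ω, X 0 ω = 0

/-- The sigma-algebra generated by `X s`, `s ≤ t`. -/
abbrev pastSigma {Ω : Type*} (X : ℝ≥0 → Ω → ℝ) (t : ℝ≥0) : MeasurableSpace Ω :=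
  ⨆ s ≤ t, MeasurableSpace.comap (X s) inferInstance

/-- End of the first `k` stages. Here `T j` is the size of the stage number `j + 1`. -/
def stageEnd {Ω : Type*} (T : ℕ → Ω → ℝ≥0) (k : ℕ) (ω : Ω) : ℝ≥0 :=
  ∑ j ∈ Finset.range k, T j ω

/-- A multistage sampling rule: for every `k ≥ 0` and `t ≥ 0` the variable
`T_{k+1} · 1{T_1 + ⋯ + T_k ≤ t}` is determined by the path up to time `t`
(for `k = 0`: the first stage size is not random). -/
def IsSamplingRule {Ω : Type*} (X : ℝ≥0 → Ω → ℝ) (T : ℕ → Ω → ℝ≥0) : Prop :=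
  ∀ (k : ℕ) (t : ℝ≥0),
    Measurable[pastSigma X t] (Set.indicator {ω | stageEnd T k ω ≤ t} (T k))

/-- The position `X_k` of the process at the end of the first `k` stages. -/
def stagePos {Ω : Type*} (X : ℝ≥0 → Ω → ℝ) (T : ℕ → Ω → ℝ≥0) (k : ℕ) (ω : Ω) : ℝ :=
  X (stageEnd T k ω) ω

/-- The number of stages `M = inf {k ≥ 1 : X_k ≥ a}`, equal to `⊤` if there is no such `k`. -/
def stageCount {Ω : Type*} (X : ℝ≥0 → Ω → ℝ) (T : ℕ → Ω → ℝ≥0) (a : ℝ) (ω : Ω) : ℕ∞ :=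
  ⨅ (k : ℕ) (_ : 1 ≤ k ∧ a ≤ stagePos X T k ω), (k : ℕ∞)

/-- The total sampling time `T_1 + ⋯ + T_M`. -/
def totalTime {Ω : Type*} (X : ℝ≥0 → Ω → ℝ) (T : ℕ → Ω → ℝ≥0) (a : ℝ) (ω : Ω) : ℝ≥0∞ :=
  ∑' j : ℕ, if (j : ℕ∞) < stageCount X T a ω then (T j ω : ℝ≥0∞) else 0

/-- The risk `E (T - a / μ) + c · E M`, where `c` is the cost per stage; it may be `+∞`. -/
def risk {Ω : Type*} [MeasurableSpace Ω] (P : Measure Ω) (μ : ℝ) (X : ℝ≥0 → Ω → ℝ)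
    (c a : ℝ) (T : ℕ → Ω → ℝ≥0) : EReal :=
  (((∫⁻ ω, totalTime X T a ω ∂P)
      + ENNReal.ofReal c * ∫⁻ ω, (stageCount X T a ω : ℝ≥0∞) ∂P : ℝ≥0∞) : EReal)
    - ((a / μ : ℝ) : EReal)

/-! ### Critical functions and bands -/

/-- The critical functions `h_m`. -/
def critFun (m : ℕ) (x : ℝ) : ℝ :=
  if m = 0 then x
  else x ^ ((1 / 2 : ℝ) ^ m) * (Real.log x) ^ (1 / 2 - (1 / 2 : ℝ) ^ m)

/-- The interior of the `m`th critical band: `h_m ≪ h ≪ h_{m-1}`. -/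
def InBand (m : ℕ) (h : ℝ → ℝ) : Prop :=
  (∀ x, 0 < x → 0 < h x) ∧ critFun m =o[atTop] h ∧ h =o[atTop] critFun (m - 1)

/-- The boundary between the critical bands `m` and `m + 1`: `h / h_m` has a positive finite
limit. -/
def OnBandBoundary (m : ℕ) (h : ℝ → ℝ) : Prop :=
  (∀ x, 0 < x → 0 < h x) ∧
    ∃ Q : ℝ, 0 < Q ∧ Tendsto (fun x => h x / critFun m x) atTop (𝓝 Q)

/-- The constants `κ_m`. -/
def kappaConst (μ : ℝ) (m : ℕ) : ℝ :=
  μ ^ (-2 + (1 / 2 : ℝ) ^ m) *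
    ∏ i ∈ Finset.Icc 1 (m - 1),
      ((1 / 2 : ℝ) ^ (m - 1 - i) - (1 / 2 : ℝ) ^ (m - 1)) ^ ((1 / 2 : ℝ) ^ (i + 1))

/-- The ratio `φ z / (1 - Φ z)` for the standard normal density and distribution function. -/
def normalHazard (z : ℝ) : ℝ :=
  gaussianPDFReal 0 1 z / (1 - cdf (gaussianReal 0 1) z)

/-- `F_y x = √(x log (x / y²))`. -/
def undershootStep (y x : ℝ) : ℝ := Real.sqrt (x * Real.log (x / y ^ 2))

/-- `F_h^{(k)} x`, the `k`-fold iterate of `F_y` at `x`, with `y = h x` held fixed. -/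
def undershootIter (h : ℝ → ℝ) (k : ℕ) (x : ℝ) : ℝ := (undershootStep (h x))^[k] x

/-! ### The optimal samplers, as functions of the boundary and the observed path -/

/-- The stage size `t(x, z)`, the unique positive solution `t` of `(x - μ t) / √t = z`. -/
def stageSize (μ x z : ℝ) : ℝ :=
  x / μ - (z * Real.sqrt (4 * x * μ + z ^ 2) - z ^ 2) / (2 * μ ^ 2)

theorem stageSize_eq_sq {μ x z : ℝ} (hμ : 0 < μ) (hx : 0 < x) :
    stageSize μ x z = ((Real.sqrt (4 * x * μ + z ^ 2) - z) / (2 * μ)) ^ 2 := by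
  have h := Real.sq_sqrt (show 0 ≤ 4 * x * μ + z ^ 2 by positivity)
  unfold stageSize
  generalize Real.sqrt (4 * x * μ + z ^ 2) = s at h ⊢
  have hμ' := hμ.ne'
  field_simp
  linear_combination (-1 : ℝ) * h

theorem stageSize_unique {μ x z : ℝ} (hμ : 0 < μ) (hx : 0 < x) (t : ℝ) :
    (0 < t ∧ (x - μ * t) / Real.sqrt t = z) ↔ t = stageSize μ x z := by
  have hS : 0 ≤ 4 * x * μ + z ^ 2 := by positivity
  have h := Real.sq_sqrt hS
  have hlt : |z| < Real.sqrt (4 * x * μ + z ^ 2) := by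
    rw [← Real.sqrt_sq_eq_abs]
    exact Real.sqrt_lt_sqrt (sq_nonneg z) (by nlinarith [mul_pos hx hμ])
  have hz1 := abs_lt.1 hlt
  rw [stageSize_eq_sq hμ hx]
  set s := Real.sqrt (4 * x * μ + z ^ 2) with hs
  constructor
  · rintro ⟨ht, he⟩
    have hr : 0 < Real.sqrt t := Real.sqrt_pos.2 ht
    have hrt := Real.sq_sqrt ht.le
    rw [div_eq_iff hr.ne'] at he
    set r := Real.sqrt t with hrdef
    have h2 : (2 * μ * r + z) ^ 2 = s ^ 2 := by
      rw [h]; linear_combination (4 * μ ^ 2) * hrt - 4 * μ * he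
    have h3 : 2 * μ * r + z = s := by
      rcases sq_eq_sq_iff_eq_or_eq_neg.1 h2 with h3 | h3
      · exact h3
      · nlinarith [mul_pos hμ hr]
    rw [← hrt]
    congr 1
    rw [eq_div_iff (by positivity)]
    linarith
  · rintro rfl
    have hp : 0 < (s - z) / (2 * μ) := div_pos (by linarith) (by positivity)
    refine ⟨by positivity, ?_⟩
    rw [Real.sqrt_sq hp.le, div_eq_iff hp.ne']
    field_simp
    linear_combination (-1 : ℝ) * h

/-- Geometric sampling with parameter `z`: end `T_1 + ⋯ + T_k` of the first `k` stages, along the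
path `w` with boundary `a`. -/
def geomEnd (μ z a : ℝ) (w : ℝ≥0 → ℝ) : ℕ → ℝ≥0
  | 0 => 0
  | k + 1 => geomEnd μ z a w k +
      if w (geomEnd μ z a w k) < a then
        (stageSize μ (a - w (geomEnd μ z a w k)) z).toNNReal else 0

/-- Geometric sampling: `T_{k+1} = t(a - X_k, z) · 1{X_k < a}`. -/
def geomSampler (μ z a : ℝ) (w : ℝ≥0 → ℝ) (k : ℕ) : ℝ≥0 :=
  if w (geomEnd μ z a w k) < a then
    (stageSize μ (a - w (geomEnd μ z a w k)) z).toNNReal else 0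

/-- A first stage of size `s`, followed, if the boundary has not been crossed, by the sampler `δ`
applied to the remaining distance and to the path restarted at time `s`. -/
def stageThen (s : ℝ≥0) (δ : ℝ → (ℝ≥0 → ℝ) → ℕ → ℝ≥0) (a : ℝ) (w : ℝ≥0 → ℝ) : ℕ → ℝ≥0
  | 0 => s
  | k + 1 => if w s < a then δ (a - w s) (fun u => w (s + u) - w s) k else 0

/-- The increasing bijection `f x = (6 / √μ) √(x log (x + 1))` of `(0, ∞)`. -/
def spreadFun (μ x : ℝ) : ℝ := 6 / Real.sqrt μ * Real.sqrt (x * Real.log (x + 1))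

/-- The inverse `f⁻¹` on `(0, ∞)`. -/
def spreadInv (μ : ℝ) : ℝ → ℝ := Function.invFunOn (spreadFun μ) (Set.Ioi 0)

/-- The sampler `δ°_{m,h}`, for `m ≥ 1` (the value at `m = 0` is a placeholder). -/
def samplerInterior (μ : ℝ) : ℕ → (ℝ → ℝ) → ℝ → (ℝ≥0 → ℝ) → ℕ → ℝ≥0
  | 0, _ => fun _ _ _ => 0
  | 1, h => fun a w =>
      geomSampler μ (-min (Real.sqrt (h a) / a ^ (1 / 4 : ℝ)) (a ^ (1 / 7 : ℝ))) a w
  | m + 2, h => fun a w =>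
      stageThen (stageSize μ a (Real.sqrt (Real.log (a / h a ^ 2 + 1)))).toNNReal
        (samplerInterior μ (m + 1) (h ∘ spreadInv μ)) a w

/-- The sampler `δ⁺_{m,z}`, for `m ≥ 1` (the value at `m = 0` is a placeholder). -/
def samplerBoundary (μ z : ℝ) : ℕ → ℝ → (ℝ≥0 → ℝ) → ℕ → ℝ≥0
  | 0 => fun _ _ _ => 0
  | 1 => fun a w =>
      stageThen (stageSize μ a z).toNNReal
        (fun y => geomSampler μ (-Real.sqrt (Real.log (y + 1))) y) a w
  | m + 2 => fun a w =>
      stageThen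
        (stageSize μ a
          (Real.sqrt ((1 - (1 / 2 : ℝ) ^ (m + 1)) * Real.log (a + 1)))).toNNReal
        (samplerBoundary μ z (m + 1)) a w

open Classical in
/-- The sampler `δ(a)`: `δ°_{m,h}(a)` inside the band, `δ⁺_{m,z}(a)` on its boundary, applied to
the process `X`. -/
def optSampler {Ω : Type*} (μ : ℝ) (X : ℝ≥0 → Ω → ℝ) (m : ℕ) (h : ℝ → ℝ) (z a : ℝ)
    (k : ℕ) (ω : Ω) : ℝ≥0 :=
  if InBand m h then samplerInterior μ m h a (fun t => X t ω) k
  else samplerBoundary μ z m a (fun t => X t ω) k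

/-- `(R(δ'(a)) - R(δ(a))) / h(a)`, where `T a` are the stage sizes of `δ'(a)`. -/
def excessRatio {Ω : Type*} [MeasurableSpace Ω] (P : Measure Ω) (μ : ℝ) (X : ℝ≥0 → Ω → ℝ)
    (m : ℕ) (h : ℝ → ℝ) (z : ℝ) (T : ℝ → ℕ → Ω → ℝ≥0) (a : ℝ) : EReal :=
  (risk P μ X (h a) a (T a) - risk P μ X (h a) a (optSampler μ X m h z a)) / ((h a : ℝ) : EReal)

end

/-! The argument is by contraposition, and only orders of magnitude matter. If the excess ratio did
not tend to infinity, then, since R(δ(a)) = O(h(a)), the risk of δ'(a) would be O(h(a)) for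
arbitrarily late members of the sequence. But a rule with risk O(h) must, with probability close to
one, stay below the boundary through stage m - 1, and after stage k be at least about
(1/μ)^{1-2^{-k}} F_h^{(k)}(a) away from it. So there are two halves, a lower bound for arbitrary
rules and an upper bound for the given samplers, both resting on the strong Markov property
(`map_increment`).

Lower half. Wald's identity for the rule stopped at the first crossing bounds the expected overshoot
at any single stage by μ E T - a, hence by O(h) (`overshoot_le_of_risk_le`). A stage of size s from
distance y ends, in mean, y - μ s short of the boundary, with standard deviation √s. If y is about c
F with F / h² large, an overshoot O(h) forces the boundary to be at least about √(log (F / h²))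
standard deviations away, which means a shortfall of about √(c / μ) √(F log (F / h²)), while the
noise is negligible (`eventually_stage_short`). Iteration gives `eventually_short`. It can be
repeated m - 1 times because F_h^{(k)} is at least of the order of h_{k+1}², which exceeds h² by a
divergent factor as long as k ≤ m - 2 (`tendsto_undershootIter_div_sq`).

Upper half. The samplers choose each stage as a function of observed distances to the boundary, so
their expected overshoot is controlled by a backward recursion (`stageValue`, `listValue`).
Geometric sampling has an explicit supersolution (`stageValue_geomBound_le`). Each earlier stage
adds an overshoot of admissible order and reduces the distance from y to the order of √(y log y),
and h_m at the reduced distance is of the order of h_{m+1} at the old one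
(`critFun_sqrt_mul_log_le`). A geometric stage crosses with probability at least one half, so E M is
bounded. Wald's identity turns these bounds into a bound for the risk
(`eventually_risk_optSampler_le`). -/

noncomputable section

/-! ### The strong Markov property -/

section StrongMarkov

variable {Ω : Type*} [mΩ : MeasurableSpace Ω]

/-- The filtration generated by the process `X`. -/
def pastFiltration (X : ℝ≥0 → Ω → ℝ) (hX : ∀ t, Measurable (X t)) : Filtration ℝ≥0 mΩ where
  seq := pastSigma X
  mono' _ _ hst := biSup_mono fun _ hr => hr.trans hst
  le' _ := iSup₂_le fun s _ => (hX s).comap_le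

theorem measurable_pastFiltration {X : ℝ≥0 → Ω → ℝ} (hX : ∀ t, Measurable (X t)) {s t : ℝ≥0}
    (hst : s ≤ t) : Measurable[pastFiltration X hX t] (X s) :=
  (comap_measurable (X s)).mono (le_iSup₂_of_le s hst le_rfl) le_rfl

variable {F : Filtration ℝ≥0 mΩ} {τ : Ω → ℝ≥0}

theorem setOf_coe_le_eq {Ω : Type*} (τ : Ω → ℝ≥0) (t : ℝ≥0) :
    {ω | (τ ω : WithTop ℝ≥0) ≤ (t : WithTop ℝ≥0)} = {ω | τ ω ≤ t} :=
  Set.ext fun _ => WithTop.coe_le_coe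

/-- The past of `τ` also requires measurability for the supremum of the filtration. This is
automatic for finite `τ`, because `s` is the union of its parts on `{τ ≤ n}`. -/
theorem MeasureTheory.IsStoppingTime.measurableSet_of_inter
    (hτ : IsStoppingTime F (fun ω => (τ ω : WithTop ℝ≥0))) {s : Set Ω}
    (hs : ∀ t, MeasurableSet[F t] (s ∩ {ω | τ ω ≤ t})) : MeasurableSet[hτ.measurableSpace] s := by
  refine ⟨?_, fun t => by rw [setOf_coe_le_eq]; exact hs t⟩
  have : s = ⋃ n : ℕ, s ∩ {ω | τ ω ≤ n} := by
    ext ω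
    simp only [Set.mem_iUnion, Set.mem_inter_iff, Set.mem_ofPred_eq, exists_and_left,
      iff_self_and]
    exact fun _ => exists_nat_ge (τ ω)
  rw [this]
  exact MeasurableSet.iUnion fun n => le_iSup (fun t => F t) (n : ℝ≥0) _ (hs n)

/-- Turns the defining condition of a sampler, stated with indicators of `{T^k ≤ t}`, into
measurability for the past at the end of the stage. -/
theorem MeasureTheory.IsStoppingTime.measurable_of_indicator
    (hτ : IsStoppingTime F (fun ω => (τ ω : WithTop ℝ≥0))) {β : Type*} [MeasurableSpace β] [Zero β]
    {V : Ω → β} (hV : ∀ t, Measurable[F t] ({ω | τ ω ≤ t}.indicator V)) :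
    Measurable[hτ.measurableSpace] V := by
  intro A hA
  refine hτ.measurableSet_of_inter fun t => ?_
  have : V ⁻¹' A ∩ {ω | τ ω ≤ t} = ({ω | τ ω ≤ t}.indicator V) ⁻¹' A ∩ {ω | τ ω ≤ t} := by
    ext ω
    by_cases h : τ ω ≤ t <;> simp [h]
  rw [this]
  exact (hV t hA).inter (by rw [← setOf_coe_le_eq]; exact hτ t)

theorem MeasureTheory.IsStoppingTime.measurable_self
    (hτ : IsStoppingTime F (fun ω => (τ ω : WithTop ℝ≥0))) : Measurable[hτ.measurableSpace] τ := by
  refine measurable_of_Iic fun t => ?_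
  have := hτ.measurableSet_le' t
  rwa [setOf_coe_le_eq] at this

theorem MeasureTheory.IsStoppingTime.measurableSet_of_subset_le
    (hτ : IsStoppingTime F (fun ω => (τ ω : WithTop ℝ≥0))) {s : Set Ω}
    (hs : MeasurableSet[hτ.measurableSpace] s) {t : ℝ≥0} (hst : ∀ ω ∈ s, τ ω ≤ t) :
    MeasurableSet[F t] s := by
  have h := hs.2 t
  rwa [setOf_coe_le_eq, Set.inter_eq_left.2 (show s ⊆ {ω | τ ω ≤ t} from hst)] at h

theorem MeasureTheory.IsStoppingTime.add_measurable
    (hτ : IsStoppingTime F (fun ω => (τ ω : WithTop ℝ≥0))) {S : Ω → ℝ≥0}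
    (hS : Measurable[hτ.measurableSpace] S) :
    IsStoppingTime F (fun ω => ((τ ω + S ω : ℝ≥0) : WithTop ℝ≥0)) := by
  intro t
  have h : MeasurableSet[hτ.measurableSpace] {ω | τ ω + S ω ≤ t} :=
    (hτ.measurable_self.add hS) measurableSet_Iic
  have h2 := hτ.measurableSet_of_subset_le h (t := t) fun ω hω => le_self_add.trans hω
  rwa [← setOf_coe_le_eq] at h2

theorem MeasureTheory.IsStoppingTime.measurable_value {X : ℝ≥0 → Ω → ℝ}
    {hX : ∀ t, Measurable (X t)} (hc : ∀ ω, Continuous fun t => X t ω)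
    (hτ : IsStoppingTime (pastFiltration X hX) (fun ω => (τ ω : WithTop ℝ≥0))) :
    Measurable[hτ.measurableSpace] (fun ω => X (τ ω) ω) := by
  have h1 : StronglyAdapted (pastFiltration X hX) X := fun t =>
    (measurable_pastFiltration hX le_rfl).stronglyMeasurable
  have := measurable_stoppedValue (h1.isStronglyProgressive_of_continuous hc) hτ
  exact this

/-- The integral over a measurable set as a sum over the values of a countable-valued function. -/
theorem setLIntegral_eq_tsum_fiber {P : Measure Ω} {ι : Type*} [Countable ι] [MeasurableSpace ι]
    [MeasurableSingletonClass ι] {i : Ω → ι} (hi : Measurable i) {A : Set Ω}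
    (hA : MeasurableSet A) (f : Ω → ℝ≥0∞) :
    ∫⁻ ω in A, f ω ∂P = ∑' j, ∫⁻ ω in A ∩ i ⁻¹' {j}, f ω ∂P := by
  rw [← lintegral_iUnion (fun j => hA.inter (hi (measurableSet_singleton j)))]
  · rw [← Set.inter_iUnion, ← Set.preimage_iUnion, Set.iUnion_of_singleton, Set.preimage_univ,
      Set.inter_univ]
  · intro j k hjk
    refine Disjoint.inter_right' _ (Disjoint.inter_left' _ ?_)
    exact Disjoint.preimage _ (by simpa using hjk)

/-- Approximation of `t` from above by multiples of `1 / (n + 1)`. -/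
def gridIndex (n : ℕ) (t : ℝ≥0) : ℕ := ⌊(n + 1 : ℝ≥0) * t⌋₊ + 1

def gridUp (n : ℕ) (t : ℝ≥0) : ℝ≥0 := gridIndex n t / (n + 1)

theorem measurable_gridIndex (n : ℕ) : Measurable (gridIndex n) :=
  (Nat.measurable_floor.comp (measurable_const.mul measurable_id)).add_const 1

theorem le_gridUp (n : ℕ) (t : ℝ≥0) : t ≤ gridUp n t := by
  unfold gridUp gridIndex
  rw [le_div_iff₀ (by positivity), mul_comm]
  push_cast
  exact (Nat.lt_floor_add_one _).le

theorem gridUp_le (n : ℕ) (t : ℝ≥0) : gridUp n t ≤ t + 1 / (n + 1) := by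
  unfold gridUp gridIndex
  rw [div_le_iff₀ (by positivity), add_mul t, one_div_mul_cancel (by positivity)]
  push_cast
  gcongr
  rw [mul_comm t]
  exact Nat.floor_le (by positivity)

theorem tendsto_gridUp (t : ℝ≥0) : Tendsto (fun n => gridUp n t) atTop (𝓝 t) := by
  refine tendsto_of_tendsto_of_tendsto_of_le_of_le tendsto_const_nhds ?_ (fun n => le_gridUp n t)
    (fun n => gridUp_le n t)
  have := (tendsto_one_div_add_atTop_nhds_zero_nat (𝕜 := ℝ≥0)).const_add t
  simpa using this

variable {P : Measure Ω} {μ : ℝ} {X : ℝ≥0 → Ω → ℝ}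

theorem IsDriftBrownian.hasLaw_increment (hX : IsDriftBrownian P μ X) (q r : ℝ≥0) :
    P.map (fun ω => X (q + r) ω - X q ω - μ * r)
      = (gaussianReal 0 1).map (fun x => Real.sqrt r * x) := by
  have h := (hX.brownian.toIsPreBrownianReal.hasLaw_sub (q + r) q).map_eq
  rw [gaussianReal_map_const_mul]
  convert h using 2
  · ext ω
    simp
    ring
  · simp
  · ext
    simp [Real.sq_sqrt, nndist, dist]
    rfl

/-- The drift is deterministic, so the past of `X` is contained in that of the centred process, and
the independence of increments of driftless Brownian motion applies. -/
theorem IsDriftBrownian.indep_increment [IsProbabilityMeasure P]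
    (hX : IsDriftBrownian P μ X) (q r : ℝ≥0) {A : Set Ω}
    (hA : MeasurableSet[pastFiltration X hX.measurable q] A)
    {g : ℝ → ℝ≥0∞} (hg : Measurable g) :
    ∫⁻ ω in A, g (X (q + r) ω - X q ω - μ * r) ∂P
      = P A * ∫⁻ x, g (Real.sqrt r * x) ∂(gaussianReal 0 1) := by
  have hind := hX.brownian.toIsPreBrownianReal.indepFun_shift q
  have hA' : MeasurableSet[MeasurableSpace.comap
      (fun ω (t : Set.Iic q) => X t ω - μ * (t : ℝ≥0)) MeasurableSpace.pi] A := by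
    refine (iSup₂_le fun s hs => ?_ : pastSigma X q ≤ _) A hA
    rw [← measurable_iff_comap_le]
    have h1 := ((measurable_pi_apply (X := fun _ : Set.Iic q => ℝ)
      (⟨s, hs⟩ : Set.Iic q)).comp (comap_measurable
        (fun ω (t : Set.Iic q) => X t ω - μ * (t : ℝ≥0)))).add_const (μ * s)
    simpa [Function.comp_def] using h1
  obtain ⟨B, hB, rfl⟩ := hA'
  have hmeas : Measurable (fun ω (t : Set.Iic q) => X t ω - μ * (t : ℝ≥0)) :=
    measurable_pi_lambda _ fun t => (hX.measurable t).sub_const _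
  have hinc : Measurable (fun ω => X (q + r) ω - X q ω - μ * r) :=
    ((hX.measurable _).sub (hX.measurable _)).sub_const _
  have hind2 : IndepFun (fun ω => X (q + r) ω - X q ω - μ * r)
      (fun ω (t : Set.Iic q) => X t ω - μ * (t : ℝ≥0)) P := by
    have h1 := hind.comp (φ := fun w : ℝ≥0 → ℝ => w r) (ψ := id)
      (measurable_pi_apply (X := fun _ : ℝ≥0 => ℝ) r) measurable_id
    refine h1.congr (ae_of_all _ fun ω => ?_) (ae_of_all _ fun ω => rfl)
    simp
    ring
  rw [← lintegral_indicator (hmeas hB)]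
  have h2 : ∀ ω, ((fun ω (t : Set.Iic q) => X t ω - μ * (t : ℝ≥0)) ⁻¹' B).indicator
      (fun ω => g (X (q + r) ω - X q ω - μ * r)) ω
      = ((g ∘ (fun ω => X (q + r) ω - X q ω - μ * r) : Ω → ℝ≥0∞) *
        ((B.indicator (1 : (Set.Iic q → ℝ) → ℝ≥0∞)) ∘
          (fun ω (t : Set.Iic q) => X t ω - μ * (t : ℝ≥0))
          : Ω → ℝ≥0∞)) ω := by
    intro ω
    simp only [Set.indicator, Pi.mul_apply, Function.comp, Set.mem_preimage, Pi.one_apply]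
    by_cases hB' : (fun t : Set.Iic q => X t ω - μ * (t : ℝ≥0)) ∈ B <;> simp [hB']
  rw [lintegral_congr h2, lintegral_mul_eq_lintegral_mul_lintegral_of_indepFun
    (hg.comp hinc) ((measurable_one.indicator hB).comp hmeas)
    (hind2.comp hg (measurable_one.indicator hB)), mul_comm]
  congr 1
  · rw [← lintegral_indicator_one (hmeas hB)]
    rfl
  · have := congrArg (fun ν => ∫⁻ x, g x ∂ν) (hX.hasLaw_increment q r)
    rw [lintegral_map hg hinc, lintegral_map hg (by fun_prop)] at this
    exact this

variable {S : Ω → ℝ≥0}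

/-- Both `τ` and `S` are rounded up, so on each of countably many cells they are constants `q` and
`r`. A cell lies in `{τ ≤ q}`, hence is an event of time `q`, and the increment over `[q, q + r]` is
independent of it. -/
theorem IsDriftBrownian.setLIntegral_grid [IsProbabilityMeasure P] (hX : IsDriftBrownian P μ X)
    (hτ : IsStoppingTime (pastFiltration X hX.measurable) (fun ω => (τ ω : WithTop ℝ≥0)))
    (hS : Measurable[hτ.measurableSpace] S) {A : Set Ω} (hA : MeasurableSet[hτ.measurableSpace] A)
    {g : ℝ → ℝ≥0∞} (hg : Measurable g) (n : ℕ) :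
    ∫⁻ ω in A, g (X (gridUp n (τ ω) + gridUp n (S ω)) ω - X (gridUp n (τ ω)) ω
        - μ * gridUp n (S ω)) ∂P
      = ∫⁻ ω in A, ∫⁻ x, g (Real.sqrt (gridUp n (S ω)) * x) ∂(gaussianReal 0 1) ∂P := by
  have hle := hτ.measurableSpace_le
  have hi : Measurable[hτ.measurableSpace] fun ω => (gridIndex n (τ ω), gridIndex n (S ω)) :=
    Measurable.prodMk ((measurable_gridIndex n).comp hτ.measurable_self)
      ((measurable_gridIndex n).comp hS)
  have hi' := hi.mono hle le_rfl
  rw [setLIntegral_eq_tsum_fiber hi' (hle _ hA), setLIntegral_eq_tsum_fiber hi' (hle _ hA)]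
  refine tsum_congr fun j => ?_
  set B := A ∩ (fun ω => (gridIndex n (τ ω), gridIndex n (S ω))) ⁻¹' {j} with hB
  have hBm : MeasurableSet[hτ.measurableSpace] B := hA.inter (hi (measurableSet_singleton j))
  set q : ℝ≥0 := j.1 / (n + 1)
  set r : ℝ≥0 := j.2 / (n + 1)
  have hq : ∀ ω ∈ B, gridUp n (τ ω) = q ∧ gridUp n (S ω) = r := by
    rintro ω ⟨-, hω⟩
    rw [Set.mem_preimage, Set.mem_singleton_iff] at hω
    subst hω
    exact ⟨rfl, rfl⟩
  have hBq : MeasurableSet[pastFiltration X hX.measurable q] B :=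
    hτ.measurableSet_of_subset_le hBm fun ω hω => (le_gridUp n _).trans (hq ω hω).1.le
  calc _ = ∫⁻ ω in B, g (X (q + r) ω - X q ω - μ * r) ∂P :=
        setLIntegral_congr_fun (hle _ hBm) fun ω hω => by simp only [(hq ω hω).1, (hq ω hω).2]
    _ = P B * ∫⁻ x, g (Real.sqrt r * x) ∂(gaussianReal 0 1) := hX.indep_increment q r hBq hg
    _ = ∫⁻ ω in B, ∫⁻ x, g (Real.sqrt r * x) ∂(gaussianReal 0 1) ∂P := by
        rw [setLIntegral_const, mul_comm]
    _ = _ := setLIntegral_congr_fun (hle _ hBm) fun ω hω => by simp only [(hq ω hω).2]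

theorem IsDriftBrownian.measurable_increment (hX : IsDriftBrownian P μ X)
    (hτ : IsStoppingTime (pastFiltration X hX.measurable) (fun ω => (τ ω : WithTop ℝ≥0)))
    (hS : Measurable[hτ.measurableSpace] S) :
    Measurable (fun ω => X (τ ω + S ω) ω - X (τ ω) ω - μ * S ω) := by
  have h1 := (hτ.measurable_value hX.continuous_path).mono hτ.measurableSpace_le le_rfl
  have hσ := hτ.add_measurable hS
  have h2 := (hσ.measurable_value hX.continuous_path).mono hσ.measurableSpace_le le_rfl
  have h3 := hS.mono hτ.measurableSpace_le le_rfl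
  exact (h2.sub h1).sub (measurable_const.mul h3.coe_nnreal_real)

/-- Limit of the grid version: the rounded times converge, paths and `g` are continuous and `g` is
bounded, so dominated convergence applies on both sides. -/
theorem IsDriftBrownian.setLIntegral_increment [IsProbabilityMeasure P] (hX : IsDriftBrownian P μ X)
    (hτ : IsStoppingTime (pastFiltration X hX.measurable) (fun ω => (τ ω : WithTop ℝ≥0)))
    (hS : Measurable[hτ.measurableSpace] S) {A : Set Ω} (hA : MeasurableSet[hτ.measurableSpace] A)
    (g : BoundedContinuousFunction ℝ ℝ≥0) :
    ∫⁻ ω in A, (g (X (τ ω + S ω) ω - X (τ ω) ω - μ * S ω) : ℝ≥0∞) ∂P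
      = ∫⁻ ω in A, ∫⁻ x, (g (Real.sqrt (S ω) * x) : ℝ≥0∞) ∂(gaussianReal 0 1) ∂P := by
  have hle := hτ.measurableSpace_le
  have hgm : Measurable fun x => (g x : ℝ≥0∞) := g.continuous.measurable.coe_nnreal_ennreal
  obtain ⟨K, hK⟩ : ∃ K : ℝ≥0, ∀ x, g x ≤ K := by
    refine ⟨nndist g 0, fun x => ?_⟩
    have := BoundedContinuousFunction.nndist_coe_le_nndist (f := g) (g := 0) x
    simpa [NNReal.nndist_zero_eq_val'] using this
  have hSm : Measurable S := hS.mono hle le_rfl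
  have hτm : Measurable τ := hτ.measurable_self.mono hle le_rfl
  have hgridm : ∀ n, Measurable (gridUp n) := fun n =>
    ((measurable_from_nat (f := fun k : ℕ => (k : ℝ≥0))).comp (measurable_gridIndex n)).div_const _
  have hval : ∀ σ : Ω → ℝ≥0, Measurable σ → Measurable fun ω => X (σ ω) ω := fun σ hσ =>
    (stronglyMeasurable_uncurry_of_continuous_of_stronglyMeasurable (u := X)
      hX.continuous_path (fun t => (hX.measurable t).stronglyMeasurable)).measurable.comp
        (hσ.prodMk measurable_id)
  have h1 : Tendsto (fun n => ∫⁻ ω in A, (g (X (gridUp n (τ ω) + gridUp n (S ω)) ω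
      - X (gridUp n (τ ω)) ω - μ * gridUp n (S ω)) : ℝ≥0∞) ∂P) atTop
      (𝓝 (∫⁻ ω in A, (g (X (τ ω + S ω) ω - X (τ ω) ω - μ * S ω) : ℝ≥0∞) ∂P)) := by
    refine tendsto_lintegral_of_dominated_convergence (fun _ => K) (fun n => ?_) (fun n => ?_) ?_ ?_
    · have a1 := (hgridm n).comp hτm
      have a2 := (hgridm n).comp hSm
      exact hgm.comp (((hval _ (a1.add a2)).sub (hval _ a1)).sub
        (measurable_const.mul a2.coe_nnreal_real))
    · exact ae_of_all _ fun ω => by simpa using hK _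
    · simp [ENNReal.mul_eq_top]
    · refine ae_of_all _ fun ω => ?_
      refine (ENNReal.continuous_coe.tendsto _).comp ((g.continuous.tendsto _).comp ?_)
      have b1 := tendsto_gridUp (τ ω)
      have b2 := tendsto_gridUp (S ω)
      have hc := hX.continuous_path ω
      exact (((hc.tendsto _).comp (b1.add b2)).sub ((hc.tendsto _).comp b1)).sub
        (((NNReal.continuous_coe.tendsto _).comp b2).const_mul μ)
  have h2 : Tendsto (fun n => ∫⁻ ω in A, ∫⁻ x, (g (Real.sqrt (gridUp n (S ω)) * x) : ℝ≥0∞)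
      ∂(gaussianReal 0 1) ∂P) atTop
      (𝓝 (∫⁻ ω in A, ∫⁻ x, (g (Real.sqrt (S ω) * x) : ℝ≥0∞) ∂(gaussianReal 0 1) ∂P)) := by
    refine tendsto_lintegral_of_dominated_convergence (fun _ => K) (fun n => ?_) (fun n => ?_) ?_ ?_
    · have a2 := (hgridm n).comp hSm
      refine Measurable.lintegral_prod_right' (f := fun p : Ω × ℝ =>
        (g (Real.sqrt (gridUp n (S p.1)) * p.2) : ℝ≥0∞)) (hgm.comp ?_)
      exact (Real.continuous_sqrt.measurable.comp
        (a2.comp measurable_fst).coe_nnreal_real).mul measurable_snd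
    · refine ae_of_all _ fun ω => ?_
      refine (lintegral_mono fun x => (by simpa using hK _ : (g _ : ℝ≥0∞) ≤ K)).trans ?_
      simp
    · simp [ENNReal.mul_eq_top]
    · refine ae_of_all _ fun ω => ?_
      refine tendsto_lintegral_of_dominated_convergence (fun _ => K) (fun n => ?_) (fun n => ?_)
        ?_ ?_
      · exact hgm.comp (measurable_const.mul measurable_id)
      · exact ae_of_all _ fun x => by simpa using hK _
      · simp
      · refine ae_of_all _ fun x => ?_
        refine (ENNReal.continuous_coe.tendsto _).comp ((g.continuous.tendsto _).comp ?_)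
        exact ((Real.continuous_sqrt.tendsto _).comp
          ((NNReal.continuous_coe.tendsto _).comp (tendsto_gridUp (S ω)))).mul_const x
  refine tendsto_nhds_unique h1 (h2.congr fun n => ?_)
  exact (hX.setLIntegral_grid hτ hS hA hgm n).symm

/-- **Strong Markov property**, in the form needed for multistage sampling: conditionally on the
past up to the stopping time `τ`, the centred increment over a further time `S` that is determined
by that past is normal with variance `S`. -/
theorem IsDriftBrownian.map_increment [IsProbabilityMeasure P] (hX : IsDriftBrownian P μ X)
    (hτ : IsStoppingTime (pastFiltration X hX.measurable) (fun ω => (τ ω : WithTop ℝ≥0)))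
    (hS : Measurable[hτ.measurableSpace] S) {β : Type*} [MeasurableSpace β] {V : Ω → β}
    (hV : Measurable[hτ.measurableSpace] V) :
    P.map (fun ω => (V ω, X (τ ω + S ω) ω - X (τ ω) ω - μ * S ω))
      = (P.prod (gaussianReal 0 1)).map (fun p => (V p.1, Real.sqrt (S p.1) * p.2)) := by
  have hle := hτ.measurableSpace_le
  have hSm : Measurable S := hS.mono hle le_rfl
  have hVm : Measurable V := hV.mono hle le_rfl
  have hW := hX.measurable_increment hτ hS
  have hsq : Measurable fun p : Ω × ℝ => Real.sqrt (S p.1) * p.2 :=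
    (Real.continuous_sqrt.measurable.comp
        (hSm.comp measurable_fst).coe_nnreal_real).mul measurable_snd
  have hm1 : Measurable (fun ω => (V ω, X (τ ω + S ω) ω - X (τ ω) ω - μ * S ω)) := hVm.prodMk hW
  have hm2 : Measurable (fun p : Ω × ℝ => (V p.1, Real.sqrt (S p.1) * p.2)) :=
    (hVm.comp measurable_fst).prodMk hsq
  have : IsFiniteMeasure (P.map (fun ω => (V ω, X (τ ω + S ω) ω - X (τ ω) ω - μ * S ω))) :=
    inferInstance
  -- Rectangles determine the joint law. The event `V ∈ s` is absorbed into a restricted measure,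
  -- under which bounded continuous test functions identify the law of the increment.
  refine Measure.ext_prod fun {s t} hs ht => ?_
  have key : (P.restrict (V ⁻¹' s)).map (fun ω => X (τ ω + S ω) ω - X (τ ω) ω - μ * S ω)
      = ((P.restrict (V ⁻¹' s)).prod (gaussianReal 0 1)).map
        (fun p => Real.sqrt (S p.1) * p.2) := by
    refine ext_of_forall_lintegral_eq_of_IsFiniteMeasure fun g => ?_
    have hgm : Measurable fun x => (g x : ℝ≥0∞) := g.continuous.measurable.coe_nnreal_ennreal
    rw [lintegral_map hgm hW, lintegral_map hgm hsq,
      lintegral_prod (fun p : Ω × ℝ => (g (Real.sqrt (S p.1) * p.2) : ℝ≥0∞))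
      (hgm.comp hsq).aemeasurable]
    exact hX.setLIntegral_increment hτ hS (hV hs) g
  have key2 := congrArg (fun ν => ν t) key
  rw [Measure.map_apply hW ht, Measure.map_apply hsq ht, Measure.restrict_apply (hW ht)] at key2
  rw [Measure.map_apply hm1 (hs.prod ht), Measure.map_apply hm2 (hs.prod ht)]
  have e1 : (fun ω => (V ω, X (τ ω + S ω) ω - X (τ ω) ω - μ * S ω)) ⁻¹' s ×ˢ t
      = (fun ω => X (τ ω + S ω) ω - X (τ ω) ω - μ * S ω) ⁻¹' t ∩ V ⁻¹' s := by
    ext ω; simp [and_comm]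
  rw [e1, key2]
  have e2 : (P.restrict (V ⁻¹' s)).prod (gaussianReal 0 1)
      = (P.prod (gaussianReal 0 1)).restrict ((V ⁻¹' s) ×ˢ Set.univ) := by
    rw [← Measure.prod_restrict, Measure.restrict_univ]
  rw [e2, Measure.restrict_apply (hsq ht)]
  congr 1
  ext p
  simp [and_comm]

theorem IsDriftBrownian.lintegral_increment [IsProbabilityMeasure P] (hX : IsDriftBrownian P μ X)
    (hτ : IsStoppingTime (pastFiltration X hX.measurable) (fun ω => (τ ω : WithTop ℝ≥0)))
    (hS : Measurable[hτ.measurableSpace] S) {β : Type*} [MeasurableSpace β] {V : Ω → β}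
    (hV : Measurable[hτ.measurableSpace] V) {g : β × ℝ → ℝ≥0∞} (hg : Measurable g) :
    ∫⁻ ω, g (V ω, X (τ ω + S ω) ω - X (τ ω) ω - μ * S ω) ∂P
      = ∫⁻ ω, ∫⁻ x, g (V ω, Real.sqrt (S ω) * x) ∂(gaussianReal 0 1) ∂P := by
  have hle := hτ.measurableSpace_le
  have hSm : Measurable S := hS.mono hle le_rfl
  have hVm : Measurable V := hV.mono hle le_rfl
  have hW := hX.measurable_increment hτ hS
  have hsq : Measurable fun p : Ω × ℝ => Real.sqrt (S p.1) * p.2 :=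
    (Real.continuous_sqrt.measurable.comp
        (hSm.comp measurable_fst).coe_nnreal_real).mul measurable_snd
  have hm2 : Measurable (fun p : Ω × ℝ => (V p.1, Real.sqrt (S p.1) * p.2)) :=
    (hVm.comp measurable_fst).prodMk hsq
  have h := congrArg (fun ν => ∫⁻ p, g p ∂ν) (hX.map_increment hτ hS hV)
  rw [lintegral_map hg (hVm.prodMk hW), lintegral_map hg hm2,
    lintegral_prod (fun p : Ω × ℝ => g (V p.1, Real.sqrt (S p.1) * p.2))
      (hg.comp hm2).aemeasurable] at h
  exact h

end StrongMarkov

/-! ### Expected excess of a normal variable -/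

section NormalExcess

/-- The expected excess `E (s Z - c)⁺` for a standard normal variable `Z`. -/
def normalExcess (s c : ℝ) : ℝ := ∫ x, max (s * x - c) 0 ∂(gaussianReal 0 1)

theorem integrable_id_stdGaussian : Integrable (fun x : ℝ => x) (gaussianReal 0 1) := by
  have := (memLp_id_gaussianReal (μ := 0) (v := 1) 1).integrable le_rfl
  exact this

theorem integrable_sq_stdGaussian : Integrable (fun x : ℝ => x ^ 2) (gaussianReal 0 1) := by
  have := (memLp_id_gaussianReal (μ := 0) (v := 1) 2).integrable_sq
  simpa using this

theorem integral_sq_stdGaussian : ∫ x : ℝ, x ^ 2 ∂(gaussianReal 0 1) = 1 := by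
  have h := variance_id_gaussianReal (μ := 0) (v := 1)
  rw [variance_eq_sub (memLp_id_gaussianReal 2)] at h
  simpa using h

theorem integrable_excess (s c : ℝ) :
    Integrable (fun x : ℝ => max (s * x - c) 0) (gaussianReal 0 1) :=
  ((integrable_id_stdGaussian.const_mul s).sub (integrable_const c)).pos_part

theorem normalExcess_nonneg (s c : ℝ) : 0 ≤ normalExcess s c :=
  integral_nonneg fun _ => le_max_right _ _

theorem lintegral_excess (s c : ℝ) :
    ∫⁻ x, ENNReal.ofReal (s * x - c) ∂(gaussianReal 0 1) = ENNReal.ofReal (normalExcess s c) := by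
  rw [normalExcess, ofReal_integral_eq_lintegral_ofReal (integrable_excess s c)
    (ae_of_all _ fun _ => le_max_right _ _)]
  refine lintegral_congr fun x => ?_
  rcases le_total (s * x - c) 0 with h | h
  · simp [h]
  · simp [h]

/-- The positive parts of `c - s x` and `s x - c` differ by `c - s x`, whose mean is `c`. -/
theorem lintegral_deficit (s c : ℝ) :
    ∫⁻ x, ENNReal.ofReal (c - s * x) ∂(gaussianReal 0 1)
      = ENNReal.ofReal (normalExcess s c + c) := by
  have h : ∀ x, max (c - s * x) 0 = max (s * x - c) 0 + (c - s * x) := by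
    intro x
    rcases le_total (s * x) c with h | h
    · rw [max_eq_left (by linarith), max_eq_right (by linarith)]; ring
    · rw [max_eq_right (by linarith), max_eq_left (by linarith)]; ring
  have hi : Integrable (fun x : ℝ => c - s * x) (gaussianReal 0 1) :=
    (integrable_const c).sub (integrable_id_stdGaussian.const_mul s)
  have h2 : ∫ x, max (c - s * x) 0 ∂(gaussianReal 0 1) = normalExcess s c + c := by
    simp_rw [h]
    rw [integral_add (integrable_excess s c) hi, integral_sub (integrable_const c)
      (integrable_id_stdGaussian.const_mul s), integral_const_mul, integral_id_gaussianReal]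
    simp [normalExcess]
  rw [← h2, ofReal_integral_eq_lintegral_ofReal hi.pos_part
    (ae_of_all _ fun _ => le_max_right _ _)]
  refine lintegral_congr fun x => ?_
  rcases le_total (c - s * x) 0 with h | h
  · simp [h]
  · simp [h]

theorem normalExcess_add_nonneg (s c : ℝ) : 0 ≤ normalExcess s c + c := by
  have : c ≤ c + normalExcess s c := by linarith [normalExcess_nonneg s c]
  have h : ∫ x, (s * x - c) ∂(gaussianReal 0 1) ≤ normalExcess s c :=
    integral_mono ((integrable_id_stdGaussian.const_mul s).sub (integrable_const c))
      (integrable_excess s c) fun x => le_max_left _ _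
  rw [integral_sub (integrable_id_stdGaussian.const_mul s) (integrable_const c),
    integral_const_mul, integral_id_gaussianReal] at h
  simp at h
  linarith

theorem normalExcess_le (s c : ℝ) (hs : 0 ≤ s) : normalExcess s c ≤ s + |c| := by
  have h1 : normalExcess s c ≤ ∫ x, (s * ((1 + x ^ 2) / 2) + |c|) ∂(gaussianReal 0 1) := by
    refine integral_mono (integrable_excess s c) ?_ fun x => ?_
    · exact ((((integrable_const 1).add integrable_sq_stdGaussian).div_const 2).const_mul s).add
        (integrable_const _)
    · refine max_le ?_ (by positivity)
      nlinarith [sq_nonneg (x - 1), neg_abs_le c, mul_nonneg hs (sq_nonneg (x - 1))]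
  refine h1.trans_eq ?_
  rw [integral_add _ (integrable_const _), integral_const_mul, integral_div,
    integral_add (integrable_const _) integrable_sq_stdGaussian, integral_sq_stdGaussian]
  · simp
  · exact ((((integrable_const 1).add integrable_sq_stdGaussian).div_const 2).const_mul s)

theorem lintegral_sq_shift (s w : ℝ) :
    ∫⁻ x, ENNReal.ofReal ((w + s * x) ^ 2) ∂(gaussianReal 0 1)
      = ENNReal.ofReal (w ^ 2) + ENNReal.ofReal (s ^ 2) := by
  have h : ∀ x, (w + s * x) ^ 2 = w ^ 2 + (2 * w * s) * x + s ^ 2 * x ^ 2 := fun x => by ring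
  have i1 : Integrable (fun x : ℝ => w ^ 2 + (2 * w * s) * x) (gaussianReal 0 1) :=
    (integrable_const _).add (integrable_id_stdGaussian.const_mul _)
  have i2 := integrable_sq_stdGaussian.const_mul (s ^ 2)
  rw [← ofReal_integral_eq_lintegral_ofReal _ (ae_of_all _ fun x => sq_nonneg _),
    ← ENNReal.ofReal_add (sq_nonneg _) (sq_nonneg _)]
  · congr 1
    simp_rw [h]
    rw [integral_add i1 i2, integral_add (integrable_const _)
      (integrable_id_stdGaussian.const_mul _), integral_const_mul, integral_const_mul,
      integral_id_gaussianReal, integral_sq_stdGaussian]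
    simp
  · simp_rw [h]
    exact i1.add i2

end NormalExcess

/-! ### Stagewise analysis of sampling rules -/

section Rules

variable {Ω : Type*} [mΩ : MeasurableSpace Ω]

theorem stageEnd_zero {Ω : Type*} (T : ℕ → Ω → ℝ≥0) (ω : Ω) : stageEnd T 0 ω = 0 := by
  simp [stageEnd]

theorem stageEnd_succ {Ω : Type*} (T : ℕ → Ω → ℝ≥0) (k : ℕ) (ω : Ω) :
    stageEnd T (k + 1) ω = stageEnd T k ω + T k ω := by simp [stageEnd, Finset.sum_range_succ]

/-- Every stage ends at a stopping time, and the size of the next stage is determined by the past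
up to that time. -/
def IsAdaptedRule (F : Filtration ℝ≥0 mΩ) (T : ℕ → Ω → ℝ≥0) : Prop :=
  ∀ k, ∃ hτ : IsStoppingTime F (fun ω => (stageEnd T k ω : WithTop ℝ≥0)),
    Measurable[hτ.measurableSpace] (T k)

variable {F : Filtration ℝ≥0 mΩ} {T : ℕ → Ω → ℝ≥0}

theorem IsAdaptedRule.isStoppingTime (hT : IsAdaptedRule F T) (k : ℕ) :
    IsStoppingTime F (fun ω => (stageEnd T k ω : WithTop ℝ≥0)) := (hT k).choose

/-- The sigma-algebra of the past up to the end of the first `k` stages. -/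
abbrev IsAdaptedRule.past (hT : IsAdaptedRule F T) (k : ℕ) : MeasurableSpace Ω :=
  (hT.isStoppingTime k).measurableSpace

theorem IsAdaptedRule.measurable_stage (hT : IsAdaptedRule F T) (k : ℕ) :
    Measurable[hT.past k] (T k) := (hT k).choose_spec

/-- If `T^k` is a stopping time and the next stage size belongs to its past, then `T^{k+1}` is a
stopping time. By induction it suffices to check each stage size assuming that the current end is a
stopping time. -/
theorem IsAdaptedRule.of_forall
    (h : ∀ k, ∀ hτ : IsStoppingTime F (fun ω => (stageEnd T k ω : WithTop ℝ≥0)),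
      Measurable[hτ.measurableSpace] (T k)) : IsAdaptedRule F T := by
  intro k
  induction k with
  | zero =>
    have h0 : IsStoppingTime F (fun ω => (stageEnd T 0 ω : WithTop ℝ≥0)) := by
      simp_rw [stageEnd_zero]
      exact isStoppingTime_const F 0
    exact ⟨h0, h 0 h0⟩
  | succ k ih =>
    obtain ⟨hk, hm⟩ := ih
    have h1 : IsStoppingTime F (fun ω => (stageEnd T (k + 1) ω : WithTop ℝ≥0)) := by
      simp_rw [stageEnd_succ]
      exact hk.add_measurable hm
    exact ⟨h1, h _ h1⟩

theorem IsAdaptedRule.past_le (hT : IsAdaptedRule F T) (k : ℕ) : hT.past k ≤ mΩ :=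
  (hT.isStoppingTime k).measurableSpace_le

theorem IsAdaptedRule.past_mono (hT : IsAdaptedRule F T) {j k : ℕ} (hjk : j ≤ k) :
    hT.past j ≤ hT.past k := by
  refine (hT.isStoppingTime j).measurableSpace_mono (hT.isStoppingTime k) fun ω => ?_
  refine WithTop.coe_le_coe.2 ?_
  exact Finset.sum_le_sum_of_subset (Finset.range_mono hjk)

theorem IsAdaptedRule.measurable_stageEnd (hT : IsAdaptedRule F T) (k : ℕ) :
    Measurable[hT.past k] (stageEnd T k) := (hT.isStoppingTime k).measurable_self

variable {P : Measure Ω} {μ : ℝ} {X : ℝ≥0 → Ω → ℝ}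

theorem IsSamplingRule.isAdaptedRule {hm : ∀ t, Measurable (X t)} (hT : IsSamplingRule X T) :
    IsAdaptedRule (pastFiltration X hm) T :=
  .of_forall fun k hτ => hτ.measurable_of_indicator fun t => hT k t

theorem IsDriftBrownian.measurable_stagePos (hX : IsDriftBrownian P μ X)
    (hT : IsAdaptedRule (pastFiltration X hX.measurable) T) (k : ℕ) :
    Measurable[hT.past k] (stagePos X T k) :=
  (hT.isStoppingTime k).measurable_value hX.continuous_path

theorem IsDriftBrownian.measurable_stagePos' (hX : IsDriftBrownian P μ X)
    (hT : IsAdaptedRule (pastFiltration X hX.measurable) T) (k : ℕ) :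
    Measurable (stagePos X T k) := (hX.measurable_stagePos hT k).mono (hT.past_le k) le_rfl

theorem IsAdaptedRule.measurable_stage' (hT : IsAdaptedRule F T) (k : ℕ) : Measurable (T k) :=
  (hT.measurable_stage k).mono (hT.past_le k) le_rfl

theorem IsAdaptedRule.measurable_stageEnd' (hT : IsAdaptedRule F T) (k : ℕ) :
    Measurable (stageEnd T k) := (hT.measurable_stageEnd k).mono (hT.past_le k) le_rfl

/-- One stage of sampling: the position at the end of the next stage, given the past. -/
theorem IsDriftBrownian.lintegral_stage [IsProbabilityMeasure P] (hX : IsDriftBrownian P μ X)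
    (hT : IsAdaptedRule (pastFiltration X hX.measurable) T) (k : ℕ)
    {β : Type*} [MeasurableSpace β] {V : Ω → β} (hV : Measurable[hT.past k] V)
    {g : β × ℝ → ℝ≥0∞} (hg : Measurable g) :
    ∫⁻ ω, g (V ω, stagePos X T (k + 1) ω) ∂P
      = ∫⁻ ω, ∫⁻ x, g (V ω, stagePos X T k ω + μ * T k ω + Real.sqrt (T k ω) * x)
          ∂(gaussianReal 0 1) ∂P := by
  have hVX : Measurable[hT.past k] fun ω => (V ω, stagePos X T k ω + μ * T k ω) :=
    hV.prodMk ((hX.measurable_stagePos hT k).add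
      ((hT.measurable_stage k).coe_nnreal_real.const_mul μ))
  have hg' : Measurable fun p : (β × ℝ) × ℝ => g (p.1.1, p.1.2 + p.2) :=
    hg.comp ((measurable_fst.comp measurable_fst).prodMk
      ((measurable_snd.comp measurable_fst).add measurable_snd))
  have h := hX.lintegral_increment (hT.isStoppingTime k) (hT.measurable_stage k) hVX hg'
  simp only at h
  rw [← h]
  refine lintegral_congr fun ω => ?_
  congr 2
  simp only [stagePos, stageEnd_succ]
  ring

/-- Expected time plus undershoot balances expected overshoot, stage by stage. -/
theorem IsDriftBrownian.wald_stage [IsProbabilityMeasure P] (hX : IsDriftBrownian P μ X)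
    (hμ : 0 < μ) (hT : IsAdaptedRule (pastFiltration X hX.measurable) T) (a : ℝ) (k : ℕ) :
    ∫⁻ ω, (ENNReal.ofReal (μ * stageEnd T (k + 1) ω)
        + ENNReal.ofReal (a - stagePos X T (k + 1) ω)) ∂P
      + ∫⁻ ω, ENNReal.ofReal (stagePos X T k ω - a) ∂P
    = ∫⁻ ω, (ENNReal.ofReal (μ * stageEnd T k ω) + ENNReal.ofReal (a - stagePos X T k ω)) ∂P
      + ∫⁻ ω, ENNReal.ofReal (stagePos X T (k + 1) ω - a) ∂P := by
  have hVm : Measurable[hT.past k] fun ω => stageEnd T (k + 1) ω := by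
    simp_rw [stageEnd_succ]
    exact (hT.measurable_stageEnd k).add (hT.measurable_stage k)
  have hp := hX.measurable_stagePos' hT
  have he := hT.measurable_stageEnd'
  have h1 := hX.lintegral_stage hT k hVm
    (g := fun p => ENNReal.ofReal (μ * p.1) + ENNReal.ofReal (a - p.2))
    ((measurable_fst.coe_nnreal_real.const_mul μ).ennreal_ofReal.add
      (measurable_snd.const_sub a).ennreal_ofReal)
  have h2 := hX.lintegral_stage hT k hVm (g := fun p => ENNReal.ofReal (p.2 - a))
    (measurable_snd.sub_const a).ennreal_ofReal
  simp only at h1 h2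
  rw [h1, h2, ← lintegral_add_right _ ((hp k).sub_const a).ennreal_ofReal,
    ← lintegral_add_left (f := fun ω => ENNReal.ofReal (μ * stageEnd T k ω)
        + ENNReal.ofReal (a - stagePos X T k ω))
      (((he k).coe_nnreal_real.const_mul μ).ennreal_ofReal.add
        ((hp k).const_sub a).ennreal_ofReal)]
  refine lintegral_congr fun ω => ?_
  rw [lintegral_add_left measurable_const, lintegral_const, measure_univ, mul_one]
  have e1 : ∀ x : ℝ, a - (stagePos X T k ω + μ * T k ω + Real.sqrt (T k ω) * x)
      = (a - stagePos X T k ω - μ * T k ω) - Real.sqrt (T k ω) * x := fun x => by ring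
  have e2 : ∀ x : ℝ, stagePos X T k ω + μ * T k ω + Real.sqrt (T k ω) * x - a
      = Real.sqrt (T k ω) * x - (a - stagePos X T k ω - μ * T k ω) := fun x => by ring
  simp_rw [e1, e2]
  -- One number is both the expected overshoot and, after adding the mean remaining distance, the
  -- expected undershoot. The balance is then linear on either side of the boundary.
  rw [lintegral_deficit, lintegral_excess, stageEnd_succ]
  have hn := normalExcess_add_nonneg (Real.sqrt (T k ω)) (a - stagePos X T k ω - μ * T k ω)
  have hn' := normalExcess_nonneg (Real.sqrt (T k ω)) (a - stagePos X T k ω - μ * T k ω)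
  generalize normalExcess (Real.sqrt (T k ω)) (a - stagePos X T k ω - μ * T k ω) = N at hn hn'
  have t1 : 0 ≤ μ * (T k ω : ℝ) := by positivity
  have t2 : 0 ≤ μ * (stageEnd T k ω : ℝ) := by positivity
  push_cast
  rcases le_total (stagePos X T k ω) a with h | h
  · rw [ENNReal.ofReal_of_nonpos (sub_nonpos.2 h), add_zero,
      ← ENNReal.ofReal_add (by positivity) hn, ← ENNReal.ofReal_add t2 (sub_nonneg.2 h),
      ← ENNReal.ofReal_add (by linarith) hn']
    congr 1
    ring
  · rw [ENNReal.ofReal_of_nonpos (p := a - stagePos X T k ω) (sub_nonpos.2 h), add_zero,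
      ← ENNReal.ofReal_add (by positivity) hn,
      ← ENNReal.ofReal_add (by positivity) (sub_nonneg.2 h), ← ENNReal.ofReal_add t2 hn']
    congr 1
    ring

/-- Accumulates the stagewise balances. All terms are nonnegative and live in `[0, ∞]`; finiteness
of the earlier overshoots is what permits cancelling them. -/
theorem IsDriftBrownian.wald [IsProbabilityMeasure P] (hX : IsDriftBrownian P μ X)
    (hμ : 0 < μ) (hT : IsAdaptedRule (pastFiltration X hX.measurable) T) {a : ℝ} (ha : 0 ≤ a)
    (k : ℕ) (hfin : ∀ j < k, ∫⁻ ω, ENNReal.ofReal (stagePos X T j ω - a) ∂P ≠ ⊤) :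
    ∫⁻ ω, (ENNReal.ofReal (μ * stageEnd T k ω) + ENNReal.ofReal (a - stagePos X T k ω)) ∂P
      = ENNReal.ofReal a + ∫⁻ ω, ENNReal.ofReal (stagePos X T k ω - a) ∂P := by
  induction k with
  | zero => simp [stagePos, stageEnd_zero, hX.zero, ENNReal.ofReal_of_nonpos (neg_nonpos.2 ha)]
  | succ k ih =>
    have h := hX.wald_stage hμ hT a k
    rw [ih fun j hj => hfin j (by omega)] at h
    have hk := hfin k (by omega)
    generalize ∫⁻ ω, ENNReal.ofReal (stagePos X T k ω - a) ∂P = B at h hk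
    rw [add_right_comm] at h
    exact (ENNReal.add_left_inj hk).1 h

/-- Wald's second identity: given the past, a centred increment has mean zero and variance equal to
the stage size, so the cross terms vanish. -/
theorem IsDriftBrownian.lintegral_sq_centred [IsProbabilityMeasure P] (hX : IsDriftBrownian P μ X)
    (hT : IsAdaptedRule (pastFiltration X hX.measurable) T) (k : ℕ) :
    ∫⁻ ω, ENNReal.ofReal ((stagePos X T k ω - μ * stageEnd T k ω) ^ 2) ∂P
      = ∫⁻ ω, (stageEnd T k ω : ℝ≥0∞) ∂P := by
  induction k with
  | zero => simp [stagePos, stageEnd_zero, hX.zero]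
  | succ k ih =>
    have hVm : Measurable[hT.past k] fun ω => stageEnd T (k + 1) ω := by
      simp_rw [stageEnd_succ]
      exact (hT.measurable_stageEnd k).add (hT.measurable_stage k)
    have h := hX.lintegral_stage hT k hVm
      (g := fun p => ENNReal.ofReal ((p.2 - μ * p.1) ^ 2))
      ((measurable_snd.sub (measurable_fst.coe_nnreal_real.const_mul μ)).pow_const 2).ennreal_ofReal
    simp only at h
    rw [h]
    have e : ∀ ω (x : ℝ), stagePos X T k ω + μ * T k ω + Real.sqrt (T k ω) * x
        - μ * stageEnd T (k + 1) ω
        = (stagePos X T k ω - μ * stageEnd T k ω) + Real.sqrt (T k ω) * x := by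
      intro ω x
      rw [stageEnd_succ]
      push_cast
      ring
    simp_rw [e, lintegral_sq_shift, Real.sq_sqrt (NNReal.coe_nonneg _), ENNReal.ofReal_coe_nnreal]
    rw [lintegral_add_right _ (hT.measurable_stage' k).coe_nnreal_ennreal, ih,
      ← lintegral_add_right _ (hT.measurable_stage' k).coe_nnreal_ennreal]
    simp_rw [stageEnd_succ]
    simp

end Rules

/-! ### Stopping a rule at the first crossing -/

section Crossing

/-- None of the stages `1, …, k` ends at or above the boundary `a`. -/
def StillBelow {Ω : Type*} (X : ℝ≥0 → Ω → ℝ) (T : ℕ → Ω → ℝ≥0) (a : ℝ) (k : ℕ) (ω : Ω) : Prop :=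
  ∀ j, 1 ≤ j → j ≤ k → stagePos X T j ω < a

open Classical in
/-- The rule `T`, stopped at the first crossing of the boundary. -/
def stoppedRule {Ω : Type*} (X : ℝ≥0 → Ω → ℝ) (T : ℕ → Ω → ℝ≥0) (a : ℝ) (k : ℕ) (ω : Ω) : ℝ≥0 :=
  if StillBelow X T a k ω then T k ω else 0

section Pathwise

variable {Ω : Type*} {X : ℝ≥0 → Ω → ℝ} {T : ℕ → Ω → ℝ≥0} {a : ℝ}

theorem stillBelow_zero (ω : Ω) : StillBelow X T a 0 ω := fun j h1 h0 => by omega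

theorem StillBelow.anti {ω : Ω} {j k : ℕ} (h : StillBelow X T a k ω) (hjk : j ≤ k) :
    StillBelow X T a j ω := fun i h1 h2 => h i h1 (h2.trans hjk)

theorem stillBelow_succ {ω : Ω} {k : ℕ} :
    StillBelow X T a (k + 1) ω ↔ StillBelow X T a k ω ∧ stagePos X T (k + 1) ω < a := by
  refine ⟨fun h => ⟨h.anti (Nat.le_succ k), h _ (by omega) le_rfl⟩, fun h j h1 h2 => ?_⟩
  rcases Nat.lt_or_ge k j with hj | hj
  · obtain rfl : j = k + 1 := by omega
    exact h.2
  · exact h.1 j h1 hj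

theorem lt_stageCount_iff {ω : Ω} {j : ℕ} :
    (j : ℕ∞) < stageCount X T a ω ↔ StillBelow X T a j ω := by
  rw [← ENat.add_one_le_iff (ENat.natCast_ne_top j), stageCount, le_iInf₂_iff]
  refine ⟨fun h i h1 h2 => ?_, fun h i hi => ?_⟩
  · by_contra hc
    have := h i ⟨h1, not_lt.1 hc⟩
    norm_cast at this
    omega
  · norm_cast
    by_contra hc
    exact absurd hi.2 (not_le.2 (h i hi.1 (by omega)))

theorem ENat.toENNReal_eq_tsum (n : ℕ∞) :
    (n : ℝ≥0∞) = ∑' j : ℕ, if (j : ℕ∞) < n then (1 : ℝ≥0∞) else 0 := by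
  induction n with
  | top => simp
  | coe n =>
    rw [tsum_eq_sum (s := Finset.range n)]
    · rw [Finset.sum_congr rfl (g := fun _ => 1)]
      · simp
      · intro j hj
        simp [Finset.mem_range.1 hj]
    · intro j hj
      simpa using hj

open Classical in
theorem stageCount_eq_tsum (ω : Ω) : (stageCount X T a ω : ℝ≥0∞)
    = ∑' j : ℕ, if StillBelow X T a j ω then (1 : ℝ≥0∞) else 0 := by
  rw [ENat.toENNReal_eq_tsum]
  simp_rw [lt_stageCount_iff]

theorem totalTime_eq_tsum (ω : Ω) : totalTime X T a ω
    = ∑' j : ℕ, (stoppedRule X T a j ω : ℝ≥0∞) := by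
  classical
  unfold totalTime stoppedRule
  refine tsum_congr fun j => ?_
  by_cases h : StillBelow X T a j ω <;> simp [lt_stageCount_iff, h]

theorem stageEnd_le_totalTime (ω : Ω) (k : ℕ) :
    (stageEnd (stoppedRule X T a) k ω : ℝ≥0∞) ≤ totalTime X T a ω := by
  rw [totalTime_eq_tsum, stageEnd]
  push_cast
  exact ENNReal.sum_le_tsum _

/-- The index goes up to `k + 1`: the stage that crosses the boundary is still carried out in full,
only later ones are suppressed. -/
theorem stageEnd_stoppedRule {ω : Ω} {j k : ℕ} (h : StillBelow X T a k ω) (hj : j ≤ k + 1) :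
    stageEnd (stoppedRule X T a) j ω = stageEnd T j ω := by
  refine Finset.sum_congr rfl fun i hi => ?_
  have := Finset.mem_range.1 hi
  simp [stoppedRule, h.anti (show i ≤ k by omega)]

theorem stageEnd_stoppedRule_of_not {ω : Ω} {j k : ℕ} (h : ¬ StillBelow X T a k ω) (hj : k ≤ j) :
    stageEnd (stoppedRule X T a) j ω = stageEnd (stoppedRule X T a) k ω := by
  induction j, hj using Nat.le_induction with
  | base => rfl
  | succ j hj ih =>
    rw [stageEnd_succ, ih]
    simp [stoppedRule, show ¬ StillBelow X T a j ω from fun hc => h (hc.anti hj)]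

/-- After a crossing the stopped rule no longer moves, so its position stays at or above `a`. -/
theorem stillBelow_of_stoppedRule_lt {ω : Ω} {k : ℕ}
    (h : stagePos X (stoppedRule X T a) k ω < a) : StillBelow X T a k ω := by
  induction k with
  | zero => exact stillBelow_zero ω
  | succ k ih =>
    by_cases hk : StillBelow X T a k ω
    · refine stillBelow_succ.2 ⟨hk, ?_⟩
      rwa [stagePos, stageEnd_stoppedRule hk le_rfl] at h
    · refine absurd (ih ?_) hk
      rwa [stagePos, stageEnd_stoppedRule_of_not hk (Nat.le_succ k)] at h

theorem stagePos_stoppedRule_of_crossing {ω : Ω} {j k : ℕ} (h : StillBelow X T a k ω)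
    (hc : a ≤ stagePos X T (k + 1) ω) (hj : k + 1 ≤ j) :
    stagePos X (stoppedRule X T a) j ω = stagePos X T (k + 1) ω := by
  have hn : ¬ StillBelow X T a (k + 1) ω := fun hs => absurd (stillBelow_succ.1 hs).2 (not_lt.2 hc)
  rw [stagePos, stageEnd_stoppedRule_of_not hn hj, stageEnd_stoppedRule h le_rfl, stagePos]

end Pathwise

variable {Ω : Type*} [mΩ : MeasurableSpace Ω] {X : ℝ≥0 → Ω → ℝ} {T : ℕ → Ω → ℝ≥0}
  {P : Measure Ω} {μ a : ℝ}

theorem IsDriftBrownian.measurableSet_stillBelow (hX : IsDriftBrownian P μ X)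
    (hT : IsAdaptedRule (pastFiltration X hX.measurable) T) (a : ℝ) (k : ℕ) :
    MeasurableSet[hT.past k] {ω | StillBelow X T a k ω} := by
  have : {ω | StillBelow X T a k ω}
      = ⋂ j ∈ Set.Icc 1 k, {ω | stagePos X T j ω < a} := by
    ext ω
    simp [StillBelow]
  rw [this]
  refine MeasurableSet.biInter (Set.to_countable _) fun j hj => ?_
  exact hT.past_mono hj.2 _ (hX.measurable_stagePos hT j measurableSet_Iio)

/-- The stopped stage size is positive only if no crossing has occurred, and there the stopped and
the original ends coincide; so for its superlevel sets the two pasts impose the same condition. -/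
theorem IsDriftBrownian.stoppedRule (hX : IsDriftBrownian P μ X)
    (hT : IsAdaptedRule (pastFiltration X hX.measurable) T) (a : ℝ) :
    IsAdaptedRule (pastFiltration X hX.measurable) (stoppedRule X T a) := by
  refine .of_forall fun k hτ => ?_
  refine measurable_of_Ioi fun c => ?_
  set s : Set Ω := _root_.stoppedRule X T a k ⁻¹' Set.Ioi c
  have hs : s = {ω | StillBelow X T a k ω} ∩ T k ⁻¹' Set.Ioi c := by
    ext ω
    by_cases h : StillBelow X T a k ω <;> simp [s, _root_.stoppedRule, h]
  have hsm : MeasurableSet[hT.past k] s := by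
    rw [hs]
    exact (hX.measurableSet_stillBelow hT a k).inter (hT.measurable_stage k measurableSet_Ioi)
  refine hτ.measurableSet_of_inter fun t => ?_
  have h2 := hsm.2 t
  rw [setOf_coe_le_eq] at h2
  convert h2 using 1
  ext ω
  refine and_congr_right fun hω => ?_
  rw [hs] at hω
  simp only [Set.mem_ofPred_eq, stageEnd_stoppedRule hω.1 (Nat.le_succ k)]

theorem IsDriftBrownian.lintegral_stageCount (hX : IsDriftBrownian P μ X)
    (hT : IsAdaptedRule (pastFiltration X hX.measurable) T) (a : ℝ) :
    ∫⁻ ω, (stageCount X T a ω : ℝ≥0∞) ∂P = ∑' k, P {ω | StillBelow X T a k ω} := by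
  classical
  have hm := fun k => hT.past_le k _ (hX.measurableSet_stillBelow hT a k)
  simp_rw [stageCount_eq_tsum]
  rw [lintegral_tsum fun k =>
    (Measurable.ite (hm k) measurable_const measurable_const).aemeasurable]
  refine tsum_congr fun k => ?_
  rw [← lintegral_indicator_one (hm k)]
  refine lintegral_congr fun ω => ?_
  by_cases h : StillBelow X T a k ω <;> simp [h, Set.indicator]

theorem lintegral_stageEnd_le (k : ℕ) :
    ∫⁻ ω, (stageEnd (stoppedRule X T a) k ω : ℝ≥0∞) ∂P
      ≤ ∫⁻ ω, totalTime X T a ω ∂P :=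
  lintegral_mono fun ω => stageEnd_le_totalTime ω k

/-- With `w = X_N - μ T^N` one has `a - X_N ≤ a - w` and `-w ≤ η w² + 1 / (4η)`. By Wald's second
identity `w²` has the mean of `T^N`, which is at most that of the total time. Hence undershoot is
negligible once stopping is almost certain. -/
theorem IsDriftBrownian.lintegral_undershoot_le [IsProbabilityMeasure P]
    (hX : IsDriftBrownian P μ X) (hμ : 0 < μ)
    (hT : IsAdaptedRule (pastFiltration X hX.measurable) T) (ha : 0 ≤ a) {η : ℝ} (hη : 0 < η)
    (N : ℕ) :
    ∫⁻ ω, ENNReal.ofReal (a - stagePos X (_root_.stoppedRule X T a) N ω) ∂P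
      ≤ ENNReal.ofReal η * ∫⁻ ω, totalTime X T a ω ∂P
        + ENNReal.ofReal (a + 1 / (4 * η)) * P {ω | StillBelow X T a N ω} := by
  have hS := hX.stoppedRule hT a
  have hm := hT.past_le N _ (hX.measurableSet_stillBelow hT a N)
  have hw : Measurable fun ω => ENNReal.ofReal
      ((stagePos X (_root_.stoppedRule X T a) N ω
        - μ * stageEnd (_root_.stoppedRule X T a) N ω) ^ 2) :=
    (((hX.measurable_stagePos' hS N).sub
      ((hS.measurable_stageEnd' N).coe_nnreal_real.const_mul μ)).pow_const 2).ennreal_ofReal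
  calc ∫⁻ ω, ENNReal.ofReal (a - stagePos X (_root_.stoppedRule X T a) N ω) ∂P
      ≤ ∫⁻ ω, (ENNReal.ofReal η * ENNReal.ofReal
          ((stagePos X (_root_.stoppedRule X T a) N ω
            - μ * stageEnd (_root_.stoppedRule X T a) N ω) ^ 2)
          + {ω | StillBelow X T a N ω}.indicator
            (fun _ => ENNReal.ofReal (a + 1 / (4 * η))) ω) ∂P := by
        refine lintegral_mono fun ω => ?_
        rcases le_or_gt a (stagePos X (_root_.stoppedRule X T a) N ω) with h | h
        · simp [ENNReal.ofReal_of_nonpos (sub_nonpos.2 h)]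
        · have hb : ω ∈ {ω | StillBelow X T a N ω} := stillBelow_of_stoppedRule_lt h
          rw [Set.indicator_of_mem hb, ← ENNReal.ofReal_mul hη.le,
            ← ENNReal.ofReal_add (by positivity) (by positivity)]
          refine ENNReal.ofReal_le_ofReal ?_
          have ht : 0 ≤ μ * (stageEnd (_root_.stoppedRule X T a) N ω : ℝ) := by positivity
          generalize stagePos X (_root_.stoppedRule X T a) N ω = x at *
          generalize μ * (stageEnd (_root_.stoppedRule X T a) N ω : ℝ) = t at *
          have h1 : -(x - t) ≤ η * (x - t) ^ 2 + 1 / (4 * η) := by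
            have : 0 ≤ η * ((x - t) + 1 / (2 * η)) ^ 2 := by positivity
            have e : η * ((x - t) + 1 / (2 * η)) ^ 2
              = η * (x - t) ^ 2 + (x - t) + 1 / (4 * η) := by field_simp; ring
            linarith
          linarith
    _ = ENNReal.ofReal η * ∫⁻ ω, (stageEnd (_root_.stoppedRule X T a) N ω : ℝ≥0∞) ∂P
        + ENNReal.ofReal (a + 1 / (4 * η)) * P {ω | StillBelow X T a N ω} := by
        rw [lintegral_add_left (hw.const_mul _), lintegral_const_mul _ hw,
          hX.lintegral_sq_centred hS, lintegral_indicator hm, setLIntegral_const]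
    _ ≤ _ := by
        gcongr with ω
        exact stageEnd_le_totalTime ω N

/-- With `w = x - μ t`, the inequality `w ≤ w² + 1` gives `x - a ≤ w² + 1 + μ t`, which is
integrable by Wald's second identity. -/
theorem IsDriftBrownian.overshoot_ne_top [IsProbabilityMeasure P]
    (hX : IsDriftBrownian P μ X) (hμ : 0 < μ)
    (hT : IsAdaptedRule (pastFiltration X hX.measurable) T) (ha : 0 ≤ a) (k : ℕ)
    (hfin : ∫⁻ ω, (stageEnd T k ω : ℝ≥0∞) ∂P ≠ ⊤) :
    ∫⁻ ω, ENNReal.ofReal (stagePos X T k ω - a) ∂P ≠ ⊤ := by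
  have hw : Measurable fun ω => ENNReal.ofReal ((stagePos X T k ω - μ * stageEnd T k ω) ^ 2) :=
    (((hX.measurable_stagePos' hT k).sub
      ((hT.measurable_stageEnd' k).coe_nnreal_real.const_mul μ)).pow_const 2).ennreal_ofReal
  refine ne_top_of_le_ne_top (b := ∫⁻ ω, (ENNReal.ofReal
    ((stagePos X T k ω - μ * stageEnd T k ω) ^ 2) + (1 + ENNReal.ofReal μ * stageEnd T k ω)) ∂P)
    ?_ (lintegral_mono fun ω => ?_)
  · rw [lintegral_add_left hw, hX.lintegral_sq_centred hT, lintegral_add_left measurable_const,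
      lintegral_const_mul _ (hT.measurable_stageEnd' k).coe_nnreal_ennreal]
    simp [hfin, ENNReal.mul_eq_top]
  · rw [← ENNReal.ofReal_coe_nnreal, ← ENNReal.ofReal_mul hμ.le, ← ENNReal.ofReal_one,
      ← ENNReal.ofReal_add zero_le_one (by positivity),
      ← ENNReal.ofReal_add (by positivity) (by positivity)]
    refine ENNReal.ofReal_le_ofReal ?_
    nlinarith [sq_nonneg (stagePos X T k ω - μ * stageEnd T k ω - 1 / 2)]

/-- The expected overshoot at the end of any given stage is a lower bound for the risk. -/
theorem IsDriftBrownian.overshoot_le_of_risk_le [IsProbabilityMeasure P]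
    (hX : IsDriftBrownian P μ X) (hμ : 0 < μ)
    (hT : IsAdaptedRule (pastFiltration X hX.measurable) T) (ha : 0 < a) {c r : ℝ} (hc : 0 < c)
    (hr : risk P μ X c a T ≤ (r : EReal)) (k : ℕ) :
    ∫⁻ ω in {ω | StillBelow X T a k ω}, ENNReal.ofReal (stagePos X T (k + 1) ω - a) ∂P
      ≤ ENNReal.ofReal (μ * r) := by
  set E := ∫⁻ ω, totalTime X T a ω ∂P with hE
  set B := ∫⁻ ω in {ω | StillBelow X T a k ω}, ENNReal.ofReal (stagePos X T (k + 1) ω - a) ∂P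
    with hB
  have hm := fun k => hT.past_le k _ (hX.measurableSet_stillBelow hT a k)
  have hsum : E + ENNReal.ofReal c * ∑' k, P {ω | StillBelow X T a k ω}
      ≤ ENNReal.ofReal (r + a / μ) := by
    unfold risk at hr
    rw [hX.lintegral_stageCount hT, ← hE, EReal.sub_le_iff_le_add (by simp) (by simp),
      ← EReal.coe_add] at hr
    rw [← EReal.coe_ennreal_le_coe_ennreal_iff, EReal.coe_ennreal_ofReal]
    exact hr.trans (by exact_mod_cast le_max_left _ _)
  have hEle : E ≤ ENNReal.ofReal (r + a / μ) := le_self_add.trans hsum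
  have hEtop : E ≠ ⊤ := ne_top_of_le_ne_top ENNReal.ofReal_ne_top hEle
  -- Since `c > 0`, the risk bound makes `E M = ∑ P(M > k)` finite, so the probability of still
  -- being below tends to zero.
  have hPsum : ∑' k, P {ω | StillBelow X T a k ω} ≠ ⊤ := by
    intro h
    rw [h, ENNReal.mul_top (by simpa using hc), add_top, top_le_iff] at hsum
    exact ENNReal.ofReal_ne_top hsum
  have hP0 := ENNReal.tendsto_atTop_zero_of_tsum_ne_top hPsum
  have hS := hX.stoppedRule hT a
  have hfin : ∀ j, ∫⁻ ω, (stageEnd (_root_.stoppedRule X T a) j ω : ℝ≥0∞) ∂P ≠ ⊤ := fun j =>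
    ne_top_of_le_ne_top hEtop (lintegral_stageEnd_le j)
  -- Wald's identity for the stopped rule after stage `N`. An overshoot produced at stage `k + 1` is
  -- frozen there, so it is still present after stage `N`.
  have key : ∀ η : ℝ, 0 < η → ∀ N, k + 1 ≤ N → ENNReal.ofReal a + B
      ≤ ENNReal.ofReal μ * E + (ENNReal.ofReal η * E
        + ENNReal.ofReal (a + 1 / (4 * η)) * P {ω | StillBelow X T a N ω}) := by
    intro η hη N hN
    have hw := hX.wald hμ hS ha.le N fun j _ => hX.overshoot_ne_top hμ hS ha.le j (hfin j)
    have h1 : B ≤ ∫⁻ ω, ENNReal.ofReal (stagePos X (_root_.stoppedRule X T a) N ω - a) ∂P := by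
      rw [hB, ← lintegral_indicator (hm k)]
      refine lintegral_mono fun ω => ?_
      by_cases h : StillBelow X T a k ω
      · rw [Set.indicator_of_mem (show ω ∈ {ω | StillBelow X T a k ω} from h)]
        rcases le_or_gt a (stagePos X T (k + 1) ω) with h2 | h2
        · rw [stagePos_stoppedRule_of_crossing h h2 hN]
        · simp [ENNReal.ofReal_of_nonpos (sub_nonpos.2 h2.le)]
      · rw [Set.indicator_of_notMem (show ω ∉ {ω | StillBelow X T a k ω} from h)]
        exact zero_le
    have hme : Measurable fun ω => ENNReal.ofReal
        (μ * stageEnd (_root_.stoppedRule X T a) N ω) :=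
      ((hS.measurable_stageEnd' N).coe_nnreal_real.const_mul μ).ennreal_ofReal
    calc _ ≤ ENNReal.ofReal a
          + ∫⁻ ω, ENNReal.ofReal (stagePos X (_root_.stoppedRule X T a) N ω - a) ∂P := by gcongr
      _ = ∫⁻ ω, ENNReal.ofReal (μ * stageEnd (_root_.stoppedRule X T a) N ω) ∂P
          + ∫⁻ ω, ENNReal.ofReal (a - stagePos X (_root_.stoppedRule X T a) N ω) ∂P := by
          rw [← hw, lintegral_add_left hme]
      _ ≤ _ := by
          refine add_le_add ?_ (hX.lintegral_undershoot_le hμ hT ha.le hη N)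
          simp_rw [ENNReal.ofReal_mul hμ.le, ENNReal.ofReal_coe_nnreal]
          rw [lintegral_const_mul _ (hS.measurable_stageEnd' N).coe_nnreal_ennreal]
          gcongr
          exact lintegral_stageEnd_le N
  -- First `N → ∞` with `η` fixed, then `η → 0`: the coefficient `1 / (4η)` forbids the other order.
  have key2 : ∀ η : ℝ, 0 < η → ENNReal.ofReal a + B
      ≤ ENNReal.ofReal μ * E + ENNReal.ofReal η * E := by
    intro η hη
    have hlim : Tendsto (fun N => ENNReal.ofReal μ * E + (ENNReal.ofReal η * E
        + ENNReal.ofReal (a + 1 / (4 * η)) * P {ω | StillBelow X T a N ω})) atTop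
        (𝓝 (ENNReal.ofReal μ * E + (ENNReal.ofReal η * E
        + ENNReal.ofReal (a + 1 / (4 * η)) * 0))) :=
      ((ENNReal.Tendsto.const_mul hP0 (Or.inr ENNReal.ofReal_ne_top)).const_add _).const_add _
    rw [mul_zero, add_zero] at hlim
    exact ge_of_tendsto hlim (eventually_atTop.2 ⟨k + 1, key η hη⟩)
  have key3 : ENNReal.ofReal a + B ≤ ENNReal.ofReal μ * E := by
    have hlim : Tendsto (fun η : ℝ => ENNReal.ofReal μ * E + ENNReal.ofReal η * E) (𝓝[>] 0)
        (𝓝 (ENNReal.ofReal μ * E + ENNReal.ofReal 0 * E)) := by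
      refine Tendsto.const_add _ (ENNReal.Tendsto.mul_const ?_ (Or.inr hEtop))
      exact (ENNReal.continuous_ofReal.tendsto 0).mono_left nhdsWithin_le_nhds
    rw [ENNReal.ofReal_zero, zero_mul, add_zero] at hlim
    exact ge_of_tendsto hlim (eventually_mem_nhdsWithin.mono fun η hη => key2 η hη)
  have key4 : ENNReal.ofReal a + B ≤ ENNReal.ofReal (μ * r + a) := by
    refine key3.trans ((mul_le_mul_right hEle _).trans_eq ?_)
    rw [← ENNReal.ofReal_mul hμ.le]
    congr 1
    field_simp
  have hr0 : 0 ≤ μ * r := by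
    have := (ENNReal.ofReal_le_ofReal_iff' (p := a)).1 (le_self_add.trans key4)
    rcases this with h | h <;> linarith
  rw [ENNReal.ofReal_add hr0 ha.le, add_comm] at key4
  exact (ENNReal.add_le_add_iff_right ENNReal.ofReal_ne_top).1 key4

end Crossing

/-! ### Stages that do not overshoot much -/

section StageBounds

/-- For `x ≥ 0` the integrands compare pointwise; for `x ≤ 0` the smaller one vanishes because `c' ≥
0`. -/
theorem normalExcess_mono {s s' c c' : ℝ} (hs : s' ≤ s) (hc : c ≤ c') (hc' : 0 ≤ c')
    (hs' : 0 ≤ s') : normalExcess s' c' ≤ normalExcess s c := by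
  refine integral_mono (integrable_excess _ _) (integrable_excess _ _) fun x => ?_
  rcases le_total 0 x with hx | hx
  · exact max_le_max (by nlinarith [mul_le_mul_of_nonneg_right hs hx]) le_rfl
  · refine (max_le (by nlinarith [mul_nonneg hs' (neg_nonneg.2 hx)]) le_rfl).trans
      (le_max_right _ _)

theorem measurable_normalExcess : Measurable fun p : ℝ × ℝ => normalExcess p.1 p.2 := by
  have h : StronglyMeasurable fun q : (ℝ × ℝ) × ℝ => max (q.1.1 * q.2 - q.1.2) 0 := by
    refine Measurable.stronglyMeasurable ?_
    fun_prop
  exact h.integral_prod_right'.measurable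

/-- On `[z + 1, z + 2]` the excess is at least `s` and the normal density at least its value at `z +
2`. -/
theorem normalExcess_ge {s c z : ℝ} (hs : 0 ≤ s) (hz : 0 ≤ z) (hc : c ≤ s * z) :
    s * ((Real.sqrt (2 * Real.pi))⁻¹ * Real.exp (-(z + 2) ^ 2 / 2)) ≤ normalExcess s c := by
  set g := (Real.sqrt (2 * Real.pi))⁻¹ * Real.exp (-(z + 2) ^ 2 / 2) with hg
  have hg0 : 0 ≤ g := by positivity
  have h1 : g ≤ (gaussianReal 0 1).real (Set.Icc (z + 1) (z + 2)) := by
    rw [measureReal_def, gaussianReal_apply_eq_integral _ one_ne_zero,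
      ENNReal.toReal_ofReal (integral_nonneg fun x => gaussianPDFReal_nonneg _ _ _)]
    have h2 : ∫ _ in Set.Icc (z + 1) (z + 2), g ∂(volume : Measure ℝ) = g := by
      rw [setIntegral_const]
      simp [measureReal_def]
      norm_num
    rw [← h2]
    refine setIntegral_mono_on (integrableOn_const (by simp))
      (integrable_gaussianPDFReal 0 1).integrableOn measurableSet_Icc fun x hx => ?_
    rw [gaussianPDFReal, hg]
    simp only [NNReal.coe_one, mul_one, sub_zero]
    gcongr
    · nlinarith [hx.1]
    · exact hx.2
  refine (mul_le_mul_of_nonneg_left h1 hs).trans ?_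
  have h3 : s * (gaussianReal 0 1).real (Set.Icc (z + 1) (z + 2))
      = ∫ x, (Set.Icc (z + 1) (z + 2)).indicator (fun _ => s) x ∂(gaussianReal 0 1) := by
    rw [integral_indicator_const _ measurableSet_Icc, smul_eq_mul, mul_comm]
  rw [h3]
  refine integral_mono ((integrable_const s).indicator measurableSet_Icc) (integrable_excess _ _)
    fun x => ?_
  by_cases hx : x ∈ Set.Icc (z + 1) (z + 2)
  · simp only [Set.indicator_of_mem hx]
    refine le_max_of_le_left ?_
    nlinarith [hx.1, mul_le_mul_of_nonneg_left hx.1 hs]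
  · simp only [Set.indicator_of_notMem hx]
    exact le_max_right _ _

/-- With `u = √(log ρ)` one has `√ρ = exp (u² / 2)`, and the factor `1 - δ` keeps the Gaussian
exponent smaller than that by a multiple of `u²`: what remains is at least `exp (u (δ u / 2 - 2) -
2)`. -/
theorem tendsto_excess_rate {δ : ℝ} (hδ : 0 < δ) (hδ' : δ < 1) :
    Tendsto (fun ρ : ℝ => Real.sqrt ρ * Real.exp (-((1 - δ) * Real.sqrt (Real.log ρ) + 2) ^ 2 / 2))
      atTop atTop := by
  have h1 : Tendsto (fun u : ℝ => Real.exp (u * (δ / 2 * u - 2 ) - 2)) atTop atTop := by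
    refine Real.tendsto_exp_atTop.comp (tendsto_atTop_add_const_right _ _ ?_)
    refine tendsto_id.atTop_mul_atTop₀ (tendsto_atTop_add_const_right _ _ ?_)
    exact tendsto_id.const_mul_atTop (by positivity)
  have h2 : Tendsto (fun ρ : ℝ => Real.sqrt (Real.log ρ)) atTop atTop :=
    Real.tendsto_sqrt_atTop.comp Real.tendsto_log_atTop
  refine tendsto_atTop_mono' _ ?_ (h1.comp h2)
  filter_upwards [eventually_ge_atTop 1] with ρ hρ
  have hL := Real.log_nonneg hρ
  have hs : Real.sqrt ρ = Real.exp (Real.log ρ / 2) := by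
    rw [Real.exp_half, Real.exp_log (by linarith)]
  rw [hs, ← Real.exp_add]
  refine Real.exp_le_exp.2 ?_
  have hu := Real.sq_sqrt hL
  have hu0 := Real.sqrt_nonneg (Real.log ρ)
  set u := Real.sqrt (Real.log ρ)
  rw [← hu]
  nlinarith [mul_nonneg hδ.le (sq_nonneg u), mul_nonneg hδ.le hu0,
    mul_nonneg (mul_nonneg hδ.le (by linarith : 0 ≤ 1 - δ)) (sq_nonneg u)]

/-- A stage from distance `y`, at least about `c F`, whose expected overshoot is `O(h)` must end
about `√(c / μ) √(F log (F / h²))` short of the boundary, up to negligible noise. -/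
theorem eventually_stage_short {μ c ε K A : ℝ} (hμ : 0 < μ) (hc : 0 < c) (hε : 0 < ε)
    (hε' : ε < 1) (hA : 0 < A) :
    ∀ᶠ ρ in atTop, ∀ F h y s : ℝ, 1 ≤ h → F / h ^ 2 = ρ → (1 - ε / 4) * (c * F) ≤ y → 0 ≤ s →
      normalExcess (Real.sqrt s) (y - μ * s) < K * h →
      (1 - ε / 2) * (Real.sqrt (c / μ) * Real.sqrt (F * Real.log (F / h ^ 2))) ≤ y - μ * s ∧
        A * Real.sqrt s ≤ y - μ * s := by
  set g := (Real.sqrt (2 * Real.pi))⁻¹ with hg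
  have hg0 : 0 < g := by positivity
  set eA := g * Real.exp (-(A + 2) ^ 2 / 2) with heA
  have heA0 : 0 < eA := by positivity
  have hε2 : 0 < 1 - ε / 2 := by linarith
  set σ₀ := Real.sqrt ((1 - ε / 2) * c / μ) with hσ₀
  have hσ₀0 : 0 < σ₀ := Real.sqrt_pos.2 (by positivity)
  -- Chosen so that the predicted shortfall `B` is at most `ε / 4 * (c * F)`, a small part of the
  -- distance.
  have e1 : ∀ᶠ ρ : ℝ in atTop, Real.log ρ ≤ (ε ^ 2 * c * μ / 16) * ρ := by
    have := Real.isLittleO_log_id_atTop.bound (show 0 < ε ^ 2 * c * μ / 16 by positivity)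
    filter_upwards [this, eventually_ge_atTop 1] with ρ h1 h2
    rw [Real.norm_of_nonneg (Real.log_nonneg h2), id, Real.norm_of_nonneg (by linarith)] at h1
    exact h1
  have e2 := (tendsto_excess_rate (show 0 < ε / 4 by linarith)
    (by linarith)).eventually_ge_atTop (K / (σ₀ * g))
  have e3 : ∀ᶠ ρ : ℝ in atTop, A * (K / eA) / ((1 - ε / 2) * Real.sqrt (c / μ)) ≤ Real.sqrt ρ :=
    Real.tendsto_sqrt_atTop.eventually_ge_atTop _
  filter_upwards [e1, e2, e3, eventually_ge_atTop (Real.exp 1)] with ρ e1 e2 e3 e4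
  rintro F h y s hh rfl hy hs hlt
  set ρ := F / h ^ 2 with hρ
  have hρ1 : 1 ≤ ρ := le_trans (by have := Real.add_one_le_exp 1; linarith) e4
  have hρ0 : 0 < ρ := by linarith
  have hF : F = ρ * h ^ 2 := by rw [hρ]; field_simp
  have hFρ : ρ ≤ F := by rw [hF]; nlinarith [mul_le_mul hh hh zero_le_one (by linarith)]
  have hF0 : 0 < F := by linarith
  have hL1 : 1 ≤ Real.log ρ := by rwa [Real.le_log_iff_exp_le hρ0]
  have hL : 0 ≤ Real.log ρ := by linarith
  set B := Real.sqrt (c / μ) * Real.sqrt (F * Real.log ρ) with hB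
  have hB0 : 0 ≤ B := by positivity
  have hB' : B = Real.sqrt (c / μ * F) * Real.sqrt (Real.log ρ) := by
    rw [hB, Real.sqrt_mul hF0.le, Real.sqrt_mul (by positivity)]; ring
  have hBle : B ≤ ε / 4 * (c * F) := by
    rw [hB, ← Real.sqrt_mul (by positivity)]
    refine Real.sqrt_le_iff.2 ⟨by positivity, ?_⟩
    have : Real.log ρ ≤ ε ^ 2 * c * μ / 16 * F :=
      e1.trans (mul_le_mul_of_nonneg_left hFρ (by positivity))
    calc c / μ * (F * Real.log ρ) ≤ c / μ * (F * (ε ^ 2 * c * μ / 16 * F)) := by gcongr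
      _ = (ε / 4 * (c * F)) ^ 2 := by field_simp; ring
  have hFh : Real.sqrt F = Real.sqrt ρ * h := by
    rw [hF, Real.sqrt_mul hρ0.le, Real.sqrt_sq (by linarith)]
  -- A stage ending closer would have size at least `(1 - ε / 2) c F / μ`. With that variance the
  -- boundary is within `(1 - ε / 4) √(log ρ)` standard deviations, and the expected overshoot is
  -- `h` times a quantity that diverges with `ρ`, hence at least `K h`.
  have first : (1 - ε / 2) * B ≤ y - μ * s := by
    by_contra hcon
    push Not at hcon
    have hslow : (1 - ε / 2) * c / μ * F ≤ s := by
      have h1 : (1 - ε / 2) * c * F ≤ μ * s := by nlinarith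
      rw [div_mul_eq_mul_div, div_le_iff₀ hμ]
      linarith
    have hσ : σ₀ * Real.sqrt F ≤ Real.sqrt s := by
      rw [hσ₀, ← Real.sqrt_mul (by positivity)]
      exact Real.sqrt_le_sqrt hslow
    have hm := normalExcess_mono (c := y - μ * s) hσ hcon.le (by positivity) (by positivity)
    have hz : (1 - ε / 2) * B ≤ σ₀ * Real.sqrt F * ((1 - ε / 4) * Real.sqrt (Real.log ρ)) := by
      have hσ' : σ₀ = Real.sqrt (1 - ε / 2) * Real.sqrt (c / μ) := by
        rw [hσ₀, mul_div_assoc, Real.sqrt_mul hε2.le]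
      have h1 : 1 - ε / 2 ≤ Real.sqrt (1 - ε / 2) * (1 - ε / 4) := by
        have h2 : 1 - ε / 2 ≤ (1 - ε / 4) ^ 2 := by nlinarith [sq_nonneg ε]
        have h3 := Real.sqrt_le_sqrt h2
        rw [Real.sqrt_sq (by linarith)] at h3
        calc 1 - ε / 2 = Real.sqrt (1 - ε / 2) * Real.sqrt (1 - ε / 2) :=
              (Real.mul_self_sqrt hε2.le).symm
          _ ≤ _ := by gcongr
      rw [hB', Real.sqrt_mul (by positivity), hσ']
      calc _ = (1 - ε / 2) * (Real.sqrt (c / μ) * Real.sqrt F * Real.sqrt (Real.log ρ)) := by ring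
        _ ≤ (Real.sqrt (1 - ε / 2) * (1 - ε / 4))
            * (Real.sqrt (c / μ) * Real.sqrt F * Real.sqrt (Real.log ρ)) := by gcongr
        _ = _ := by ring
    have hge := normalExcess_ge (by positivity : 0 ≤ σ₀ * Real.sqrt F)
      (mul_nonneg (by linarith) (Real.sqrt_nonneg _) :
        0 ≤ (1 - ε / 4) * Real.sqrt (Real.log ρ)) hz
    rw [div_le_iff₀ (by positivity)] at e2
    have : K * h ≤ σ₀ * Real.sqrt F
        * (g * Real.exp (-((1 - ε / 4) * Real.sqrt (Real.log ρ) + 2) ^ 2 / 2)) := by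
      rw [hFh]
      calc K * h ≤ (Real.sqrt ρ
          * Real.exp (-((1 - ε / 4) * Real.sqrt (Real.log ρ) + 2) ^ 2 / 2) * (σ₀ * g)) * h := by
            gcongr
        _ = _ := by ring
    linarith
  refine ⟨first, ?_⟩
  -- If the boundary were within `A` standard deviations, the overshoot bound would give `√s =
  -- O(h)`. But the shortfall is at least of order `√ρ h`, which exceeds `A √s` for large `ρ`.
  by_contra hcon
  push Not at hcon
  have hge := normalExcess_ge (Real.sqrt_nonneg s) hA.le
    (show y - μ * s ≤ Real.sqrt s * A by linarith)
  have hs1 : Real.sqrt s < K / eA * h := by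
    rw [div_mul_eq_mul_div, lt_div_iff₀ heA0]
    exact hge.trans_lt hlt
  rw [div_le_iff₀ (by positivity)] at e3
  have h1 : A * (K / eA) * h ≤ (1 - ε / 2) * B := by
    rw [hB, Real.sqrt_mul hF0.le, hFh]
    have h2 : 1 ≤ Real.sqrt (Real.log ρ) := by rwa [Real.one_le_sqrt]
    calc A * (K / eA) * h ≤ (Real.sqrt ρ * ((1 - ε / 2) * Real.sqrt (c / μ))) * h * 1 := by
          rw [mul_one]; gcongr
      _ ≤ (Real.sqrt ρ * ((1 - ε / 2) * Real.sqrt (c / μ))) * h * Real.sqrt (Real.log ρ) := by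
          gcongr
      _ = _ := by ring
  have h2 : A * Real.sqrt s < A * (K / eA) * h := by
    rw [mul_assoc]
    exact mul_lt_mul_of_pos_left hs1 hA
  linarith

end StageBounds

/-! ### Growth of the iterates of `F_h` -/

section Growth

/-- The square of the critical function `h_{k+1}`, near infinity. -/
def critSq (k : ℕ) (a : ℝ) : ℝ := a ^ ((1 / 2 : ℝ) ^ k) * Real.log a ^ (1 - (1 / 2 : ℝ) ^ k)

theorem half_pow_pos (k : ℕ) : 0 < (1 / 2 : ℝ) ^ k := by positivity

theorem half_pow_le_one (k : ℕ) : (1 / 2 : ℝ) ^ k ≤ 1 := pow_le_one₀ (by norm_num) (by norm_num)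

theorem critFun_sq {k : ℕ} {a : ℝ} (ha : 1 ≤ a) : critFun (k + 1) a ^ 2 = critSq k a := by
  have hl := Real.log_nonneg ha
  rw [critFun, if_neg (Nat.succ_ne_zero k), critSq, mul_pow, ← Real.rpow_mul_natCast (by linarith),
    ← Real.rpow_mul_natCast hl]
  congr 2 <;> push_cast <;> ring

theorem critSq_nonneg {k : ℕ} {a : ℝ} (ha : 1 ≤ a) : 0 ≤ critSq k a := by
  have hl := Real.log_nonneg ha
  unfold critSq
  positivity

/-- In this form quotients of critical functions are powers of `a / log a`. -/
theorem critSq_eq {k : ℕ} {a : ℝ} (ha : 1 < a) :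
    critSq k a = Real.log a * (a / Real.log a) ^ ((1 / 2 : ℝ) ^ k) := by
  have hl := Real.log_pos ha
  rw [critSq, Real.div_rpow (by linarith) hl.le, Real.rpow_sub hl, Real.rpow_one]
  ring

/-- This is the recursion of the iterates of `F_h`, with `log (x / h²)` replaced by `log a`. -/
theorem critSq_succ {k : ℕ} {a : ℝ} (ha : 1 ≤ a) :
    critSq (k + 1) a = Real.sqrt (critSq k a * Real.log a) := by
  have hl := Real.log_nonneg ha
  rw [critSq, critSq, Real.sqrt_eq_rpow, Real.mul_rpow (by positivity) hl,
    Real.mul_rpow (by positivity) (by positivity), ← Real.rpow_mul (by linarith),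
    ← Real.rpow_mul hl, mul_assoc, ← Real.rpow_add_of_nonneg hl]
  · congr 2; ring
  · nlinarith [half_pow_le_one k]
  · norm_num

theorem one_le_div_log {a : ℝ} (ha : 1 < a) : 1 ≤ a / Real.log a := by
  rw [le_div_iff₀ (Real.log_pos ha)]
  linarith [Real.log_le_sub_one_of_pos (by linarith : 0 < a)]

theorem critSq_anti {k n : ℕ} (hkn : k ≤ n) {a : ℝ} (ha : 1 < a) : critSq n a ≤ critSq k a := by
  rw [critSq_eq ha, critSq_eq ha]
  refine mul_le_mul_of_nonneg_left ?_ (Real.log_pos ha).le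
  exact Real.rpow_le_rpow_of_exponent_le (one_le_div_log ha)
    (pow_le_pow_of_le_one (by norm_num) (by norm_num) hkn)

/-- Since `a / log a ≥ √a` eventually, the power is at least `a^{δ/2}`, and half of that exponent is
spent on absorbing `c`. -/
theorem eventually_log_ratio_ge {δ c : ℝ} (hδ : 0 < δ) (hc : 0 < c) :
    ∀ᶠ a : ℝ in atTop, δ / 4 * Real.log a ≤ Real.log (c * (a / Real.log a) ^ δ) := by
  have h1 := (isLittleO_log_rpow_atTop (show (0 : ℝ) < 1 / 2 by norm_num)).bound one_pos
  have h2 := (tendsto_rpow_atTop (show 0 < δ / 4 by positivity)).eventually_ge_atTop (1 / c)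
  filter_upwards [h1, h2, eventually_gt_atTop 1] with a h1 h2 ha
  have hl := Real.log_pos ha
  have ha0 : 0 < a := by linarith
  rw [one_mul, Real.norm_of_nonneg hl.le, Real.norm_of_nonneg (by positivity)] at h1
  have h3 : a ^ (1 / 2 : ℝ) ≤ a / Real.log a := by
    rw [le_div_iff₀ hl]
    calc a ^ (1 / 2 : ℝ) * Real.log a ≤ a ^ (1 / 2 : ℝ) * a ^ (1 / 2 : ℝ) := by gcongr
      _ = a := by rw [← Real.rpow_add ha0]; norm_num
  have h4 : a ^ (δ / 4) ≤ c * (a / Real.log a) ^ δ := by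
    calc a ^ (δ / 4) ≤ c * a ^ (δ / 4) * a ^ (δ / 4) := by
          have : 1 ≤ c * a ^ (δ / 4) := by rwa [div_le_iff₀' hc] at h2
          exact le_mul_of_one_le_left (by positivity) this
      _ = c * (a ^ (1 / 2 : ℝ)) ^ δ := by
          rw [mul_assoc, ← Real.rpow_add ha0, ← Real.rpow_mul ha0.le]
          congr 2
          ring
      _ ≤ _ := by gcongr
  calc δ / 4 * Real.log a = Real.log (a ^ (δ / 4)) := (Real.log_rpow ha0 _).symm
    _ ≤ _ := Real.log_le_log (by positivity) h4

variable {h : ℝ → ℝ} {n : ℕ}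

theorem eventually_sq_le_critSq (ho : h =o[atTop] critFun (n + 1)) {c : ℝ} (hc : 0 < c) :
    ∀ᶠ a in atTop, h a ^ 2 ≤ c * critSq n a := by
  filter_upwards [ho.bound (Real.sqrt_pos.2 hc), eventually_ge_atTop 1] with a h1 h2
  rw [← critFun_sq h2, ← Real.sq_sqrt hc.le, ← mul_pow, ← sq_abs (h a), ← sq_abs (_ * _), abs_mul,
    abs_of_nonneg (Real.sqrt_nonneg c)]
  exact pow_le_pow_left₀ (abs_nonneg _) h1 2

/-- For `k < n` the ratio of `F_h^{(k)}` to `h²` is at least of order `critSq k / critSq n`, a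
positive power of `a / log a`. Its logarithm is therefore at least a multiple of `log a`, so the
next iterate keeps up with the recursion of `critSq`. -/
theorem eventually_critSq_le_undershootIter (ho : h =o[atTop] critFun (n + 1))
    (h1 : ∀ᶠ a in atTop, 1 ≤ h a) {k : ℕ} (hk : k ≤ n) :
    ∃ c, 0 < c ∧ ∀ᶠ a in atTop, c * critSq k a ≤ undershootIter h k a := by
  induction k with
  | zero =>
    refine ⟨1, one_pos, Eventually.of_forall fun a => ?_⟩
    simp [critSq, undershootIter]
  | succ k ih =>
    obtain ⟨c, hc, hle⟩ := ih (by omega)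
    have hδ : 0 < (1 / 2 : ℝ) ^ k - (1 / 2 : ℝ) ^ n :=
      sub_pos.2 (pow_lt_pow_right_of_lt_one₀ (by norm_num) (by norm_num) hk)
    set δ := (1 / 2 : ℝ) ^ k - (1 / 2 : ℝ) ^ n
    refine ⟨Real.sqrt (c * (δ / 4)), by positivity, ?_⟩
    filter_upwards [hle, h1, eventually_sq_le_critSq ho one_pos, eventually_log_ratio_ge hδ hc,
      eventually_gt_atTop 1] with a hle h1 hsq hlog ha
    have hl := Real.log_pos ha
    have hq := one_le_div_log ha
    have hs0 := critSq_nonneg (k := k) ha.le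
    rw [one_mul] at hsq
    have hr : c * (a / Real.log a) ^ δ ≤ undershootIter h k a / h a ^ 2 := by
      rw [le_div_iff₀ (by positivity)]
      refine le_trans ?_ hle
      calc c * (a / Real.log a) ^ δ * h a ^ 2 ≤ c * (a / Real.log a) ^ δ * critSq n a := by gcongr
        _ = c * critSq k a := by
          rw [critSq_eq ha, critSq_eq ha, Real.rpow_sub (by linarith)]
          have : 0 < (a / Real.log a) ^ ((1 / 2 : ℝ) ^ n) := by positivity
          field_simp
    rw [undershootIter, Function.iterate_succ_apply', undershootStep, critSq_succ ha.le,
      ← Real.sqrt_mul (by positivity)]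
    refine Real.sqrt_le_sqrt ?_
    have hlog2 : δ / 4 * Real.log a ≤ Real.log (undershootIter h k a / h a ^ 2) :=
      hlog.trans (Real.log_le_log (by positivity) hr)
    calc c * (δ / 4) * (critSq k a * Real.log a)
        = (c * critSq k a) * (δ / 4 * Real.log a) := by ring
      _ ≤ undershootIter h k a * Real.log (undershootIter h k a / h a ^ 2) := by
          gcongr
          exact (by positivity : 0 ≤ c * critSq k a).trans hle
      _ = _ := rfl

/-- Here `h² = o(critSq n)`, while the iterate is at least of order `critSq k ≥ critSq n`. The case
`k = n` is included, which allows one more stage of the lower bound. -/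
theorem tendsto_undershootIter_div_sq (ho : h =o[atTop] critFun (n + 1))
    (h1 : ∀ᶠ a in atTop, 1 ≤ h a) {k : ℕ} (hk : k ≤ n) :
    Tendsto (fun a => undershootIter h k a / h a ^ 2) atTop atTop := by
  obtain ⟨c, hc, hle⟩ := eventually_critSq_le_undershootIter ho h1 hk
  refine tendsto_atTop.2 fun M => ?_
  have hM : 0 < c / (|M| + 1) := by positivity
  filter_upwards [hle, h1, eventually_sq_le_critSq ho hM, eventually_gt_atTop 1]
    with a hle h1 hsq ha
  rw [le_div_iff₀ (by positivity)]
  calc M * h a ^ 2 ≤ (|M| + 1) * h a ^ 2 := by gcongr; linarith [le_abs_self M]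
    _ ≤ (|M| + 1) * (c / (|M| + 1) * critSq n a) := by gcongr
    _ = c * critSq n a := by field_simp
    _ ≤ c * critSq k a := by gcongr; exact critSq_anti hk ha
    _ ≤ _ := hle

end Growth

/-! ### Efficient rules stay short of the boundary -/

section Short

variable {Ω : Type*} [mΩ : MeasurableSpace Ω] {X : ℝ≥0 → Ω → ℝ} {T : ℕ → Ω → ℝ≥0}
  {P : Measure Ω} {μ a : ℝ}

theorem IsDriftBrownian.setLIntegral_stage [IsProbabilityMeasure P] (hX : IsDriftBrownian P μ X)
    (hT : IsAdaptedRule (pastFiltration X hX.measurable) T) (k : ℕ)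
    {Q : Set Ω} (hQ : MeasurableSet[hT.past k] Q) {g : ℝ → ℝ≥0∞} (hg : Measurable g) :
    ∫⁻ ω in Q, g (stagePos X T (k + 1) ω) ∂P
      = ∫⁻ ω in Q, ∫⁻ x, g (stagePos X T k ω + μ * T k ω + Real.sqrt (T k ω) * x)
          ∂(gaussianReal 0 1) ∂P := by
  have hQ' := hT.past_le k _ hQ
  have hV : Measurable[hT.past k] (Q.indicator fun _ => (1 : ℝ≥0∞)) :=
    measurable_const.indicator hQ
  have h := hX.lintegral_stage hT k hV (g := fun p : ℝ≥0∞ × ℝ => p.1 * g p.2)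
    (measurable_fst.mul (hg.comp measurable_snd))
  simp only at h
  rw [← lintegral_indicator hQ', ← lintegral_indicator hQ']
  convert h using 1
  · refine lintegral_congr fun ω => ?_
    by_cases hω : ω ∈ Q <;> simp [hω]
  · refine lintegral_congr fun ω => ?_
    by_cases hω : ω ∈ Q <;> simp [hω]

theorem stdGaussian_Ioi_le {θ : ℝ} (hθ : 0 < θ) :
    gaussianReal 0 1 (Set.Ioi θ) ≤ ENNReal.ofReal (1 / θ ^ 2) := by
  have h := mul_meas_ge_le_lintegral (μ := gaussianReal 0 1)
    (f := fun x : ℝ => ENNReal.ofReal ((0 + 1 * x) ^ 2)) (by fun_prop) (ENNReal.ofReal (θ ^ 2))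
  rw [lintegral_sq_shift] at h
  have h2 : gaussianReal 0 1 (Set.Ioi θ) ≤ gaussianReal 0 1
      {x | ENNReal.ofReal (θ ^ 2) ≤ ENNReal.ofReal ((0 + 1 * x) ^ 2)} := by
    refine measure_mono fun x hx => ENNReal.ofReal_le_ofReal ?_
    rw [zero_add, one_mul]
    exact pow_le_pow_left₀ hθ.le (Set.mem_Ioi.1 hx).le 2
  rw [ENNReal.ofReal_div_of_pos (by positivity), ENNReal.ofReal_one,
    ENNReal.le_div_iff_mul_le (Or.inl (by simpa using hθ.ne')) (Or.inl ENNReal.ofReal_ne_top),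
    mul_comm]
  refine (mul_le_mul_right h2 _).trans ?_
  simpa using h

/-- The constants in front of the iterates obey `c_{k+1} = √(c_k / μ)` with `c_0 = 1`. -/
theorem sqrt_rate_div {μ : ℝ} (hμ : 0 < μ) (k : ℕ) :
    Real.sqrt ((1 / μ) ^ (1 - (1 / 2 : ℝ) ^ k) / μ) = (1 / μ) ^ (1 - (1 / 2 : ℝ) ^ (k + 1)) := by
  have h : 0 < 1 / μ := by positivity
  have e : (1 / μ) ^ (1 - (1 / 2 : ℝ) ^ k) / μ = (1 / μ) ^ (2 - (1 / 2 : ℝ) ^ k) := by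
    rw [div_eq_mul_one_div]
    nth_rewrite 2 [← Real.rpow_one (1 / μ)]
    rw [← Real.rpow_add h]
    congr 1
    ring
  rw [e, Real.sqrt_eq_rpow, ← Real.rpow_mul h.le]
  congr 1
  ring

/-- If the risk is `O(h)`, the expected overshoot at stage `k + 1` can rarely be large. -/
theorem IsDriftBrownian.measure_large_overshoot_le [IsProbabilityMeasure P]
    (hX : IsDriftBrownian P μ X) (hμ : 0 < μ)
    (hT : IsAdaptedRule (pastFiltration X hX.measurable) T) (ha : 0 < a) {c r K : ℝ} (hc : 0 < c)
    (hr : risk P μ X c a T ≤ (r : EReal)) (hK : 0 < K) (k : ℕ) :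
    P {ω | StillBelow X T a k ω ∧
        K ≤ normalExcess (Real.sqrt (T k ω)) (a - stagePos X T k ω - μ * T k ω)}
      ≤ ENNReal.ofReal (μ * r / K) := by
  set D := {ω | StillBelow X T a k ω ∧
        K ≤ normalExcess (Real.sqrt (T k ω)) (a - stagePos X T k ω - μ * T k ω)} with hD
  have hSm := (hT.measurable_stage k).coe_nnreal_real
  have hDm : MeasurableSet[hT.past k] D := by
    refine (hX.measurableSet_stillBelow hT a k).inter ?_
    exact (measurable_normalExcess.comp ((Real.continuous_sqrt.measurable.comp hSm).prodMk
      (((hX.measurable_stagePos hT k).const_sub a).sub (hSm.const_mul μ)))) measurableSet_Ici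
  have h1 := hX.overshoot_le_of_risk_le hμ hT ha hc hr k
  have h2 : ENNReal.ofReal K * P D ≤ ∫⁻ ω in D, ENNReal.ofReal (stagePos X T (k + 1) ω - a) ∂P := by
    rw [hX.setLIntegral_stage hT k hDm (g := fun x => ENNReal.ofReal (x - a)) (by fun_prop),
      ← setLIntegral_const]
    refine setLIntegral_mono' (hT.past_le k _ hDm) fun ω hω => ?_
    have e : ∀ x : ℝ, stagePos X T k ω + μ * T k ω + Real.sqrt (T k ω) * x - a
        = Real.sqrt (T k ω) * x - (a - stagePos X T k ω - μ * T k ω) := fun x => by ring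
    simp_rw [e, lintegral_excess]
    exact ENNReal.ofReal_le_ofReal hω.2
  rw [ENNReal.ofReal_div_of_pos hK, ENNReal.le_div_iff_mul_le (Or.inl (by simpa using hK))
    (Or.inl ENNReal.ofReal_ne_top), mul_comm]
  exact (h2.trans (lintegral_mono_set fun ω hω => hω.1)).trans h1

/-- A rule whose risk is `O(h)` ends each of its first stages about as far from the boundary as
the iterates of `F_h` predict, with probability close to one. -/
theorem IsDriftBrownian.eventually_short [IsProbabilityMeasure P] (hX : IsDriftBrownian P μ X)
    (hμ : 0 < μ) {h : ℝ → ℝ} {n : ℕ} (ho : h =o[atTop] critFun (n + 1))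
    (h1 : ∀ᶠ a in atTop, 1 ≤ h a) {k : ℕ} (hk : k ≤ n + 1) {ε η : ℝ} (hε : 0 < ε) (hε' : ε < 1)
    (hη : 0 < η) (C : ℝ) :
    ∀ᶠ a in atTop, ∀ T, IsAdaptedRule (pastFiltration X hX.measurable) T →
      risk P μ X (h a) a T ≤ ((C * h a : ℝ) : EReal) →
      P {ω | StillBelow X T a k ω ∧ (1 - ε) * ((1 / μ) ^ (1 - (1 / 2 : ℝ) ^ k)
        * undershootIter h k a) ≤ a - stagePos X T k ω}ᶜ ≤ ENNReal.ofReal η := by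
  induction k generalizing ε η with
  | zero =>
    filter_upwards [eventually_gt_atTop 0] with a ha T _ _
    have : {ω | StillBelow X T a 0 ω ∧ (1 - ε) * ((1 / μ) ^ (1 - (1 / 2 : ℝ) ^ 0)
        * undershootIter h 0 a) ≤ a - stagePos X T 0 ω}ᶜ = ∅ := by
      rw [Set.compl_empty_iff, Set.eq_univ_iff_forall]
      refine fun ω => ⟨stillBelow_zero ω, ?_⟩
      simp [undershootIter, stagePos, stageEnd_zero, hX.zero]
      nlinarith
    rw [this, measure_empty]
    exact zero_le
  | succ k ih =>
    have hC : 0 < |C| + 1 := by positivity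
    set c := (1 / μ) ^ (1 - (1 / 2 : ℝ) ^ k) with hc
    have hc0 : 0 < c := by positivity
    -- Makes Markov's bound for an expected overshoot of at least `K h` equal to `η / 3`.
    set K := 3 * (|C| + 1) * μ / η with hK
    have hK0 : 0 < K := by positivity
    -- Then `A ε / 2 = 2 / √η`, and Chebyshev's inequality bounds the noise event by `η / 4`.
    set A := 4 / (ε * Real.sqrt η) with hA
    have hA0 : 0 < A := by positivity
    have hρ := tendsto_undershootIter_div_sq ho h1 (show k ≤ n by omega)
    filter_upwards [ih (by omega) (show 0 < ε / 4 by linarith) (by linarith)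
      (show 0 < η / 3 by linarith),
    hρ.eventually (eventually_stage_short (K := K) hμ hc0 hε hε' hA0),
      hρ.eventually_gt_atTop 1, h1, eventually_gt_atTop 0] with a ih hshort hρ1 h1 ha T hT hr
    set F := undershootIter h k a with hF
    have hF0 : 0 < F := by
      rw [lt_div_iff₀ (by positivity)] at hρ1
      nlinarith
    set B := (1 / μ) ^ (1 - (1 / 2 : ℝ) ^ (k + 1)) * undershootIter h (k + 1) a with hB
    have hBeq : B = Real.sqrt (c / μ) * Real.sqrt (F * Real.log (F / h a ^ 2)) := by
      rw [hB, hc, sqrt_rate_div hμ, undershootIter, Function.iterate_succ_apply', undershootStep]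
      rfl
    have hB0 : 0 < B := by
      have := Real.log_pos hρ1
      rw [hBeq]
      positivity
    have hr' : risk P μ X (h a) a T ≤ (((|C| + 1) * h a : ℝ) : EReal) := by
      refine hr.trans (EReal.coe_le_coe_iff.2 ?_)
      gcongr
      linarith [le_abs_self C]
    set G := {ω | StillBelow X T a k ω ∧ (1 - ε / 4) * (c * F) ≤ a - stagePos X T k ω} with hG
    set D := {ω | StillBelow X T a k ω ∧
        K * h a ≤ normalExcess (Real.sqrt (T k ω)) (a - stagePos X T k ω - μ * T k ω)} with hD
    have hPG : P Gᶜ ≤ ENNReal.ofReal (η / 3) := ih T hT hr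
    have hPD : P D ≤ ENNReal.ofReal (η / 3) := by
      refine (hX.measure_large_overshoot_le hμ hT ha (by linarith) hr'
        (by positivity : 0 < K * h a) k).trans (ENNReal.ofReal_le_ofReal ?_)
      rw [hK]
      refine le_of_eq ?_
      have : 0 < h a := by linarith
      field_simp
    -- On `Q` the stage starts far enough away and has small expected overshoot, so its mean end is
    -- short by about `B`. The only bad event left is an upward fluctuation of more than `A ε / 2`
    -- standard deviations.
    set Q := G ∩ Dᶜ with hQ
    have hSm := (hT.measurable_stage k).coe_nnreal_real
    have hpm := (hX.measurable_stagePos hT k).const_sub a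
    have hGm : MeasurableSet[hT.past k] G :=
      (hX.measurableSet_stillBelow hT a k).inter (hpm measurableSet_Ici)
    have hDm : MeasurableSet[hT.past k] D := by
      refine (hX.measurableSet_stillBelow hT a k).inter ?_
      exact (measurable_normalExcess.comp ((Real.continuous_sqrt.measurable.comp hSm).prodMk
        (hpm.sub (hSm.const_mul μ)))) measurableSet_Ici
    have hQm : MeasurableSet[hT.past k] Q := hGm.inter hDm.compl
    have hQ' : ∀ ω ∈ Q, (1 - ε / 2) * B ≤ a - stagePos X T k ω - μ * T k ω ∧
        A * Real.sqrt (T k ω) ≤ a - stagePos X T k ω - μ * T k ω := by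
      rintro ω ⟨hg, hd⟩
      rw [hBeq]
      refine hshort F (h a) _ _ h1 rfl hg.2 (NNReal.coe_nonneg _) ?_
      by_contra hcon
      exact hd ⟨hg.1, not_lt.1 hcon⟩
    have hbad : P (Q ∩ stagePos X T (k + 1) ⁻¹' Set.Ioi (a - (1 - ε) * B))
        ≤ ENNReal.ofReal (η / 3) := by
      have hθ : 0 < A * ε / 2 := by positivity
      have hm : MeasurableSet (stagePos X T (k + 1) ⁻¹' Set.Ioi (a - (1 - ε) * B)) :=
        hX.measurable_stagePos' hT _ measurableSet_Ioi
      have e := hX.setLIntegral_stage hT k hQm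
        (g := (Set.Ioi (a - (1 - ε) * B)).indicator 1) (measurable_one.indicator measurableSet_Ioi)
      have e1 : ∫⁻ ω in Q, (Set.Ioi (a - (1 - ε) * B)).indicator 1 (stagePos X T (k + 1) ω) ∂P
          = P (Q ∩ stagePos X T (k + 1) ⁻¹' Set.Ioi (a - (1 - ε) * B)) := by
        rw [Set.inter_comm, ← Measure.restrict_apply hm, ← lintegral_indicator_one hm]
        rfl
      rw [← e1, e]
      calc _ ≤ ∫⁻ _ in Q, ENNReal.ofReal (η / 3) ∂P := by
            refine setLIntegral_mono' (hT.past_le k _ hQm) fun ω hω => ?_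
            obtain ⟨hd1, hd2⟩ := hQ' ω hω
            calc _ ≤ ∫⁻ x, (Set.Ioi (A * ε / 2)).indicator 1 x ∂(gaussianReal 0 1) := by
                  refine lintegral_mono fun x => ?_
                  by_cases hx : stagePos X T k ω + μ * T k ω + Real.sqrt (T k ω) * x
                      ∈ Set.Ioi (a - (1 - ε) * B)
                  · have hx' : x ∈ Set.Ioi (A * ε / 2) := by
                      rw [Set.mem_Ioi] at hx ⊢
                      by_contra hcon
                      push Not at hcon
                      have hs := Real.sqrt_nonneg (T k ω : ℝ)
                      have h3 : Real.sqrt (T k ω) * x ≤ Real.sqrt (T k ω) * (A * ε / 2) := by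
                        gcongr
                      have h4 := mul_le_mul_of_nonneg_left hd2 (show 0 ≤ ε / 2 by linarith)
                      have h5 := mul_le_mul_of_nonneg_left hd1 (show 0 ≤ 1 - ε / 2 by linarith)
                      -- One factor `1 - ε / 2` is lost in the mean and one in the noise, and `(1 -
                      -- ε / 2)² ≥ 1 - ε`.
                      nlinarith [mul_nonneg (sq_nonneg ε) hB0.le]
                    simp [hx, hx']
                  · simp [hx]
              _ = gaussianReal 0 1 (Set.Ioi (A * ε / 2)) :=
                lintegral_indicator_one measurableSet_Ioi
              _ ≤ ENNReal.ofReal (1 / (A * ε / 2) ^ 2) := stdGaussian_Ioi_le hθ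
              _ ≤ ENNReal.ofReal (η / 3) := by
                  refine ENNReal.ofReal_le_ofReal ?_
                  have : 1 / (A * ε / 2) ^ 2 = η / 4 := by
                    rw [hA]
                    field_simp
                    rw [Real.sq_sqrt hη.le]
                    ring
                  rw [this]
                  linarith
        _ ≤ ENNReal.ofReal (η / 3) * 1 := by
            rw [setLIntegral_const]
            gcongr
            exact prob_le_one
        _ = _ := mul_one _
    calc _ ≤ P (Gᶜ ∪ (D ∪ (Q ∩ stagePos X T (k + 1) ⁻¹' Set.Ioi (a - (1 - ε) * B)))) := by
          refine measure_mono fun ω hω => ?_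
          by_contra hcon
          simp only [Set.mem_union, not_or, Set.mem_compl_iff, not_not, Set.mem_inter_iff,
            not_and] at hcon
          have h2 : stagePos X T (k + 1) ω ≤ a - (1 - ε) * B := by
            simpa using hcon.2.2 ⟨hcon.1, hcon.2.1⟩
          refine hω ⟨stillBelow_succ.2 ⟨hcon.1.1, ?_⟩, by linarith⟩
          have : 0 < (1 - ε) * B := mul_pos (by linarith) hB0
          linarith
      _ ≤ ENNReal.ofReal (η / 3) + (ENNReal.ofReal (η / 3) + ENNReal.ofReal (η / 3)) :=
          (measure_union_le _ _).trans (add_le_add hPG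
            ((measure_union_le _ _).trans (add_le_add hPD hbad)))
      _ = ENNReal.ofReal η := by
          rw [← ENNReal.ofReal_add (by positivity) (by positivity),
            ← ENNReal.ofReal_add (by positivity) (by positivity)]
          congr 1
          ring

end Short

/-! ### Sampling policies -/

section Policies

/-- The stage sizes `S` along the path `w` are `t(a - X_{k-1}, z_k)` as long as the boundary has not
been crossed, where `z_k` is a function of the distance from the boundary at the end of stage
`min k n`. -/
def FollowsPolicy (μ : ℝ) (n : ℕ) (Z : ℕ → ℝ → ℝ) (a : ℝ) (w : ℝ≥0 → ℝ) (S : ℕ → ℝ≥0) : Prop :=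
  ∀ k, S k = if w (∑ j ∈ Finset.range k, S j) < a then
    (stageSize μ (a - w (∑ j ∈ Finset.range k, S j))
      (Z k (a - w (∑ j ∈ Finset.range (min k n), S j)))).toNNReal else 0

theorem geomEnd_eq_sum (μ z a : ℝ) (w : ℝ≥0 → ℝ) (k : ℕ) :
    geomEnd μ z a w k = ∑ j ∈ Finset.range k, geomSampler μ z a w j := by
  induction k with
  | zero => simp [geomEnd]
  | succ k ih => rw [Finset.sum_range_succ, ← ih, geomEnd, geomSampler]

theorem followsPolicy_geomSampler (μ : ℝ) {a : ℝ} {w : ℝ≥0 → ℝ} (hw : w 0 = 0) (g : ℝ → ℝ) :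
    FollowsPolicy μ 0 (fun _ => g) a w (geomSampler μ (g a) a w) := by
  intro k
  rw [← geomEnd_eq_sum, geomSampler]
  simp [hw]

/-- The policy that uses the parameters `zs` in the first stages, and then `g`. -/
def listPolicy : List (ℝ → ℝ) → (ℝ → ℝ) → ℕ → ℝ → ℝ
  | [], g, _ => g
  | z :: _, _, 0 => z
  | _ :: zs, g, k + 1 => listPolicy zs g k

/-- Restarting the path shifts position and boundary by the same amount, so distances to the
boundary are unchanged and the stage index moves by one. -/
theorem followsPolicy_stageThen {μ a : ℝ} {w : ℝ≥0 → ℝ} (hw : w 0 = 0) (ha : 0 < a) {z : ℝ → ℝ}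
    {zs : List (ℝ → ℝ)} {g : ℝ → ℝ} {δ : ℝ → (ℝ≥0 → ℝ) → ℕ → ℝ≥0}
    (hδ : ∀ b : ℝ, 0 < b → ∀ v : ℝ≥0 → ℝ, v 0 = 0 →
      FollowsPolicy μ zs.length (listPolicy zs g) b v (δ b v)) :
    FollowsPolicy μ (z :: zs).length (listPolicy (z :: zs) g) a w
      (stageThen (stageSize μ a (z a)).toNNReal δ a w) := by
  set s := (stageSize μ a (z a)).toNNReal with hs
  intro k
  cases k with
  | zero => simp [stageThen, hw, ha, listPolicy, hs]
  | succ k =>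
    have hsum : ∀ j, ∑ i ∈ Finset.range (j + 1), stageThen s δ a w i
        = s + if w s < a then ∑ i ∈ Finset.range j, δ (a - w s) (fun u => w (s + u) - w s) i
          else 0 := by
      intro j
      rw [Finset.sum_range_succ', add_comm]
      congr 1
      split_ifs with h
      · exact Finset.sum_congr rfl fun i _ => by simp [stageThen, h]
      · exact Finset.sum_eq_zero fun i _ => by simp [stageThen, h]
    have hmin : min (k + 1) (z :: zs).length = min k zs.length + 1 := by simp
    rw [hmin, hsum, hsum, stageThen]
    by_cases h : w s < a
    · rw [if_pos h, if_pos h, if_pos h, hδ (a - w s) (by linarith) _ (by simp) k]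
      simp only [listPolicy, sub_sub_sub_cancel_right, sub_lt_sub_iff_right]
    · simp [h]

/-- The parameters of the first stages of `δ°_{m,h}`. -/
def interiorStages (μ : ℝ) : ℕ → (ℝ → ℝ) → List (ℝ → ℝ)
  | 0, _ => []
  | 1, _ => []
  | m + 2, h => (fun y => Real.sqrt (Real.log (y / h y ^ 2 + 1)))
      :: interiorStages μ (m + 1) (h ∘ spreadInv μ)

/-- The parameter of the concluding geometric sampling of `δ°_{m,h}`. -/
def interiorGeom (μ : ℝ) : ℕ → (ℝ → ℝ) → ℝ → ℝ
  | 0, h => fun y => if 0 < y then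
      -min (Real.sqrt (h y) / y ^ (1 / 4 : ℝ)) (y ^ (1 / 7 : ℝ)) else 0
  | 1, h => fun y => if 0 < y then
      -min (Real.sqrt (h y) / y ^ (1 / 4 : ℝ)) (y ^ (1 / 7 : ℝ)) else 0
  | m + 2, h => interiorGeom μ (m + 1) (h ∘ spreadInv μ)

theorem followsPolicy_samplerInterior (μ : ℝ) {m : ℕ} (hm : 1 ≤ m) (h : ℝ → ℝ) {a : ℝ}
    (ha : 0 < a) {w : ℝ≥0 → ℝ} (hw : w 0 = 0) :
    FollowsPolicy μ (interiorStages μ m h).length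
      (listPolicy (interiorStages μ m h) (interiorGeom μ m h)) a w (samplerInterior μ m h a w) := by
  induction m, hm using Nat.le_induction generalizing h a w with
  | base =>
    have := followsPolicy_geomSampler μ (a := a) hw (interiorGeom μ 1 h)
    rw [interiorGeom] at this
    simp only [ha, if_true] at this
    exact this
  | succ m hm ih =>
    obtain ⟨m, rfl⟩ : ∃ k, m = k + 1 := ⟨m - 1, by omega⟩
    exact followsPolicy_stageThen hw ha (z := fun y => Real.sqrt (Real.log (y / h y ^ 2 + 1)))
      fun b hb v hv => ih (h ∘ spreadInv μ) hb hv

/-- The parameters of the first stages of `δ⁺_{m,z}`. -/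
def boundaryStages (z : ℝ) : ℕ → List (ℝ → ℝ)
  | 0 => []
  | 1 => [fun _ => z]
  | m + 2 => (fun y => Real.sqrt ((1 - (1 / 2 : ℝ) ^ (m + 1)) * Real.log (y + 1)))
      :: boundaryStages z (m + 1)

/-- The parameter of the concluding geometric sampling of `δ⁺_{m,z}`. -/
def boundaryGeom (y : ℝ) : ℝ := -Real.sqrt (Real.log (y + 1))

theorem followsPolicy_samplerBoundary (μ z : ℝ) {m : ℕ} (hm : 1 ≤ m) {a : ℝ}
    (ha : 0 < a) {w : ℝ≥0 → ℝ} (hw : w 0 = 0) :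
    FollowsPolicy μ (boundaryStages z m).length
      (listPolicy (boundaryStages z m) boundaryGeom) a w (samplerBoundary μ z m a w) := by
  induction m, hm using Nat.le_induction generalizing a w with
  | base =>
    exact followsPolicy_stageThen hw ha (z := fun _ => z) (zs := [])
      (δ := fun y => geomSampler μ (-Real.sqrt (Real.log (y + 1))) y) fun b hb v hv =>
      followsPolicy_geomSampler μ hv boundaryGeom
  | succ m hm ih =>
    obtain ⟨m, rfl⟩ : ∃ k, m = k + 1 := ⟨m - 1, by omega⟩
    exact followsPolicy_stageThen hw ha
      (z := fun y => Real.sqrt ((1 - (1 / 2 : ℝ) ^ (m + 1)) * Real.log (y + 1)))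
      fun b hb v hv => ih hb hv

/-- Expected overshoot of a stage from distance `y` with parameter `ζ`, plus the expected value of
the function `v` at the remaining distance if the boundary is not crossed. -/
def stageValue (μ : ℝ) (v : ℝ → ℝ≥0∞) (ζ y : ℝ) : ℝ≥0∞ :=
  ∫⁻ x, (ENNReal.ofReal (Real.sqrt (stageSize μ y ζ) * (x - ζ))
    + if x < ζ then v (Real.sqrt (stageSize μ y ζ) * (ζ - x)) else 0) ∂(gaussianReal 0 1)

/-- The value of the policy with the parameters `zs` in the first stages, when the function `v`
is the value of what follows. -/
def listValue (μ : ℝ) (v : ℝ → ℝ≥0∞) : List (ℝ → ℝ) → ℝ → ℝ≥0∞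
  | [] => v
  | z :: zs => fun y => stageValue μ (listValue μ v zs) (z y) y

theorem measurable_stageSize (μ : ℝ) : Measurable fun p : ℝ × ℝ => stageSize μ p.1 p.2 := by
  unfold stageSize
  fun_prop

theorem measurable_stageValue (μ : ℝ) {β : Type*} [MeasurableSpace β] {v : β → ℝ → ℝ≥0∞}
    (hv : Measurable fun p : β × ℝ => v p.1 p.2) :
    Measurable fun p : β × ℝ × ℝ => stageValue μ (v p.1) p.2.1 p.2.2 := by
  unfold stageValue
  have hs : Measurable fun q : (β × ℝ × ℝ) × ℝ => Real.sqrt (stageSize μ q.1.2.2 q.1.2.1) :=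
    Real.continuous_sqrt.measurable.comp ((measurable_stageSize μ).comp (by fun_prop :
      Measurable fun q : (β × ℝ × ℝ) × ℝ => (q.1.2.2, q.1.2.1)))
  have hd : Measurable fun q : (β × ℝ × ℝ) × ℝ => q.1.2.1 - q.2 := by fun_prop
  refine Measurable.lintegral_prod_right' (f := fun q : (β × ℝ × ℝ) × ℝ =>
    ENNReal.ofReal (Real.sqrt (stageSize μ q.1.2.2 q.1.2.1) * (q.2 - q.1.2.1))
      + if q.2 < q.1.2.1 then
        v q.1.1 (Real.sqrt (stageSize μ q.1.2.2 q.1.2.1) * (q.1.2.1 - q.2)) else 0) ?_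
  refine Measurable.add (hs.mul (by fun_prop)).ennreal_ofReal (Measurable.ite ?_ ?_ ?_)
  · exact measurableSet_lt (by fun_prop) (by fun_prop)
  · exact hv.comp (f := fun q : (β × ℝ × ℝ) × ℝ =>
      (q.1.1, Real.sqrt (stageSize μ q.1.2.2 q.1.2.1) * (q.1.2.1 - q.2)))
      ((measurable_fst.comp measurable_fst).prodMk (hs.mul hd))
  · exact measurable_const

theorem measurable_listValue (μ : ℝ) {v : ℝ → ℝ≥0∞} (hv : Measurable v) {zs : List (ℝ → ℝ)}
    (hzs : ∀ z ∈ zs, Measurable z) : Measurable (listValue μ v zs) := by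
  induction zs with
  | nil => exact hv
  | cons z zs ih =>
    have h := measurable_stageValue μ (β := Unit) (v := fun _ => listValue μ v zs)
      ((ih fun z hz => hzs z (List.mem_cons_of_mem _ hz)).comp measurable_snd)
    exact h.comp (g := fun p : Unit × ℝ × ℝ => stageValue μ (listValue μ v zs) p.2.1 p.2.2)
      (f := fun y => ((), z y, y))
      (measurable_const.prodMk ((hzs z List.mem_cons_self).prodMk measurable_id))

theorem measurable_listPolicy {zs : List (ℝ → ℝ)} (hzs : ∀ z ∈ zs, Measurable z) {g : ℝ → ℝ}
    (hg : Measurable g) (k : ℕ) : Measurable (listPolicy zs g k) := by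
  induction zs generalizing k with
  | nil => exact hg
  | cons z zs ih =>
    cases k with
    | zero => exact hzs z List.mem_cons_self
    | succ k => exact ih (fun z hz => hzs z (List.mem_cons_of_mem _ hz)) k

theorem listPolicy_of_length_le {zs : List (ℝ → ℝ)} {g : ℝ → ℝ} {k : ℕ} (hk : zs.length ≤ k) :
    listPolicy zs g k = g := by
  induction zs generalizing k with
  | nil => rfl
  | cons z zs ih =>
    cases k with
    | zero => simp at hk
    | succ k => exact ih (by simpa using hk)

theorem listValue_drop (μ : ℝ) (v : ℝ → ℝ≥0∞) {zs : List (ℝ → ℝ)} (g : ℝ → ℝ) {k : ℕ}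
    (hk : k < zs.length) (y : ℝ) :
    listValue μ v (zs.drop k) y
      = stageValue μ (listValue μ v (zs.drop (k + 1))) (listPolicy zs g k y) y := by
  induction zs generalizing k with
  | nil => simp at hk
  | cons z zs ih =>
    cases k with
    | zero => rfl
    | succ k => exact ih (by simpa using hk)

/-- `T` follows a policy along the paths of `X`. -/
def RuleFollows {Ω : Type*} (μ : ℝ) (X : ℝ≥0 → Ω → ℝ) (n : ℕ) (Z : ℕ → ℝ → ℝ) (a : ℝ)
    (T : ℕ → Ω → ℝ≥0) : Prop :=
  ∀ ω, FollowsPolicy μ n Z a (fun t => X t ω) (fun k => T k ω)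

theorem RuleFollows.apply {Ω : Type*} {X : ℝ≥0 → Ω → ℝ} {T : ℕ → Ω → ℝ≥0} {μ a : ℝ}
    {n : ℕ} {Z : ℕ → ℝ → ℝ}
    (h : RuleFollows μ X n Z a T) (k : ℕ) (ω : Ω) :
    T k ω = if stagePos X T k ω < a then (stageSize μ (a - stagePos X T k ω)
      (Z k (a - stagePos X T (min k n) ω))).toNNReal else 0 := h ω k

variable {Ω : Type*} [mΩ : MeasurableSpace Ω] {X : ℝ≥0 → Ω → ℝ} {T : ℕ → Ω → ℝ≥0}
  {P : Measure Ω} {μ a : ℝ}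

/-- A policy may read its parameter off an earlier stage, so the ends of all previous stages must be
known to be stopping times. -/
theorem IsAdaptedRule.of_forall_le {F : Filtration ℝ≥0 mΩ}
    (h : ∀ k, ∀ hs : ∀ j ≤ k, IsStoppingTime F (fun ω => (stageEnd T j ω : WithTop ℝ≥0)),
      Measurable[(hs k le_rfl).measurableSpace] (T k)) : IsAdaptedRule F T := by
  have key : ∀ k, ∀ j ≤ k, IsStoppingTime F (fun ω => (stageEnd T j ω : WithTop ℝ≥0)) := by
    intro k
    induction k with
    | zero =>
      intro j hj
      obtain rfl : j = 0 := by omega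
      simp_rw [stageEnd_zero]
      exact isStoppingTime_const F 0
    | succ k ih =>
      intro j hj
      rcases Nat.lt_or_ge k j with hkj | hkj
      · obtain rfl : j = k + 1 := by omega
        simp_rw [stageEnd_succ]
        exact (ih k le_rfl).add_measurable (h k ih)
      · exact ih j hkj
  exact fun k => ⟨key k k le_rfl, h k (key k)⟩

theorem RuleFollows.isAdaptedRule {n : ℕ} {Z : ℕ → ℝ → ℝ} (h : RuleFollows μ X n Z a T)
    (hX : IsDriftBrownian P μ X) (hZ : ∀ k, Measurable (Z k)) :
    IsAdaptedRule (pastFiltration X hX.measurable) T := by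
  refine .of_forall_le fun k hs => ?_
  have hp : ∀ j ≤ k, Measurable[(hs k le_rfl).measurableSpace] (stagePos X T j) := fun j hj =>
    ((hs j hj).measurable_value hX.continuous_path).mono
      ((hs j hj).measurableSpace_mono (hs k le_rfl) fun ω => WithTop.coe_le_coe.2
        (Finset.sum_le_sum_of_subset (Finset.range_mono hj))) le_rfl
  have e : T k = fun ω => if stagePos X T k ω < a then (stageSize μ (a - stagePos X T k ω)
      (Z k (a - stagePos X T (min k n) ω))).toNNReal else 0 := funext fun ω => h.apply k ω
  rw [e]
  refine Measurable.ite (hp k le_rfl measurableSet_Iio) ?_ measurable_const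
  refine measurable_real_toNNReal.comp ((measurable_stageSize μ).comp
    (((hp k le_rfl).const_sub a).prodMk ?_))
  exact (hZ k).comp ((hp _ (min_le_left _ _)).const_sub a)

theorem stageSize_pos (hμ : 0 < μ) {y : ℝ} (hy : 0 < y) (z : ℝ) : 0 < stageSize μ y z :=
  ((stageSize_unique hμ hy _).2 rfl).1

theorem stageSize_spec (hμ : 0 < μ) {y : ℝ} (hy : 0 < y) (z : ℝ) :
    y - μ * stageSize μ y z = Real.sqrt (stageSize μ y z) * z := by
  have h := ((stageSize_unique hμ hy (stageSize μ y z)).2 rfl)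
  rw [div_eq_iff (Real.sqrt_pos.2 h.1).ne'] at h
  linarith [h.2]

/-- One step of a policy. -/
theorem RuleFollows.lintegral_step {n : ℕ} {Z : ℕ → ℝ → ℝ} (h : RuleFollows μ X n Z a T)
    [IsProbabilityMeasure P] (hX : IsDriftBrownian P μ X) (hμ : 0 < μ)
    (hZ : ∀ k, Measurable (Z k)) (k : ℕ) {β : Type*} [MeasurableSpace β] {V : Ω → β}
    (hV : Measurable[(h.isAdaptedRule hX hZ).past k] V) {v : β → ℝ → ℝ≥0∞}
    (hv : Measurable fun p : β × ℝ => v p.1 p.2) :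
    ∫⁻ ω, (ENNReal.ofReal (stagePos X T (k + 1) ω - a) + if stagePos X T (k + 1) ω < a then
        v (V ω) (a - stagePos X T (k + 1) ω) else 0) ∂P
      = ∫⁻ ω, (ENNReal.ofReal (stagePos X T k ω - a) + if stagePos X T k ω < a then
        stageValue μ (v (V ω)) (Z k (a - stagePos X T (min k n) ω)) (a - stagePos X T k ω)
          else 0) ∂P := by
  have hT := h.isAdaptedRule hX hZ
  have hg : Measurable fun p : β × ℝ => ENNReal.ofReal (p.2 - a) + if p.2 < a then
      v p.1 (a - p.2) else 0 := by
    refine Measurable.add (measurable_snd.sub_const a).ennreal_ofReal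
      (Measurable.ite ?_ ?_ measurable_const)
    · exact measurableSet_lt measurable_snd measurable_const
    · exact hv.comp (f := fun p : β × ℝ => (p.1, a - p.2)) (by fun_prop)
  have hstep := hX.lintegral_stage hT k hV hg
  simp only at hstep
  rw [hstep]
  refine lintegral_congr fun ω => ?_
  have hTk := h.apply k ω
  by_cases hb : stagePos X T k ω < a
  · rw [if_pos hb] at hTk ⊢
    set ζ := Z k (a - stagePos X T (min k n) ω)
    have hy : 0 < a - stagePos X T k ω := by linarith
    have hpos := stageSize_pos hμ hy ζ
    have hspec := stageSize_spec hμ hy ζ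
    rw [ENNReal.ofReal_of_nonpos (by linarith), zero_add, stageValue]
    refine lintegral_congr fun x => ?_
    rw [hTk, Real.coe_toNNReal _ hpos.le]
    set r := Real.sqrt (stageSize μ (a - stagePos X T k ω) ζ)
    have hr : 0 < r := Real.sqrt_pos.2 hpos
    have e1 : stagePos X T k ω + μ * stageSize μ (a - stagePos X T k ω) ζ + r * x - a
        = r * (x - ζ) := by linarith
    have e2 : a - (stagePos X T k ω + μ * stageSize μ (a - stagePos X T k ω) ζ + r * x)
        = r * (ζ - x) := by linarith
    have e3 : stagePos X T k ω + μ * stageSize μ (a - stagePos X T k ω) ζ + r * x < a ↔ x < ζ := by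
      rw [← sub_pos, e2, mul_pos_iff_of_pos_left hr, sub_pos]
    rw [e1, e2]
    simp only [e3]
  -- After a crossing the stage size is zero, so the overshoot is carried over unchanged.
  · rw [if_neg hb] at hTk
    simp [hTk, hb]

end Policies

/-! ### The risk of a policy -/

section PolicyRisk

theorem stdGaussian_map_neg : (gaussianReal 0 1).map (fun x => -x) = gaussianReal 0 1 := by
  rw [gaussianReal_map_neg, neg_zero]

/-- The integral of an even function over a half-line. -/
theorem setLIntegral_Iio_le_half {f : ℝ → ℝ≥0∞} (hf : Measurable f) (he : ∀ x, f (-x) = f x) :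
    ∫⁻ x in Set.Iio 0, f x ∂(gaussianReal 0 1) ≤ 2⁻¹ * ∫⁻ x, f x ∂(gaussianReal 0 1) := by
  have h1 : ∫⁻ x in Set.Iio 0, f x ∂(gaussianReal 0 1)
      = ∫⁻ x in Set.Ioi 0, f x ∂(gaussianReal 0 1) := by
    nth_rewrite 1 [← stdGaussian_map_neg]
    rw [setLIntegral_map measurableSet_Iio hf measurable_neg]
    simp [he]
  have h2 : ∫⁻ x in Set.Iio 0, f x ∂(gaussianReal 0 1)
      + ∫⁻ x in Set.Ioi 0, f x ∂(gaussianReal 0 1) ≤ ∫⁻ x, f x ∂(gaussianReal 0 1) := by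
    rw [← lintegral_union measurableSet_Ioi (by
      rw [Set.disjoint_left]
      intro x h1 h2
      exact absurd (Set.mem_Iio.1 h1) (not_lt.2 (Set.mem_Ioi.1 h2).le))]
    exact setLIntegral_le_lintegral _ _
  rw [← h1, ← two_mul] at h2
  rw [← ENNReal.div_eq_inv_mul, ENNReal.le_div_iff_mul_le (by simp) (by simp), mul_comm]
  exact h2

theorem stdGaussian_Iio_le {ζ : ℝ} (hζ : ζ ≤ 0) : gaussianReal 0 1 (Set.Iio ζ) ≤ 2⁻¹ := by
  have h := setLIntegral_Iio_le_half (f := fun _ => 1) measurable_const fun _ => rfl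
  simp only [lintegral_const, measure_univ, mul_one, MeasurableSet.univ,
    Measure.restrict_apply, Set.univ_inter, one_mul] at h
  exact (measure_mono (Set.Iio_subset_Iio hζ)).trans h

variable {μ : ℝ}

theorem sqrt_stageSize {y : ℝ} (hμ : 0 < μ) (hy : 0 < y) (ζ : ℝ) :
    Real.sqrt (stageSize μ y ζ) = (Real.sqrt (4 * y * μ + ζ ^ 2) - ζ) / (2 * μ) := by
  rw [stageSize_eq_sq hμ hy, Real.sqrt_sq]
  refine div_nonneg (sub_nonneg.2 ?_) (by positivity)
  exact Real.le_sqrt_of_sq_le (by nlinarith [mul_pos hy hμ])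

theorem sqrt_stageSize_le {y : ℝ} (hμ : 0 < μ) (hy : 0 < y) (ζ : ℝ) :
    Real.sqrt (stageSize μ y ζ) ≤ Real.sqrt y / Real.sqrt μ + (|ζ| - ζ) / (2 * μ) := by
  have hs : Real.sqrt (4 * y * μ + ζ ^ 2) ≤ 2 * (Real.sqrt y * Real.sqrt μ) + |ζ| := by
    refine Real.sqrt_le_iff.2 ⟨by positivity, ?_⟩
    have h1 := Real.sq_sqrt hy.le
    have h2 := Real.sq_sqrt hμ.le
    have h3 : (2 * (Real.sqrt y * Real.sqrt μ) + |ζ|) ^ 2 = 4 * (Real.sqrt y ^ 2 * Real.sqrt μ ^ 2)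
      + 4 * (Real.sqrt y * Real.sqrt μ) * |ζ| + |ζ| ^ 2 := by ring
    rw [h3, h1, h2, sq_abs]
    have : 0 ≤ 4 * (Real.sqrt y * Real.sqrt μ) * |ζ| := by positivity
    linarith
  rw [sqrt_stageSize hμ hy]
  have e : Real.sqrt y / Real.sqrt μ = 2 * (Real.sqrt y * Real.sqrt μ) / (2 * μ) := by
    have h2 := Real.mul_self_sqrt hμ.le
    have : 0 < Real.sqrt μ := Real.sqrt_pos.2 hμ
    rw [div_eq_div_iff (by positivity) (by positivity)]
    linear_combination (-2 * Real.sqrt y) * h2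
  rw [e, ← add_div]
  exact div_le_div_of_nonneg_right (by linarith) (by positivity)

/-- A bound for the expected overshoot of geometric sampling. -/
def geomBound (μ ζ y : ℝ) : ℝ≥0∞ :=
  ENNReal.ofReal (2 * (1 + |ζ|) / Real.sqrt μ * Real.sqrt y + 3 * (1 + |ζ|) ^ 2 / μ)

/-- `geomBound` is a supersolution for repeated stages with fixed `ζ ≤ 0`. With `r = √t` and `θ =
|ζ|`, a stage costs an overshoot of at most `r (1 + θ)`, and it misses the boundary on at most half
of the mass. The continuation involves only the square root of the remaining distance and adds `r (1
+ θ) / 2` plus a constant. As `r ≤ √y / √μ + θ / μ`, the coefficient `3/2` of the sum stays below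
the `2` in `geomBound`. -/
theorem stageValue_geomBound_le {y ζ : ℝ} (hμ : 0 < μ) (hy : 0 < y) (hζ : ζ ≤ 0) :
    stageValue μ (geomBound μ ζ) ζ y ≤ geomBound μ ζ y := by
  set θ := |ζ| with hθ
  have hθζ : ζ = -θ := by rw [hθ, abs_of_nonpos hζ]; ring
  have hθ0 : 0 ≤ θ := abs_nonneg ζ
  have hm : 0 < Real.sqrt μ := Real.sqrt_pos.2 hμ
  have hmm : Real.sqrt μ * Real.sqrt μ = μ := Real.mul_self_sqrt hμ.le
  set m := Real.sqrt μ
  set r := Real.sqrt (stageSize μ y ζ) with hr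
  have hr0 : 0 ≤ r := Real.sqrt_nonneg _
  have hrle : r ≤ Real.sqrt y / m + θ / (m * m) := by
    refine (sqrt_stageSize_le hμ hy ζ).trans_eq ?_
    rw [← hθ, show θ - ζ = 2 * θ by linarith, hmm, mul_div_mul_left _ _ two_ne_zero]
  set A := 2 * (1 + θ) / m with hA
  set B := 3 * (1 + θ) ^ 2 / μ with hB
  have hA0 : 0 ≤ A := by positivity
  have hB0 : 0 ≤ B := by positivity
  set c₀ := A * (m * r / 2 + 1 / m) / 2 + B with hc₀
  set c₁ := A * m * r / 4 with hc₁
  have hc₀0 : 0 ≤ c₀ := by positivity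
  have hc₁0 : 0 ≤ c₁ := by positivity
  calc stageValue μ (geomBound μ ζ) ζ y
      ≤ ∫⁻ x, (ENNReal.ofReal (r * x - -(r * θ)) + (Set.Iio 0).indicator
          (fun x => ENNReal.ofReal (c₀ + c₁ * x ^ 2)) x) ∂(gaussianReal 0 1) := by
        refine lintegral_mono fun x => add_le_add (ENNReal.ofReal_le_ofReal ?_) ?_
        · exact le_of_eq (by linear_combination (-r) * hθζ)
        · by_cases hx : x < ζ
          · have hx0 : x ∈ Set.Iio (0 : ℝ) := hx.trans_le hζ
            rw [if_pos hx, Set.indicator_of_mem hx0, geomBound]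
            refine ENNReal.ofReal_le_ofReal ?_
            -- The inequality `√p ≤ (m p + 1 / m) / 2` of arithmetic and geometric means, for a
            -- bound `p` of the remaining distance that is even in `x`; evenness is what makes the
            -- half-line integral at most half of the whole.
            have h1 : Real.sqrt (r * (ζ - x)) ≤ (m * r * (1 + x ^ 2) / 2 + 1 / m) / 2 := by
              refine Real.sqrt_le_iff.2 ⟨by positivity, ?_⟩
              have h2 : r * (ζ - x) ≤ r * ((1 + x ^ 2) / 2) := by
                gcongr
                nlinarith [sq_nonneg (x + 1)]
              have h3 : ((m * r * (1 + x ^ 2) / 2 + 1 / m) / 2) ^ 2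
                  = r * ((1 + x ^ 2) / 2) + ((m * r * (1 + x ^ 2) / 2 - 1 / m) / 2) ^ 2 := by
                field_simp
                ring
              rw [h3]
              nlinarith [sq_nonneg ((m * r * (1 + x ^ 2) / 2 - 1 / m) / 2)]
            calc _ ≤ A * ((m * r * (1 + x ^ 2) / 2 + 1 / m) / 2) + B := by gcongr
              _ = c₀ + c₁ * x ^ 2 := by rw [hc₀, hc₁]; ring
          · rw [if_neg hx]
            exact zero_le
    _ = ENNReal.ofReal (normalExcess r (-(r * θ)))
        + ∫⁻ x in Set.Iio 0, ENNReal.ofReal (c₀ + c₁ * x ^ 2) ∂(gaussianReal 0 1) := by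
        rw [lintegral_add_left (by fun_prop), lintegral_excess,
          lintegral_indicator measurableSet_Iio]
    _ ≤ ENNReal.ofReal (r + r * θ) + 2⁻¹ * ENNReal.ofReal (c₀ + c₁) := by
        gcongr
        · refine (normalExcess_le r _ hr0).trans_eq ?_
          rw [abs_neg, abs_of_nonneg (by positivity)]
        · refine (setLIntegral_Iio_le_half (by fun_prop) fun x => by simp).trans_eq ?_
          congr 1
          rw [← ofReal_integral_eq_lintegral_ofReal _ (ae_of_all _ fun x => by positivity),
            integral_add (integrable_const _) (integrable_sq_stdGaussian.const_mul _),
            integral_const_mul, integral_sq_stdGaussian]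
          · simp
          · exact (integrable_const _).add (integrable_sq_stdGaussian.const_mul _)
    _ = ENNReal.ofReal (r + r * θ + (c₀ + c₁) / 2) := by
        rw [ENNReal.ofReal_add (p := r + r * θ) (by positivity) (by positivity),
          ENNReal.ofReal_div_of_pos (x := c₀ + c₁) (by norm_num), ENNReal.div_eq_inv_mul,
          ENNReal.ofReal_ofNat]
    _ ≤ geomBound μ ζ y := by
        rw [geomBound]
        refine ENNReal.ofReal_le_ofReal ?_
        rw [← hθ, ← hA, ← hB]
        have e1 : r + r * θ + (c₀ + c₁) / 2
            = r * (1 + θ) + A * m * r / 4 + A / (4 * m) + B / 2 := by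
          rw [hc₀, hc₁]
          field_simp
          ring
        have e2 : A * m = 2 * (1 + θ) := by rw [hA]; field_simp
        have e3 : A / (4 * m) = (1 + θ) / (2 * μ) := by rw [hA, ← hmm]; field_simp; ring
        have e4 : 3 / 2 * (1 + θ) * r ≤ A * Real.sqrt y + 3 / 2 * (1 + θ) * (θ / μ) := by
          calc 3 / 2 * (1 + θ) * r ≤ 3 / 2 * (1 + θ) * (Real.sqrt y / m + θ / (m * m)) := by gcongr
            _ = 3 / 4 * (A * Real.sqrt y) + 3 / 2 * (1 + θ) * (θ / μ) := by
              rw [hA, hmm]; field_simp; ring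
            _ ≤ _ := by
              have : 0 ≤ A * Real.sqrt y := by positivity
              linarith
        have e5 : (1 + θ) / (2 * μ) + 3 / 2 * (1 + θ) * (θ / μ) ≤ B / 2 := by
          rw [hB, div_add' _ _ _ (by positivity), div_div, div_le_div_iff₀ (by positivity)
            (by positivity)]
          have : 3 / 2 * (1 + θ) * (θ / μ) * (2 * μ) = 3 * (1 + θ) * θ := by field_simp
          rw [this]
          nlinarith [mul_nonneg hθ0 hθ0]
        rw [e1, e2, e3]
        linarith

theorem measurable_geomBound (μ : ℝ) : Measurable fun p : ℝ × ℝ => geomBound μ p.1 p.2 := by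
  unfold geomBound
  fun_prop

theorem measurable_geomBound_comp (μ : ℝ) {g : ℝ → ℝ} (hg : Measurable g) :
    Measurable fun y => geomBound μ (g y) y := by
  unfold geomBound
  fun_prop

variable {Ω : Type*} [mΩ : MeasurableSpace Ω] {X : ℝ≥0 → Ω → ℝ} {T : ℕ → Ω → ℝ≥0}
  {P : Measure Ω} {a : ℝ} {zs : List (ℝ → ℝ)} {g : ℝ → ℝ}

/-- The overshoot of a policy is bounded by its value. -/
theorem RuleFollows.lintegral_overshoot_le
    (h : RuleFollows μ X zs.length (listPolicy zs g) a T) [IsProbabilityMeasure P]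
    (hX : IsDriftBrownian P μ X) (hμ : 0 < μ) (ha : 0 < a)
    (hzs : ∀ z ∈ zs, Measurable z) (hg : Measurable g) (hg0 : ∀ y, g y ≤ 0) (N : ℕ) :
    ∫⁻ ω, ENNReal.ofReal (stagePos X T N ω - a) ∂P
      ≤ listValue μ (fun y => geomBound μ (g y) y) zs a := by
  have hGm := measurable_geomBound_comp μ hg
  generalize hG : (fun y => geomBound μ (g y) y) = G at hGm
  have hZ := fun k => measurable_listPolicy hzs hg k
  have hT := h.isAdaptedRule hX hZ
  -- Overshoot so far plus the value at the remaining distance has constant mean through the listed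
  -- stages.
  have hstage : ∀ k ≤ zs.length, ∫⁻ ω, (ENNReal.ofReal (stagePos X T k ω - a)
      + if stagePos X T k ω < a then listValue μ G (zs.drop k) (a - stagePos X T k ω) else 0) ∂P
      ≤ listValue μ G zs a := by
    intro k
    induction k with
    | zero =>
      intro _
      simp [stagePos, stageEnd_zero, hX.zero, ha, ENNReal.ofReal_of_nonpos (neg_nonpos.2 ha.le)]
    | succ k ih =>
      intro hk
      have hm := measurable_listValue μ hGm fun z hz => hzs z (List.mem_of_mem_drop (i := k + 1) hz)
      have hs := h.lintegral_step hX hμ hZ k (V := fun _ => ()) measurable_const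
        (v := fun _ => listValue μ G (zs.drop (k + 1))) (hm.comp measurable_snd)
      refine le_trans (le_of_eq (hs.trans ?_)) (ih (Nat.le_of_succ_le hk))
      rw [min_eq_left (Nat.le_of_succ_le hk)]
      simp_rw [listValue_drop μ G g (show k < zs.length from hk)]
  -- From here on the parameter is frozen, and the analogous mean cannot increase because
  -- `geomBound` is a supersolution.
  have hgeom : ∀ k, zs.length ≤ k → ∫⁻ ω, (ENNReal.ofReal (stagePos X T k ω - a)
      + if stagePos X T k ω < a then geomBound μ (g (a - stagePos X T zs.length ω))
          (a - stagePos X T k ω) else 0) ∂P ≤ listValue μ G zs a := by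
    intro k hk
    induction k, hk using Nat.le_induction with
    | base =>
      refine le_trans (le_of_eq ?_) (hstage _ le_rfl)
      simp [listValue, ← hG]
    | succ k hk ih =>
      have hV : Measurable[(h.isAdaptedRule hX hZ).past k]
          fun ω => g (a - stagePos X T zs.length ω) :=
        hg.comp (((hX.measurable_stagePos hT _).mono (hT.past_mono hk) le_rfl).const_sub a)
      have hs := h.lintegral_step hX hμ hZ k hV (v := geomBound μ) (measurable_geomBound μ)
      refine le_trans (hs.le.trans ?_) ih
      rw [min_eq_right hk, listPolicy_of_length_le hk]
      refine lintegral_mono fun ω => add_le_add le_rfl ?_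
      by_cases hb : stagePos X T k ω < a
      · rw [if_pos hb, if_pos hb]
        exact stageValue_geomBound_le hμ (sub_pos.2 hb) (hg0 _)
      · rw [if_neg hb, if_neg hb]
  rcases le_total N zs.length with hN | hN
  · exact (lintegral_mono fun ω => le_self_add).trans (hstage N hN)
  · exact (lintegral_mono fun ω => le_self_add).trans (hgeom N hN)

/-- A stage with nonpositive parameter misses the boundary with probability at most one half. The
factor `2 ^ zs.length` makes the bound trivial during the listed stages. -/
theorem RuleFollows.measure_below_le
    (h : RuleFollows μ X zs.length (listPolicy zs g) a T) [IsProbabilityMeasure P]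
    (hX : IsDriftBrownian P μ X) (hμ : 0 < μ)
    (hzs : ∀ z ∈ zs, Measurable z) (hg : Measurable g) (hg0 : ∀ y, g y ≤ 0) (k : ℕ) :
    P {ω | stagePos X T k ω < a} ≤ 2 ^ zs.length * 2⁻¹ ^ k := by
  have hT := h.isAdaptedRule hX fun k => measurable_listPolicy hzs hg k
  rcases Nat.lt_or_ge k zs.length with hk | hk
  · refine prob_le_one.trans ?_
    rw [← ENNReal.inv_pow, ← ENNReal.div_eq_inv_mul.trans (mul_comm _ _),
      ENNReal.le_div_iff_mul_le (by simp) (by simp), one_mul]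
    exact pow_le_pow_right₀ (by norm_num) hk.le
  · induction k, hk using Nat.le_induction with
    | base =>
      rw [← mul_pow, ENNReal.mul_inv_cancel (by simp) (by simp), one_pow]
      exact prob_le_one
    | succ k hk ih =>
      have hQ : MeasurableSet[hT.past k] {ω | stagePos X T k ω < a} :=
        hX.measurable_stagePos hT k measurableSet_Iio
      have hs := hX.setLIntegral_stage hT k hQ (g := (Set.Iio a).indicator 1)
        (measurable_one.indicator measurableSet_Iio)
      have hsub : {ω | stagePos X T (k + 1) ω < a} ⊆ {ω | stagePos X T k ω < a} := by
        intro ω hω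
        by_contra hb
        have hTk := h.apply k ω
        rw [if_neg (show ¬ stagePos X T k ω < a from hb)] at hTk
        refine hb ?_
        have hω' : stagePos X T (k + 1) ω < a := hω
        rwa [stagePos, stageEnd_succ, hTk, add_zero] at hω'
      have e1 : ∫⁻ ω in {ω | stagePos X T k ω < a}, (Set.Iio a).indicator 1
          (stagePos X T (k + 1) ω) ∂P = P {ω | stagePos X T (k + 1) ω < a} := by
        have hm : MeasurableSet (stagePos X T (k + 1) ⁻¹' Set.Iio a) :=
          hX.measurable_stagePos' hT _ measurableSet_Iio
        have e2 : {ω | stagePos X T (k + 1) ω < a}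
            = stagePos X T (k + 1) ⁻¹' Set.Iio a ∩ {ω | stagePos X T k ω < a} :=
          (Set.inter_eq_left.2 hsub).symm
        rw [e2, ← Measure.restrict_apply hm, ← lintegral_indicator_one hm]
        rfl
      rw [← e1, hs]
      calc _ ≤ ∫⁻ ω in {ω | stagePos X T k ω < a}, 2⁻¹ ∂P := by
            refine setLIntegral_mono' (hT.past_le k _ hQ) fun ω hω => ?_
            have hTk := h.apply k ω
            rw [if_pos (show stagePos X T k ω < a from hω), min_eq_right hk,
              listPolicy_of_length_le hk] at hTk
            set ζ := g (a - stagePos X T zs.length ω)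
            have hy : 0 < a - stagePos X T k ω := sub_pos.2 hω
            have hpos := stageSize_pos hμ hy ζ
            have hspec := stageSize_spec hμ hy ζ
            rw [hTk, Real.coe_toNNReal _ hpos.le]
            set r := Real.sqrt (stageSize μ (a - stagePos X T k ω) ζ)
            have hr : 0 < r := Real.sqrt_pos.2 hpos
            refine le_trans ?_ (stdGaussian_Iio_le (hg0 (a - stagePos X T zs.length ω)))
            rw [← lintegral_indicator_one measurableSet_Iio]
            refine lintegral_mono fun x => ?_
            by_cases hx : x ∈ Set.Iio ζ
            · rw [Set.indicator_of_mem hx]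
              exact Set.indicator_le_self _ _ _
            · have hx' : stagePos X T k ω + μ * stageSize μ (a - stagePos X T k ω) ζ + r * x
                  ∉ Set.Iio a := by
                rw [Set.mem_Iio, not_lt] at hx ⊢
                nlinarith
              simp [hx']
        _ = 2⁻¹ * P {ω | stagePos X T k ω < a} := setLIntegral_const _ _
        _ ≤ 2⁻¹ * (2 ^ zs.length * 2⁻¹ ^ k) := by gcongr
        _ = _ := by rw [pow_succ]; ring

/-- The risk of a policy is bounded in terms of its value. -/
theorem RuleFollows.risk_le
    (h : RuleFollows μ X zs.length (listPolicy zs g) a T) [IsProbabilityMeasure P]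
    (hX : IsDriftBrownian P μ X) (hμ : 0 < μ) (ha : 0 < a)
    (hzs : ∀ z ∈ zs, Measurable z) (hg : Measurable g) (hg0 : ∀ y, g y ≤ 0) {c v : ℝ}
    (hc : 0 ≤ c) (hv0 : 0 ≤ v)
    (hv : listValue μ (fun y => geomBound μ (g y) y) zs a ≤ ENNReal.ofReal v) :
    risk P μ X c a T ≤ ((v / μ + 2 ^ (zs.length + 1) * c : ℝ) : EReal) := by
  have hT := h.isAdaptedRule hX fun k => measurable_listPolicy hzs hg k
  have hB : ∀ N, ∫⁻ ω, ENNReal.ofReal (stagePos X T N ω - a) ∂P ≤ ENNReal.ofReal v := fun N =>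
    (h.lintegral_overshoot_le hX hμ ha hzs hg hg0 N).trans hv
  have hE : ∫⁻ ω, totalTime X T a ω ∂P ≤ ENNReal.ofReal ((a + v) / μ) := by
    -- A policy takes stages of size zero after crossing, so little is given away by summing all of
    -- them; Wald's identity bounds the means of the partial sums uniformly.
    have h1 : ∫⁻ ω, totalTime X T a ω ∂P ≤ ∫⁻ ω, ∑' j, (T j ω : ℝ≥0∞) ∂P := by
      refine lintegral_mono fun ω => ENNReal.tsum_le_tsum fun j => ?_
      split_ifs
      · exact le_rfl
      · exact zero_le
    refine h1.trans ?_
    rw [lintegral_tsum fun j => (hT.measurable_stage' j).coe_nnreal_ennreal.aemeasurable,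
      ENNReal.tsum_eq_iSup_nat]
    refine iSup_le fun N => ?_
    rw [← lintegral_finsetSum _ fun j _ => (hT.measurable_stage' j).coe_nnreal_ennreal]
    have hw := hX.wald hμ hT ha.le N fun j _ => ne_top_of_le_ne_top ENNReal.ofReal_ne_top (hB j)
    have h2 : ∫⁻ ω, ENNReal.ofReal (μ * stageEnd T N ω) ∂P ≤ ENNReal.ofReal (a + v) := by
      rw [ENNReal.ofReal_add ha.le hv0]
      refine (lintegral_mono fun ω => le_self_add).trans (hw.le.trans ?_)
      gcongr
      exact hB N
    simp_rw [ENNReal.ofReal_mul hμ.le, ENNReal.ofReal_coe_nnreal] at h2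
    rw [lintegral_const_mul _ (hT.measurable_stageEnd' N).coe_nnreal_ennreal] at h2
    rw [ENNReal.ofReal_div_of_pos hμ, ENNReal.le_div_iff_mul_le (Or.inl (by simpa using hμ))
      (Or.inl ENNReal.ofReal_ne_top), mul_comm]
    refine le_trans (le_of_eq ?_) h2
    congr 2
    ext ω
    simp [stageEnd]
  have hM : ∫⁻ ω, (stageCount X T a ω : ℝ≥0∞) ∂P ≤ ENNReal.ofReal (2 ^ (zs.length + 1)) := by
    rw [hX.lintegral_stageCount hT]
    calc ∑' k, P {ω | StillBelow X T a k ω} ≤ ∑' k, 2 ^ zs.length * (2⁻¹ : ℝ≥0∞) ^ k := by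
          refine ENNReal.tsum_le_tsum fun k => le_trans (measure_mono fun ω hω => ?_)
            (h.measure_below_le hX hμ hzs hg hg0 k)
          rcases Nat.eq_zero_or_pos k with rfl | hk
          · simp [stagePos, stageEnd_zero, hX.zero, ha]
          · exact hω k hk le_rfl
      _ = ENNReal.ofReal (2 ^ (zs.length + 1)) := by
          rw [ENNReal.tsum_mul_left, ENNReal.tsum_geometric, ENNReal.one_sub_inv_two, inv_inv,
            ENNReal.ofReal_pow (by norm_num)]
          simp [pow_succ]
  have hsum : ∫⁻ ω, totalTime X T a ω ∂P
      + ENNReal.ofReal c * ∫⁻ ω, (stageCount X T a ω : ℝ≥0∞) ∂P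
      ≤ ENNReal.ofReal ((a + v) / μ + 2 ^ (zs.length + 1) * c) := by
    rw [ENNReal.ofReal_add (by positivity) (by positivity), mul_comm _ c, ENNReal.ofReal_mul hc]
    gcongr
  unfold risk
  rw [EReal.sub_le_iff_le_add (by simp) (by simp), ← EReal.coe_add]
  have h3 : v / μ + 2 ^ (zs.length + 1) * c + a / μ = (a + v) / μ + 2 ^ (zs.length + 1) * c := by
    ring
  rw [h3]
  have h4 := EReal.coe_ennreal_le_coe_ennreal_iff.2 hsum
  rwa [EReal.coe_ennreal_ofReal, max_eq_left (by positivity)] at h4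

end PolicyRisk

/-! ### Estimates for a single stage -/

section StageEstimates

theorem lintegral_exp_stdGaussian (t : ℝ) :
    ∫⁻ x, ENNReal.ofReal (Real.exp (t * x)) ∂(gaussianReal 0 1)
      = ENNReal.ofReal (Real.exp (t ^ 2 / 2)) := by
  rw [← ofReal_integral_eq_lintegral_ofReal (integrable_exp_mul_gaussianReal t)
    (ae_of_all _ fun x => (Real.exp_pos _).le)]
  have h := congrFun (mgf_id_gaussianReal (μ := 0) (v := 1)) t
  simp only [mgf, id] at h
  rw [h]
  simp

theorem exp_half_le : Real.exp (1 / 2) ≤ 2 := by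
  have h := Real.exp_one_lt_d9
  have h2 : Real.exp (1 / 2) ^ 2 = Real.exp 1 := by rw [← Real.exp_nat_mul]; norm_num
  nlinarith [Real.exp_pos (1 / 2)]

/-- Exponential domination `x - ζ ≤ exp ((ζ + 1) (x - ζ))`; the Gaussian moment generating function
turns it into `exp (1/2 - ζ² / 2)`. -/
theorem lintegral_excess_le {r ζ : ℝ} (hr : 0 ≤ r) (hζ : 0 ≤ ζ) :
    ∫⁻ x, ENNReal.ofReal (r * (x - ζ)) ∂(gaussianReal 0 1)
      ≤ ENNReal.ofReal (2 * r * Real.exp (-(ζ ^ 2) / 2)) := by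
  calc ∫⁻ x, ENNReal.ofReal (r * (x - ζ)) ∂(gaussianReal 0 1)
      ≤ ∫⁻ x, ENNReal.ofReal (r * Real.exp (-((ζ + 1) * ζ))) *
          ENNReal.ofReal (Real.exp ((ζ + 1) * x)) ∂(gaussianReal 0 1) := by
        refine lintegral_mono fun x => ?_
        rw [← ENNReal.ofReal_mul (by positivity)]
        refine ENNReal.ofReal_le_ofReal ?_
        rw [mul_assoc, ← Real.exp_add]
        refine mul_le_mul_of_nonneg_left ?_ hr
        rcases le_total x ζ with h | h
        · exact (sub_nonpos.2 h).trans (Real.exp_pos _).le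
        · have := Real.add_one_le_exp (-((ζ + 1) * ζ) + (ζ + 1) * x)
          nlinarith [mul_nonneg hζ (sub_nonneg.2 h)]
    _ = ENNReal.ofReal (r * Real.exp (-((ζ + 1) * ζ)) * Real.exp ((ζ + 1) ^ 2 / 2)) := by
        rw [lintegral_const_mul _ (by fun_prop), lintegral_exp_stdGaussian,
          ← ENNReal.ofReal_mul (by positivity)]
    _ ≤ _ := by
        refine ENNReal.ofReal_le_ofReal ?_
        have e : -((ζ + 1) * ζ) + (ζ + 1) ^ 2 / 2 = 1 / 2 + -(ζ ^ 2) / 2 := by ring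
        rw [mul_assoc, ← Real.exp_add, e, Real.exp_add, mul_comm 2 r, mul_assoc]
        gcongr
        exact exp_half_le

theorem lintegral_excess_le_affine {r ζ : ℝ} (hr : 0 ≤ r) :
    ∫⁻ x, ENNReal.ofReal (r * (x - ζ)) ∂(gaussianReal 0 1)
      ≤ ENNReal.ofReal (r * (1 + |ζ|)) := by
  have h : ∀ x, r * (x - ζ) = r * x - r * ζ := fun x => by ring
  simp_rw [h]
  rw [lintegral_excess]
  refine ENNReal.ofReal_le_ofReal ((normalExcess_le r _ hr).trans_eq ?_)
  rw [abs_mul, abs_of_nonneg hr]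
  ring

theorem lintegral_undershoot_le {r ζ A B : ℝ} {v : ℝ → ℝ≥0∞} (hr : 0 < r) (hA : 0 ≤ A)
    (hB : 0 ≤ B) (hv : ∀ u, 0 < u → v u ≤ ENNReal.ofReal (A + B * u)) :
    ∫⁻ x, (if x < ζ then v (r * (ζ - x)) else 0) ∂(gaussianReal 0 1)
      ≤ ENNReal.ofReal (A + B * (r * (|ζ| + 1))) := by
  calc ∫⁻ x, (if x < ζ then v (r * (ζ - x)) else 0) ∂(gaussianReal 0 1)
      ≤ ∫⁻ x, ENNReal.ofReal (A + B * (r * (|ζ| + 1 / 2)) + B * r / 2 * x ^ 2)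
          ∂(gaussianReal 0 1) := by
        refine lintegral_mono fun x => ?_
        by_cases hx : x < ζ
        · rw [if_pos hx]
          refine (hv _ (mul_pos hr (sub_pos.2 hx))).trans (ENNReal.ofReal_le_ofReal ?_)
          have h1 : ζ - x ≤ |ζ| + 1 / 2 + x ^ 2 / 2 := by
            nlinarith [le_abs_self ζ, sq_nonneg (x + 1)]
          have h2 := mul_le_mul_of_nonneg_left h1 (mul_nonneg hB hr.le)
          linarith
        · rw [if_neg hx]
          exact zero_le
    _ = _ := by
        rw [← ofReal_integral_eq_lintegral_ofReal _ (ae_of_all _ fun x => by positivity),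
          integral_add (integrable_const _) (integrable_sq_stdGaussian.const_mul _),
          integral_const_mul, integral_sq_stdGaussian]
        · congr 1
          simp only [integral_const, probReal_univ, one_smul]
          ring
        · exact (integrable_const _).add (integrable_sq_stdGaussian.const_mul _)

/-- For `x < -K` the linear factor is dominated through `1 - x ≤ exp (-x) ≤ exp (-K² - (K + 1) x)`.
The Gaussian mean of the last term is at most `e^{3/2} exp (-K² / 4)`, and `e^{3/2} ≤ 8`. -/
theorem setLIntegral_undershoot_tail_le {r ζ K : ℝ} (hr : 0 ≤ r) (hζ : 0 ≤ ζ) (hK : 0 ≤ K) :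
    ∫⁻ x in Set.Iio (-K), ENNReal.ofReal (1 + r * (ζ - x)) ∂(gaussianReal 0 1)
      ≤ ENNReal.ofReal ((1 + r) * (1 + ζ) * (8 * Real.exp (-(K ^ 2) / 4))) := by
  calc ∫⁻ x in Set.Iio (-K), ENNReal.ofReal (1 + r * (ζ - x)) ∂(gaussianReal 0 1)
      ≤ ∫⁻ x in Set.Iio (-K), ENNReal.ofReal ((1 + r) * (1 + ζ) * Real.exp (-(K ^ 2))) *
          ENNReal.ofReal (Real.exp (-(K + 1) * x)) ∂(gaussianReal 0 1) := by
        refine setLIntegral_mono' measurableSet_Iio fun x hx => ?_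
        rw [Set.mem_Iio] at hx
        rw [← ENNReal.ofReal_mul (by positivity)]
        refine ENNReal.ofReal_le_ofReal ?_
        have hx0 : 0 ≤ -x := by linarith
        have h1 : 1 + r * (ζ - x) ≤ (1 + r) * (1 + ζ) * (1 - x) := by
          nlinarith [mul_nonneg hr hζ, mul_nonneg hr hx0, mul_nonneg hζ hx0,
            mul_nonneg (mul_nonneg hr hζ) hx0]
        rw [mul_assoc _ (Real.exp _), ← Real.exp_add]
        refine h1.trans (mul_le_mul_of_nonneg_left ?_ (by positivity))
        have h2 := Real.add_one_le_exp (-x)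
        have h3 : Real.exp (-x) ≤ Real.exp (-(K ^ 2) + -(K + 1) * x) := by
          refine Real.exp_le_exp.2 ?_
          nlinarith
        linarith
    _ ≤ ∫⁻ x, ENNReal.ofReal ((1 + r) * (1 + ζ) * Real.exp (-(K ^ 2))) *
          ENNReal.ofReal (Real.exp (-(K + 1) * x)) ∂(gaussianReal 0 1) :=
        setLIntegral_le_lintegral _ _
    _ = ENNReal.ofReal ((1 + r) * (1 + ζ) * (Real.exp (-(K ^ 2)) *
          Real.exp ((-(K + 1)) ^ 2 / 2))) := by
        rw [lintegral_const_mul _ (by fun_prop), lintegral_exp_stdGaussian,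
          ← ENNReal.ofReal_mul (by positivity), mul_assoc]
    _ ≤ _ := by
        refine ENNReal.ofReal_le_ofReal (mul_le_mul_of_nonneg_left ?_ (by positivity))
        have h8 : Real.exp (1 / 2) ^ 3 ≤ 2 ^ 3 := by gcongr; exact exp_half_le
        rw [← Real.exp_nat_mul] at h8
        norm_num at h8
        calc _ ≤ Real.exp (3 / 2) * Real.exp (-(K ^ 2) / 4) := by
              rw [← Real.exp_add, ← Real.exp_add]
              refine Real.exp_le_exp.2 ?_
              nlinarith [sq_nonneg (K - 2)]
          _ ≤ _ := by gcongr

variable {μ y ζ : ℝ} {v : ℝ → ℝ≥0∞}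

theorem sqrt_stageSize_pos (hμ : 0 < μ) (hy : 0 < y) (ζ : ℝ) :
    0 < Real.sqrt (stageSize μ y ζ) := Real.sqrt_pos.2 (stageSize_pos hμ hy ζ)

theorem sqrt_stageSize_le_of_nonneg (hμ : 0 < μ) (hy : 0 < y) (hζ : 0 ≤ ζ) :
    Real.sqrt (stageSize μ y ζ) ≤ Real.sqrt y / Real.sqrt μ := by
  have h := sqrt_stageSize_le hμ hy ζ
  rwa [abs_of_nonneg hζ, sub_self, zero_div, add_zero] at h

theorem sqrt_stageSize_mul_le (hμ : 0 < μ) (hy : 0 < y) :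
    Real.sqrt (stageSize μ y ζ) * ζ ≤ y := by
  have h := stageSize_spec hμ hy ζ
  have := mul_pos hμ (stageSize_pos hμ hy ζ)
  linarith

theorem stageValue_eq_add (μ : ℝ) (v : ℝ → ℝ≥0∞) (ζ y : ℝ) :
    stageValue μ v ζ y
      = ∫⁻ x, ENNReal.ofReal (Real.sqrt (stageSize μ y ζ) * (x - ζ)) ∂(gaussianReal 0 1)
        + ∫⁻ x, (if x < ζ then v (Real.sqrt (stageSize μ y ζ) * (ζ - x)) else 0)
          ∂(gaussianReal 0 1) := by
  rw [stageValue, lintegral_add_left (by fun_prop)]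

theorem stageValue_le_of_affine {A B : ℝ} (hμ : 0 < μ) (hy : 0 < y) (hA : 0 ≤ A) (hB : 0 ≤ B)
    (hv : ∀ u, 0 < u → v u ≤ ENNReal.ofReal (A + B * u)) :
    stageValue μ v ζ y ≤ ENNReal.ofReal
      (A + (B + 1) * (Real.sqrt (stageSize μ y ζ) * (|ζ| + 1))) := by
  have hr := sqrt_stageSize_pos hμ hy ζ
  rw [stageValue_eq_add]
  refine (add_le_add (lintegral_excess_le_affine hr.le)
    (lintegral_undershoot_le hr hA hB hv)).trans_eq ?_
  rw [← ENNReal.ofReal_add (by positivity) (by positivity)]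
  congr 1
  ring

theorem stageValue_le_of_nonneg {A B : ℝ} (hμ : 0 < μ) (hy : 0 < y) (hζ : 0 ≤ ζ) (hA : 0 ≤ A)
    (hB : 0 ≤ B) (hv : ∀ u, 0 < u → v u ≤ ENNReal.ofReal (A + B * u)) :
    stageValue μ v ζ y ≤ ENNReal.ofReal
      (2 * (Real.sqrt y / Real.sqrt μ) * Real.exp (-(ζ ^ 2) / 2)
        + (A + B * (Real.sqrt y / Real.sqrt μ * (ζ + 1)))) := by
  have hr := sqrt_stageSize_pos hμ hy ζ
  have hle := sqrt_stageSize_le_of_nonneg hμ hy hζ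
  rw [stageValue_eq_add, ENNReal.ofReal_add (by positivity) (by positivity)]
  refine add_le_add ((lintegral_excess_le hr.le hζ).trans (ENNReal.ofReal_le_ofReal ?_))
    ((lintegral_undershoot_le hr hA hB hv).trans (ENNReal.ofReal_le_ofReal ?_))
  · gcongr
  · rw [abs_of_nonneg hζ]
    gcongr

/-- A bound for the value of a stage, when the continuation value is at most `A` up to
distance `L`, and of linear growth. -/
theorem stageValue_le_of_split {A B K L : ℝ} (hμ : 0 < μ) (hy : 0 < y) (hζ : 0 ≤ ζ) (hA : 0 ≤ A)
    (hB : 0 ≤ B) (hK : 0 ≤ K) (hL : Real.sqrt y / Real.sqrt μ * (K + ζ) ≤ L)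
    (hvA : ∀ u, 0 < u → u ≤ L → v u ≤ ENNReal.ofReal A)
    (hvB : ∀ u, 0 < u → v u ≤ ENNReal.ofReal (B * (1 + u))) :
    stageValue μ v ζ y ≤ ENNReal.ofReal
      (2 * (Real.sqrt y / Real.sqrt μ) * Real.exp (-(ζ ^ 2) / 2)
        + (A + B * ((1 + Real.sqrt y / Real.sqrt μ) * (1 + ζ) *
          (8 * Real.exp (-(K ^ 2) / 4))))) := by
  have hr := sqrt_stageSize_pos hμ hy ζ
  have hle := sqrt_stageSize_le_of_nonneg hμ hy hζ
  rw [stageValue_eq_add]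
  generalize Real.sqrt (stageSize μ y ζ) = r at hr hle
  generalize Real.sqrt y / Real.sqrt μ = R at hle hL
  have hR : 0 ≤ R := hr.le.trans hle
  rw [ENNReal.ofReal_add (by positivity) (by positivity),
    ENNReal.ofReal_add (p := A) (by positivity) (by positivity)]
  refine add_le_add ((lintegral_excess_le hr.le hζ).trans (ENNReal.ofReal_le_ofReal ?_)) ?_
  · gcongr
  · calc ∫⁻ x, (if x < ζ then v (r * (ζ - x)) else 0) ∂(gaussianReal 0 1)
        ≤ ∫⁻ x, (ENNReal.ofReal A + (Set.Iio (-K)).indicator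
            (fun x => ENNReal.ofReal B * ENNReal.ofReal (1 + r * (ζ - x))) x)
            ∂(gaussianReal 0 1) := by
          refine lintegral_mono fun x => ?_
          by_cases hx : x < ζ
          · rw [if_pos hx]
            have hu : 0 < r * (ζ - x) := mul_pos hr (sub_pos.2 hx)
            by_cases hxK : x ∈ Set.Iio (-K)
            · rw [Set.indicator_of_mem hxK, ← ENNReal.ofReal_mul hB]
              exact (hvB _ hu).trans le_add_self
            · refine (hvA _ hu (le_trans ?_ hL)).trans le_self_add
              rw [Set.mem_Iio, not_lt] at hxK
              exact mul_le_mul hle (by linarith) (by linarith) hR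
          · rw [if_neg hx]
            exact zero_le
      _ = ENNReal.ofReal A + ENNReal.ofReal B *
            ∫⁻ x in Set.Iio (-K), ENNReal.ofReal (1 + r * (ζ - x)) ∂(gaussianReal 0 1) := by
          rw [lintegral_add_left measurable_const, lintegral_const, measure_univ, mul_one,
            lintegral_indicator measurableSet_Iio, lintegral_const_mul _ (by fun_prop)]
      _ ≤ _ := by
          rw [ENNReal.ofReal_mul hB]
          gcongr
          refine (setLIntegral_undershoot_tail_le hr.le hζ hK).trans
            (ENNReal.ofReal_le_ofReal ?_)
          gcongr

end StageEstimates

/-! ### Growth of the critical functions, and the spread function -/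

section CriticalGrowth

variable {m : ℕ}

theorem one_le_log {w : ℝ} (hw : 3 ≤ w) : 1 ≤ Real.log w := by
  rw [Real.le_log_iff_exp_le (by linarith)]
  exact Real.exp_one_lt_d9.le.trans (by linarith)

theorem half_pow_le_half (hm : 1 ≤ m) : (1 / 2 : ℝ) ^ m ≤ 1 / 2 := by
  calc (1 / 2 : ℝ) ^ m ≤ (1 / 2 : ℝ) ^ 1 :=
        pow_le_pow_of_le_one (by norm_num) (by norm_num) hm
    _ = 1 / 2 := pow_one _

theorem critFun_of_pos (hm : 1 ≤ m) (x : ℝ) :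
    critFun m x = x ^ ((1 / 2 : ℝ) ^ m) * (Real.log x) ^ (1 / 2 - (1 / 2 : ℝ) ^ m) := by
  rw [critFun, if_neg (by omega)]

theorem critFun_nonneg (m : ℕ) {x : ℝ} (hx : 1 ≤ x) : 0 ≤ critFun m x := by
  have := Real.log_nonneg hx
  unfold critFun
  split_ifs <;> positivity

theorem critFun_mono (hm : 1 ≤ m) {x y : ℝ} (hx : 1 ≤ x) (hxy : x ≤ y) :
    critFun m x ≤ critFun m y := by
  have := Real.log_nonneg hx
  have := half_pow_le_half hm
  have hy : 0 ≤ y := by linarith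
  rw [critFun_of_pos hm, critFun_of_pos hm]
  gcongr

theorem rpow_half_le_critFun (hm : 1 ≤ m) {x : ℝ} (hx : 3 ≤ x) :
    x ^ ((1 / 2 : ℝ) ^ m) ≤ critFun m x := by
  rw [critFun_of_pos hm]
  exact le_mul_of_one_le_right (by positivity)
    (Real.one_le_rpow (one_le_log hx) (by linarith [half_pow_le_half hm]))

theorem one_le_critFun (hm : 1 ≤ m) {x : ℝ} (hx : 3 ≤ x) : 1 ≤ critFun m x :=
  (Real.one_le_rpow (by linarith) (half_pow_pos m).le).trans (rpow_half_le_critFun hm hx)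

theorem tendsto_critFun (hm : 1 ≤ m) : Tendsto (critFun m) atTop atTop :=
  tendsto_atTop_mono' _ ((eventually_ge_atTop 3).mono fun _ hx => rpow_half_le_critFun hm hx)
    (tendsto_rpow_atTop (half_pow_pos m))

/-- The two exponents in `h_m` add up to `1/2`, so a factor `c` in both the argument and the
logarithm comes out as `√c ≤ c`. -/
theorem critFun_mul_le_of_log_le (hm : 1 ≤ m) {c s l : ℝ} (hc : 1 ≤ c) (hs : 1 ≤ s)
    (hl : Real.log (c * s) ≤ c * l) :
    critFun m (c * s) ≤ c * (s ^ ((1 / 2 : ℝ) ^ m) * l ^ (1 / 2 - (1 / 2 : ℝ) ^ m)) := by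
  have h0 : 0 ≤ Real.log (c * s) := Real.log_nonneg (by nlinarith)
  have hl0 : 0 ≤ l := by
    have := h0.trans hl
    nlinarith
  have hm' := half_pow_le_half hm
  have hp := half_pow_pos m
  rw [critFun_of_pos hm]
  generalize (1 / 2 : ℝ) ^ m = α at hm' hp
  calc (c * s) ^ α * Real.log (c * s) ^ (1 / 2 - α)
      ≤ (c * s) ^ α * (c * l) ^ (1 / 2 - α) := by gcongr
    _ = c ^ (1 / 2 : ℝ) * (s ^ α * l ^ (1 / 2 - α)) := by
        have hsum : α + (1 / 2 - α) = 1 / 2 := by ring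
        rw [Real.mul_rpow (by linarith) (by linarith), Real.mul_rpow (by linarith) hl0, ← hsum,
          Real.rpow_add (by linarith), hsum]
        ring
    _ ≤ c * (s ^ α * l ^ (1 / 2 - α)) := by
        gcongr
        calc c ^ (1 / 2 : ℝ) ≤ c ^ (1 : ℝ) :=
              Real.rpow_le_rpow_of_exponent_le hc (by norm_num)
          _ = c := Real.rpow_one c

theorem critFun_mul_le (hm : 1 ≤ m) {c s : ℝ} (hc : 1 ≤ c) (hs : 3 ≤ s) :
    critFun m (c * s) ≤ c * critFun m s := by
  have hl := one_le_log hs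
  rw [critFun_of_pos hm s]
  refine critFun_mul_le_of_log_le hm hc (by linarith) ?_
  rw [Real.log_mul (by linarith) (by linarith)]
  nlinarith [Real.log_le_sub_one_of_pos (show 0 < c by linarith)]

theorem critFun_add_three_le (hm : 1 ≤ m) {x : ℝ} (hx : 3 ≤ x) :
    critFun m (x + 3) ≤ 2 * critFun m x :=
  (critFun_mono hm (by linarith) (by linarith)).trans (critFun_mul_le hm one_le_two hx)

theorem one_le_sqrt_mul_log {w : ℝ} (hw : 3 ≤ w) : 1 ≤ Real.sqrt (w * Real.log w) := by
  rw [Real.one_le_sqrt]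
  nlinarith [one_le_log hw]

/-- Self-similarity of the critical functions: with `log √(w log w)` replaced by `log w`, the value
of `h_m` at `√(w log w)` is exactly `h_{m+1} w`. This is why one more stage leads to the next band.
-/
theorem critFun_sqrt_mul_log_le (hm : 1 ≤ m) {c w : ℝ} (hc : 1 ≤ c) (hw : 3 ≤ w) :
    critFun m (c * Real.sqrt (w * Real.log w)) ≤ c * critFun (m + 1) w := by
  have hl := one_le_log hw
  have hw0 : 0 < w := by linarith
  refine (critFun_mul_le_of_log_le hm (l := Real.log w) hc (one_le_sqrt_mul_log hw) ?_).trans_eq ?_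
  · rw [Real.log_mul (by linarith) (by linarith [one_le_sqrt_mul_log hw]),
      Real.log_sqrt (by positivity), Real.log_mul hw0.ne' (by linarith)]
    have h1 := Real.log_le_sub_one_of_pos (show 0 < c by linarith)
    have h2 := Real.log_le_sub_one_of_pos (show 0 < Real.log w by linarith)
    nlinarith
  · rw [critFun_of_pos (Nat.le_add_left 1 m), Real.sqrt_eq_rpow, ← Real.rpow_mul (by positivity),
      Real.mul_rpow hw0.le (by linarith), mul_assoc (w ^ _), ← Real.rpow_add (by linarith)]
    congr 3 <;> ring_nf

/-- The quotient of the squares is the power of `x / log x` with exponent `-(1/2)^m`. -/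
theorem isLittleO_critFun_succ (hm : 1 ≤ m) : critFun (m + 1) =o[atTop] critFun m := by
  obtain ⟨k, rfl⟩ : ∃ k, m = k + 1 := ⟨m - 1, by omega⟩
  refine isLittleO_iff.2 fun c hc => ?_
  have hlim : Tendsto (fun x : ℝ => x / Real.log x) atTop atTop := by
    have h := Real.isLittleO_log_id_atTop.tendsto_div_nhds_zero
    have h2 : Tendsto (fun x : ℝ => (Real.log x / x)⁻¹) atTop atTop := by
      refine Tendsto.inv_tendsto_nhdsGT_zero (tendsto_nhdsWithin_iff.2 ⟨h, ?_⟩)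
      filter_upwards [eventually_gt_atTop 1] with x hx
      exact div_pos (Real.log_pos hx) (by linarith)
    simpa using h2
  have h1 := ((tendsto_rpow_atTop (half_pow_pos (k + 1))).comp hlim).eventually_ge_atTop
    (1 / c ^ 2)
  filter_upwards [h1, eventually_gt_atTop 1] with x h1 hx
  rw [Function.comp_apply] at h1
  rw [Real.norm_of_nonneg (critFun_nonneg _ hx.le), Real.norm_of_nonneg (critFun_nonneg _ hx.le)]
  refine le_of_sq_le_sq ?_ (mul_nonneg hc.le (critFun_nonneg _ hx.le))
  rw [mul_pow, critFun_sq hx.le, critFun_sq hx.le, critSq_eq hx, critSq_eq hx]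
  have hl := Real.log_pos hx
  have hpos : 0 < x / Real.log x := div_pos (by linarith) hl
  set q := (x / Real.log x) ^ ((1 / 2 : ℝ) ^ (k + 1)) with hq
  have hq0 : 0 < q := by positivity
  have e : (x / Real.log x) ^ ((1 / 2 : ℝ) ^ k) = q * q := by
    rw [hq, ← Real.rpow_add hpos]
    congr 1
    rw [pow_succ]
    ring
  rw [e]
  rw [div_le_iff₀ (by positivity)] at h1
  have : Real.log x * q * 1 ≤ Real.log x * q * (q * c ^ 2) := by gcongr
  linarith

end CriticalGrowth

/-! ### The spread function and its inverse -/

section Spread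

variable {μ : ℝ}

theorem spreadFun_strictMonoOn (hμ : 0 < μ) : StrictMonoOn (spreadFun μ) (Set.Ici 0) := by
  intro x hx y hy hxy
  rw [Set.mem_Ici] at hx hy
  have hm : 0 < Real.sqrt μ := Real.sqrt_pos.2 hμ
  have hl : 0 ≤ Real.log (x + 1) := Real.log_nonneg (by linarith)
  have hl' : Real.log (x + 1) < Real.log (y + 1) := Real.log_lt_log (by linarith) (by linarith)
  unfold spreadFun
  refine mul_lt_mul_of_pos_left (Real.sqrt_lt_sqrt (by positivity) ?_) (by positivity)
  nlinarith

theorem spreadFun_zero (μ : ℝ) : spreadFun μ 0 = 0 := by simp [spreadFun]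

theorem spreadFun_pos (hμ : 0 < μ) {x : ℝ} (hx : 0 < x) : 0 < spreadFun μ x := by
  have := spreadFun_strictMonoOn hμ Set.self_mem_Ici hx.le hx
  rwa [spreadFun_zero] at this

theorem tendsto_spreadFun (hμ : 0 < μ) : Tendsto (spreadFun μ) atTop atTop := by
  have hm : 0 < Real.sqrt μ := Real.sqrt_pos.2 hμ
  refine Tendsto.const_mul_atTop (by positivity) (Real.tendsto_sqrt_atTop.comp ?_)
  exact tendsto_id.atTop_mul_atTop₀ (Real.tendsto_log_atTop.comp
    (tendsto_atTop_add_const_right _ 1 tendsto_id))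

theorem continuousOn_spreadFun (μ : ℝ) : ContinuousOn (spreadFun μ) (Set.Ici 0) := by
  have h : ContinuousOn (fun x : ℝ => Real.log (x + 1)) (Set.Ici 0) :=
    ContinuousOn.log (by fun_prop) fun x hx => by
      rw [Set.mem_Ici] at hx
      linarith
  exact continuousOn_const.mul (continuousOn_id.mul h).sqrt

theorem surjOn_spreadFun (hμ : 0 < μ) :
    Set.SurjOn (spreadFun μ) (Set.Ioi 0) (Set.Ioi 0) := by
  intro y hy
  rw [Set.mem_Ioi] at hy
  obtain ⟨b, hyb, hb⟩ := (((tendsto_spreadFun hμ).eventually_ge_atTop y).and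
    (eventually_ge_atTop 0)).exists
  obtain ⟨x, hx, he⟩ := intermediate_value_Icc hb
    ((continuousOn_spreadFun μ).mono Set.Icc_subset_Ici_self)
    (show y ∈ Set.Icc (spreadFun μ 0) (spreadFun μ b) from ⟨(spreadFun_zero μ).trans_le hy.le, hyb⟩)
  refine ⟨x, lt_of_le_of_ne hx.1 ?_, he⟩
  rintro rfl
  rw [spreadFun_zero] at he
  exact hy.ne he

theorem spreadInv_pos (hμ : 0 < μ) {y : ℝ} (hy : 0 < y) : 0 < spreadInv μ y :=
  Function.invFunOn_mem (surjOn_spreadFun hμ hy)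

theorem spreadFun_spreadInv (hμ : 0 < μ) {y : ℝ} (hy : 0 < y) :
    spreadFun μ (spreadInv μ y) = y :=
  Function.invFunOn_eq (surjOn_spreadFun hμ hy)

theorem spreadInv_spreadFun (hμ : 0 < μ) {x : ℝ} (hx : 0 < x) :
    spreadInv μ (spreadFun μ x) = x :=
  (spreadFun_strictMonoOn hμ).injOn (spreadInv_pos hμ (spreadFun_pos hμ hx)).le hx.le
    (spreadFun_spreadInv hμ (spreadFun_pos hμ hx))

theorem spreadInv_le_spreadInv (hμ : 0 < μ) {x y : ℝ} (hx : 0 < x) (hxy : x ≤ y) :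
    spreadInv μ x ≤ spreadInv μ y := by
  have hy := hx.trans_le hxy
  rw [← (spreadFun_strictMonoOn hμ).le_iff_le (spreadInv_pos hμ hx).le (spreadInv_pos hμ hy).le,
    spreadFun_spreadInv hμ hx, spreadFun_spreadInv hμ hy]
  exact hxy

theorem tendsto_spreadInv (hμ : 0 < μ) : Tendsto (spreadInv μ) atTop atTop := by
  refine tendsto_atTop.2 fun b => ?_
  have hb : 0 < max b 1 := by positivity
  filter_upwards [eventually_ge_atTop (spreadFun μ (max b 1))] with y hy
  have h := spreadInv_le_spreadInv hμ (spreadFun_pos hμ hb) hy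
  rw [spreadInv_spreadFun hμ hb] at h
  exact (le_max_left _ _).trans h

theorem measurable_spreadInv (hμ : 0 < μ) : Measurable (spreadInv μ) := by
  have hmono : Monotone fun y => if 0 < y then spreadInv μ y else 0 := by
    intro x y hxy
    by_cases hx : 0 < x
    · simp only [hx, hx.trans_le hxy, if_true]
      exact spreadInv_le_spreadInv hμ hx hxy
    · simp only [hx, if_false]
      split_ifs with hy
      · exact (spreadInv_pos hμ hy).le
      · exact le_rfl
  -- Off `(0, ∞)` there is no preimage, and `Function.invFunOn` returns the same default everywhere.
  have e : spreadInv μ = fun y => if 0 < y then (if 0 < y then spreadInv μ y else 0)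
      else spreadInv μ 0 := by
    funext y
    by_cases hy : 0 < y
    · simp [hy]
    · have hne : ∀ z : ℝ, ¬ 0 < z → ¬ ∃ x ∈ Set.Ioi (0 : ℝ), spreadFun μ x = z := by
        rintro z hz ⟨x, hx, rfl⟩
        exact hz (spreadFun_pos hμ hx)
      rw [if_neg hy, spreadInv, Function.invFunOn_neg (hne y hy),
        Function.invFunOn_neg (hne 0 (lt_irrefl 0))]
  rw [e]
  exact Measurable.ite measurableSet_Ioi hmono.measurable measurable_const

/-- Transfers the hypothesis `h_{m+1} = O(h)` to `h_m = O(h ∘ f⁻¹)`, as the recursion for the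
interior samplers requires. -/
theorem isBigO_critFun_comp_spreadFun (hμ : 0 < μ) {m : ℕ} (hm : 1 ≤ m) :
    (fun x => critFun m (spreadFun μ x)) =O[atTop] critFun (m + 1) := by
  have hμ' : 0 < Real.sqrt μ := Real.sqrt_pos.2 hμ
  set c := 1 + 6 / Real.sqrt μ with hc
  have hc1 : 1 ≤ c := by
    have : 0 < 6 / Real.sqrt μ := by positivity
    linarith
  refine IsBigO.of_bound (c * 2) ?_
  filter_upwards [eventually_ge_atTop 3, (tendsto_spreadFun hμ).eventually_ge_atTop 1]
    with x hx hfx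
  rw [Real.norm_of_nonneg (critFun_nonneg _ hfx),
    Real.norm_of_nonneg (critFun_nonneg _ (by linarith))]
  have hle : spreadFun μ x ≤ c * Real.sqrt ((x + 3) * Real.log (x + 3)) := by
    have : 0 ≤ Real.log (x + 1) := Real.log_nonneg (by linarith)
    unfold spreadFun
    gcongr <;> linarith
  calc critFun m (spreadFun μ x) ≤ critFun m (c * Real.sqrt ((x + 3) * Real.log (x + 3))) :=
        critFun_mono hm hfx hle
    _ ≤ c * critFun (m + 1) (x + 3) := critFun_sqrt_mul_log_le hm hc1 (by linarith)
    _ ≤ c * (2 * critFun (m + 1) x) := by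
        gcongr
        exact critFun_add_three_le (Nat.le_add_left 1 m) hx
    _ = _ := by ring

end Spread

/-! ### The values of the samplers -/

section Values

variable {μ : ℝ}

theorem geomBound_le {y ζ : ℝ} (hμ : 0 < μ) (hy : 0 < y) (hζ : ζ ^ 2 ≤ 1 + y) :
    geomBound μ ζ y ≤ ENNReal.ofReal ((4 / Real.sqrt μ + 12 / μ) * (1 + y)) := by
  have hm : 0 < Real.sqrt μ := Real.sqrt_pos.2 hμ
  have hs := Real.sq_sqrt hy.le
  have hs0 := Real.sqrt_nonneg y
  rw [← sq_abs] at hζ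
  have hθ := abs_nonneg ζ
  refine ENNReal.ofReal_le_ofReal ?_
  generalize |ζ| = θ at hζ hθ
  generalize Real.sqrt y = s at hs hs0
  have h1 : (1 + θ) * s ≤ 2 * (1 + y) := by nlinarith [sq_nonneg (θ - s), sq_nonneg (s - 1)]
  have h2 : (1 + θ) ^ 2 ≤ 4 * (1 + y) := by nlinarith [sq_nonneg (θ - 1)]
  calc 2 * (1 + θ) / Real.sqrt μ * s + 3 * (1 + θ) ^ 2 / μ
      = 2 / Real.sqrt μ * ((1 + θ) * s) + 3 / μ * (1 + θ) ^ 2 := by ring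
    _ ≤ 2 / Real.sqrt μ * (2 * (1 + y)) + 3 / μ * (4 * (1 + y)) := by gcongr
    _ = _ := by ring

theorem sqrt_le_one_add {y : ℝ} (hy : 0 ≤ y) : Real.sqrt y ≤ 1 + y := by
  nlinarith [Real.sq_sqrt hy, Real.sqrt_nonneg y, sq_nonneg (Real.sqrt y - 1)]

/-- The value of the policy of `δ°_{m,h}`. -/
def interiorValue (μ : ℝ) (m : ℕ) (h : ℝ → ℝ) : ℝ → ℝ≥0∞ :=
  listValue μ (fun y => geomBound μ (interiorGeom μ m h y) y) (interiorStages μ m h)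

theorem interiorValue_one (μ : ℝ) (h : ℝ → ℝ) {y : ℝ} (hy : 0 < y) :
    interiorValue μ 1 h y
      = geomBound μ (-min (Real.sqrt (h y) / y ^ (1 / 4 : ℝ)) (y ^ (1 / 7 : ℝ))) y := by
  simp [interiorValue, interiorStages, interiorGeom, listValue, hy]

theorem interiorValue_succ (μ : ℝ) {m : ℕ} (hm : 1 ≤ m) (h : ℝ → ℝ) (y : ℝ) :
    interiorValue μ (m + 1) h y = stageValue μ (interiorValue μ m (h ∘ spreadInv μ))
      (Real.sqrt (Real.log (y / h y ^ 2 + 1))) y := by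
  obtain ⟨k, rfl⟩ : ∃ k, m = k + 1 := ⟨m - 1, by omega⟩
  rfl

/-- The constant is uniform in `h`: `ζ √t ≤ y` however large `ζ` is, and the geometric parameter is
capped by `y^{1/7}`. The bound serves at remaining distances that are atypically large, or too small
for the asymptotic estimate. -/
theorem interiorValue_le_affine (hμ : 0 < μ) {m : ℕ} (hm : 1 ≤ m) :
    ∃ C : ℝ, 0 ≤ C ∧ ∀ h : ℝ → ℝ, ∀ y, 0 < y →
      interiorValue μ m h y ≤ ENNReal.ofReal (C * (1 + y)) := by
  have hm' : 0 < Real.sqrt μ := Real.sqrt_pos.2 hμ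
  induction m, hm using Nat.le_induction with
  | base =>
    refine ⟨4 / Real.sqrt μ + 12 / μ, by positivity, fun h y hy => ?_⟩
    rw [interiorValue_one μ h hy]
    refine geomBound_le hμ hy ?_
    rw [neg_sq]
    have h0 : 0 ≤ min (Real.sqrt (h y) / y ^ (1 / 4 : ℝ)) (y ^ (1 / 7 : ℝ)) := by positivity
    calc _ ≤ (y ^ (1 / 7 : ℝ)) ^ 2 := by gcongr; exact min_le_right _ _
      _ = y ^ (2 / 7 : ℝ) := by rw [← Real.rpow_mul_natCast hy.le]; norm_num
      _ ≤ 1 + y := by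
        rcases le_total y 1 with h1 | h1
        · exact (Real.rpow_le_one hy.le h1 (by norm_num)).trans (by linarith)
        · calc y ^ (2 / 7 : ℝ) ≤ y ^ (1 : ℝ) :=
                Real.rpow_le_rpow_of_exponent_le h1 (by norm_num)
            _ ≤ 1 + y := by rw [Real.rpow_one]; linarith
  | succ m hm ih =>
    obtain ⟨C, hC, hle⟩ := ih
    refine ⟨C + (C + 1) * (1 + 1 / Real.sqrt μ), by positivity, fun h y hy => ?_⟩
    rw [interiorValue_succ μ hm]
    generalize hζ : Real.sqrt (Real.log (y / h y ^ 2 + 1)) = ζ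
    have hζ0 : 0 ≤ ζ := hζ ▸ Real.sqrt_nonneg _
    refine (stageValue_le_of_affine (A := C) (B := C) hμ hy hC hC fun u hu =>
      (hle _ u hu).trans_eq (by ring_nf)).trans (ENNReal.ofReal_le_ofReal ?_)
    have h1 := sqrt_stageSize_mul_le (ζ := ζ) hμ hy
    have h2 : Real.sqrt (stageSize μ y ζ) ≤ (1 + y) / Real.sqrt μ :=
      (sqrt_stageSize_le_of_nonneg hμ hy hζ0).trans (by gcongr; exact sqrt_le_one_add hy.le)
    rw [abs_of_nonneg hζ0]
    calc C + (C + 1) * (Real.sqrt (stageSize μ y ζ) * (ζ + 1))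
        ≤ C * (1 + y) + (C + 1) * (y + (1 + y) / Real.sqrt μ) := by
          refine add_le_add (by nlinarith) (mul_le_mul_of_nonneg_left ?_ (by linarith))
          linarith
      _ ≤ C * (1 + y) + (C + 1) * ((1 + y) + (1 + y) / Real.sqrt μ) := by gcongr; linarith
      _ = _ := by ring

theorem eventually_one_le_of_isBigO {m : ℕ} (hm : 1 ≤ m) {h : ℝ → ℝ}
    (hpos : ∀ x, 0 < x → 0 < h x) (hc : critFun m =O[atTop] h) : ∀ᶠ a in atTop, 1 ≤ h a := by
  obtain ⟨c, hc0, hb⟩ := hc.exists_pos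
  filter_upwards [hb.bound, (tendsto_critFun hm).eventually_ge_atTop c, eventually_gt_atTop 0]
    with a h1 h2 h3
  rw [Real.norm_of_nonneg (hc0.le.trans h2), Real.norm_of_nonneg (hpos a h3).le] at h1
  have : c * 1 ≤ c * h a := by linarith
  exact le_of_mul_le_mul_left this hc0

/-- Each cap on the parameter `θ` has its use: `θ ≤ √h / a^{1/4}` gives `θ √a ≤ √h a^{1/4} = O(h)`,
because `√a = O(h)`, and `θ ≤ a^{1/7}` gives `θ² ≤ √a`. -/
theorem eventually_interiorValue_one_le (hμ : 0 < μ) {h : ℝ → ℝ}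
    (hpos : ∀ x, 0 < x → 0 < h x) (hc : critFun 1 =O[atTop] h) :
    ∃ C : ℝ, 0 ≤ C ∧ ∀ᶠ a in atTop, interiorValue μ 1 h a ≤ ENNReal.ofReal (C * h a) := by
  have hm' : 0 < Real.sqrt μ := Real.sqrt_pos.2 hμ
  obtain ⟨c, hc0, hb⟩ := hc.exists_pos
  refine ⟨2 / Real.sqrt μ * (1 + 2 * c) + 12 * c / μ, by positivity, ?_⟩
  filter_upwards [hb.bound, eventually_ge_atTop 1] with a h1 ha
  have ha0 : 0 < a := by linarith
  have hh := hpos a ha0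
  rw [Real.norm_of_nonneg (critFun_nonneg _ ha), Real.norm_of_nonneg hh.le,
    critFun_of_pos le_rfl] at h1
  norm_num at h1
  rw [interiorValue_one μ h ha0, geomBound, abs_neg]
  set θ := min (Real.sqrt (h a) / a ^ (1 / 4 : ℝ)) (a ^ (1 / 7 : ℝ)) with hθ
  have hθ0 : 0 ≤ θ := by positivity
  rw [abs_of_nonneg hθ0]
  refine ENNReal.ofReal_le_ofReal ?_
  rw [Real.sqrt_eq_rpow a]
  set q := a ^ (1 / 4 : ℝ) with hq
  have hq0 : 0 < q := by positivity
  have hqq : a ^ (1 / 2 : ℝ) = q * q := by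
    rw [hq, ← Real.rpow_add ha0]
    norm_num
  have hq1 : 1 ≤ q * q := hqq ▸ Real.one_le_rpow ha (by norm_num)
  have h2 : θ ^ 2 ≤ q * q := by
    calc θ ^ 2 ≤ (a ^ (1 / 7 : ℝ)) ^ 2 := by gcongr; exact min_le_right _ _
      _ = a ^ (2 / 7 : ℝ) := by rw [← Real.rpow_mul_natCast ha0.le]; norm_num
      _ ≤ a ^ (1 / 2 : ℝ) := Real.rpow_le_rpow_of_exponent_le ha (by norm_num)
      _ = q * q := hqq
  have h3 : θ * q ≤ Real.sqrt (h a) := (le_div_iff₀ hq0).1 (min_le_left _ _)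
  have h4 : θ * (q * q) ≤ (1 + c) * h a := by
    have h5 := Real.sq_sqrt hh.le
    have h6 : θ * q * q ≤ Real.sqrt (h a) * q := by gcongr
    nlinarith [sq_nonneg (Real.sqrt (h a) - q), hqq ▸ h1, mul_pos hc0 hh]
  rw [hqq] at h1 ⊢
  calc 2 * (1 + θ) / Real.sqrt μ * (q * q) + 3 * (1 + θ) ^ 2 / μ
      = 2 / Real.sqrt μ * (q * q + θ * (q * q)) + 3 / μ * (1 + θ) ^ 2 := by ring
    _ ≤ 2 / Real.sqrt μ * (c * h a + (1 + c) * h a) + 3 / μ * (4 * (c * h a)) := by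
        gcongr
        nlinarith [sq_nonneg (θ - 1)]
    _ = _ := by ring

/-- The reason for the stage parameter `√(log (a / h² + 1))`: it brings the overshoot of a stage
with standard deviation of order `√a` down to order `h`. -/
theorem sqrt_mul_exp_neg_log_le {a y : ℝ} (ha : 0 < a) (hy : 0 < y) :
    Real.sqrt a * Real.exp (-(Real.log (a / y ^ 2 + 1)) / 2) ≤ y := by
  have hq : 0 < a / y ^ 2 + 1 := by positivity
  rw [Real.exp_half, Real.exp_neg, Real.exp_log hq, ← Real.sqrt_mul ha.le]
  refine Real.sqrt_le_iff.2 ⟨hy.le, ?_⟩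
  rw [← div_eq_mul_inv, div_le_iff₀ hq]
  have : y ^ 2 * (a / y ^ 2 + 1) = a + y ^ 2 := by field_simp
  nlinarith

/-- The reason for the cutoff `K = 5 √(log (a + 1))`: `K² / 4` exceeds `2 log (a + 1)`, which beats
a quadratic factor. -/
theorem add_one_mul_exp_neg_log_le {a : ℝ} (ha : 0 < a) :
    (a + 1) * (a + 1) * Real.exp (-((5 * Real.sqrt (Real.log (a + 1))) ^ 2) / 4) ≤ 1 := by
  have hl : 0 ≤ Real.log (a + 1) := Real.log_nonneg (by linarith)
  have h1 : Real.exp (-((5 * Real.sqrt (Real.log (a + 1))) ^ 2) / 4)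
      ≤ Real.exp (-(Real.log (a + 1) + Real.log (a + 1))) := by
    rw [mul_pow, Real.sq_sqrt hl]
    exact Real.exp_le_exp.2 (by linarith)
  rw [Real.exp_neg, Real.exp_add, Real.exp_log (by linarith)] at h1
  calc _ ≤ (a + 1) * (a + 1) * ((a + 1) * (a + 1))⁻¹ := by gcongr
    _ = 1 := mul_inv_cancel₀ (by positivity)

/-- The value of `δ°_{m,h}(a)` is of the order of `h a`. -/
theorem eventually_interiorValue_le (hμ : 0 < μ) {m : ℕ} (hm : 1 ≤ m) {h : ℝ → ℝ}
    (hpos : ∀ x, 0 < x → 0 < h x) (hc : critFun m =O[atTop] h)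
    (hreg : ∃ C x₀ : ℝ, ∀ x y, x₀ ≤ x → x ≤ y → h x ≤ C * h y) :
    ∃ C : ℝ, 0 ≤ C ∧ ∀ᶠ a in atTop, interiorValue μ m h a ≤ ENNReal.ofReal (C * h a) := by
  have hm' : 0 < Real.sqrt μ := Real.sqrt_pos.2 hμ
  induction m, hm using Nat.le_induction generalizing h with
  | base => exact eventually_interiorValue_one_le hμ hpos hc
  | succ m hm ih =>
    have hc' : critFun m =O[atTop] (h ∘ spreadInv μ) := by
      refine (((isBigO_critFun_comp_spreadFun hμ hm).trans hc).comp_tendsto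
        (tendsto_spreadInv hμ)).congr' ?_ EventuallyEq.rfl
      filter_upwards [eventually_gt_atTop 0] with y hy
      simp [spreadFun_spreadInv hμ hy]
    obtain ⟨D, x₀, hD⟩ := hreg
    obtain ⟨x₁, hx₁⟩ := eventually_atTop.1 ((tendsto_spreadInv hμ).eventually_ge_atTop x₀)
    have hD' : ∀ x y, max x₁ 1 ≤ x → x ≤ y →
        (h ∘ spreadInv μ) x ≤ D * (h ∘ spreadInv μ) y := fun x y hx hxy =>
      hD _ _ (hx₁ x ((le_max_left _ _).trans hx))
        (spreadInv_le_spreadInv hμ (one_pos.trans_le ((le_max_right _ _).trans hx)) hxy)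
    obtain ⟨C, hC, hev⟩ := ih (fun x hx => hpos _ (spreadInv_pos hμ hx)) hc' ⟨D, _, hD'⟩
    obtain ⟨y₀, hy₀⟩ := eventually_atTop.1 hev
    obtain ⟨B, hB, hcrude⟩ := interiorValue_le_affine hμ hm
    set Y := max y₀ (max x₁ 1) with hY
    have hY0 : 0 < Y := one_pos.trans_le ((le_max_right _ _).trans (le_max_right _ _))
    set R := 1 / Real.sqrt μ with hR
    have hR0 : 0 < R := by positivity
    refine ⟨2 * R + (C * |D| + B * (1 + Y)) + 16 * B * (1 + R), by positivity, ?_⟩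
    filter_upwards [eventually_one_le_of_isBigO (Nat.le_add_left 1 m) hpos hc,
      eventually_gt_atTop 0] with a h1 ha
    have hh := hpos a ha
    have hl : 0 ≤ Real.log (a + 1) := Real.log_nonneg (by linarith)
    have hla : Real.log (a + 1) ≤ a := by
      have := Real.log_le_sub_one_of_pos (show 0 < a + 1 by linarith)
      linarith
    have hq : 1 ≤ a / h a ^ 2 + 1 := by
      have : 0 ≤ a / h a ^ 2 := by positivity
      linarith
    rw [interiorValue_succ μ hm]
    set ζ := Real.sqrt (Real.log (a / h a ^ 2 + 1)) with hζ
    have hζ0 : 0 ≤ ζ := Real.sqrt_nonneg _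
    have hζl : ζ ≤ Real.sqrt (Real.log (a + 1)) := by
      refine Real.sqrt_le_sqrt (Real.log_le_log (by linarith) ?_)
      have : a / h a ^ 2 ≤ a := div_le_self ha.le (one_le_pow₀ h1)
      linarith
    have hsl := sqrt_le_one_add hl
    -- The cutoff `5 √(log (a + 1))` and `ζ ≤ √(log (a + 1))` add up to the `6` of the spread
    -- function `f`. So outside the tail the remaining distance is at most `f a`, where `h ∘ f⁻¹`
    -- equals `h a`, and near-monotonicity covers smaller distances.
    refine (stageValue_le_of_split (A := (C * |D| + B * (1 + Y)) * h a) (B := B)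
      (K := 5 * Real.sqrt (Real.log (a + 1))) (L := spreadFun μ a) hμ ha hζ0 (by positivity) hB
      (by positivity) ?_ ?_ (hcrude _)).trans (ENNReal.ofReal_le_ofReal ?_)
    · rw [spreadFun, Real.sqrt_mul ha.le]
      calc Real.sqrt a / Real.sqrt μ * (5 * Real.sqrt (Real.log (a + 1)) + ζ)
          ≤ Real.sqrt a / Real.sqrt μ * (6 * Real.sqrt (Real.log (a + 1))) := by
            gcongr
            linarith
        _ = _ := by ring
    · intro u hu hua
      -- Below the threshold `Y` of the asymptotic bound the value is at most a constant, absorbed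
      -- by `h a ≥ 1`.
      rcases le_total Y u with hYu | hYu
      · refine (hy₀ u ((le_max_left _ _).trans hYu)).trans (ENNReal.ofReal_le_ofReal ?_)
        have h2 := hD' u _ ((le_max_right _ _).trans hYu) hua
        rw [Function.comp_apply (x := spreadFun μ a), spreadInv_spreadFun hμ ha] at h2
        calc C * (h ∘ spreadInv μ) u ≤ C * (|D| * h a) := by
              gcongr
              exact h2.trans (by gcongr; exact le_abs_self D)
          _ ≤ C * (|D| * h a) + B * (1 + Y) * h a := le_add_of_nonneg_right (by positivity)
          _ = _ := by ring
      · refine (hcrude _ u hu).trans (ENNReal.ofReal_le_ofReal ?_)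
        calc B * (1 + u) ≤ B * (1 + Y) * 1 := by rw [mul_one]; gcongr
          _ ≤ B * (1 + Y) * h a := by gcongr
          _ ≤ C * |D| * h a + B * (1 + Y) * h a := le_add_of_nonneg_left (by positivity)
          _ = _ := by ring
    · have e1 : 2 * (Real.sqrt a / Real.sqrt μ) * Real.exp (-(ζ ^ 2) / 2) ≤ 2 * R * h a := by
        rw [hζ, Real.sq_sqrt (Real.log_nonneg hq)]
        have h2 := mul_le_mul_of_nonneg_left (sqrt_mul_exp_neg_log_le ha hh)
          (show 0 ≤ 2 * R by positivity)
        refine le_trans (le_of_eq ?_) h2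
        rw [hR]
        ring
      have e2 : (1 + Real.sqrt a / Real.sqrt μ) * (1 + ζ) *
          (8 * Real.exp (-((5 * Real.sqrt (Real.log (a + 1))) ^ 2) / 4)) ≤ 16 * (1 + R) := by
        have h2 : 1 + Real.sqrt a / Real.sqrt μ ≤ (1 + R) * (a + 1) := by
          have h3 : Real.sqrt a / Real.sqrt μ ≤ R * (1 + a) := by
            rw [hR, one_div_mul_eq_div]
            gcongr
            exact sqrt_le_one_add ha.le
          nlinarith
        have h3 : 1 + ζ ≤ 2 * (a + 1) := by linarith
        calc _ ≤ ((1 + R) * (a + 1)) * (2 * (a + 1)) *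
              (8 * Real.exp (-((5 * Real.sqrt (Real.log (a + 1))) ^ 2) / 4)) := by gcongr
          _ = 16 * (1 + R) * ((a + 1) * (a + 1) *
              Real.exp (-((5 * Real.sqrt (Real.log (a + 1))) ^ 2) / 4)) := by ring
          _ ≤ 16 * (1 + R) * 1 := by
              gcongr
              exact add_one_mul_exp_neg_log_le ha
          _ = _ := mul_one _
      calc _ ≤ 2 * R * h a + ((C * |D| + B * (1 + Y)) * h a + B * (16 * (1 + R))) := by gcongr
        _ ≤ 2 * R * h a + ((C * |D| + B * (1 + Y)) * h a + B * (16 * (1 + R)) * h a) := by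
            refine add_le_add le_rfl (add_le_add le_rfl ?_)
            exact le_mul_of_one_le_right (by positivity) h1
        _ = _ := by ring

/-- The value of the policy of `δ⁺_{m,z}`. -/
def boundaryValue (μ z : ℝ) (m : ℕ) : ℝ → ℝ≥0∞ :=
  listValue μ (fun y => geomBound μ (boundaryGeom y) y) (boundaryStages z m)

theorem boundaryValue_one (μ z y : ℝ) :
    boundaryValue μ z 1 y
      = stageValue μ (fun y => geomBound μ (boundaryGeom y) y) z y := rfl

theorem boundaryValue_succ (μ z : ℝ) {m : ℕ} (hm : 1 ≤ m) (y : ℝ) :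
    boundaryValue μ z (m + 1) y = stageValue μ (boundaryValue μ z m)
      (Real.sqrt ((1 - (1 / 2 : ℝ) ^ m) * Real.log (y + 1))) y := by
  obtain ⟨k, rfl⟩ : ∃ k, m = k + 1 := ⟨m - 1, by omega⟩
  rfl

/-- The stage parameter is tuned so that the overshoot carries the exponent `1/2 - (1 - 2^{-m}) / 2
= 2^{-(m+1)}`, the power of `y` in `h_{m+1}`. -/
theorem sqrt_mul_exp_neg_le_critFun {m : ℕ} {y : ℝ} (hy : 0 < y) :
    Real.sqrt y * Real.exp (-((1 - (1 / 2 : ℝ) ^ m) * Real.log (y + 1)) / 2)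
      ≤ critFun (m + 1) (y + 3) := by
  refine le_trans ?_ (rpow_half_le_critFun (Nat.le_add_left 1 m) (by linarith))
  calc Real.sqrt y * Real.exp (-((1 - (1 / 2 : ℝ) ^ m) * Real.log (y + 1)) / 2)
      ≤ Real.sqrt (y + 1) * Real.exp (-((1 - (1 / 2 : ℝ) ^ m) * Real.log (y + 1)) / 2) := by
        gcongr
        linarith
    _ = (y + 1) ^ ((1 / 2 : ℝ) ^ (m + 1)) := by
        rw [Real.sqrt_eq_rpow, Real.rpow_def_of_pos (by linarith),
          Real.rpow_def_of_pos (by linarith), ← Real.exp_add]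
        congr 1
        rw [pow_succ]
        ring
    _ ≤ (y + 3) ^ ((1 / 2 : ℝ) ^ (m + 1)) := by gcongr; linarith

/-- The value of `δ⁺_{m,z}(y)` is of the order of the critical function. -/
theorem boundaryValue_le (hμ : 0 < μ) (z : ℝ) {m : ℕ} (hm : 1 ≤ m) :
    ∃ C : ℝ, 0 ≤ C ∧ ∀ y, 0 < y →
      boundaryValue μ z m y ≤ ENNReal.ofReal (C * critFun m (y + 3)) := by
  have hm' : 0 < Real.sqrt μ := Real.sqrt_pos.2 hμ
  induction m, hm using Nat.le_induction with
  | base =>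
    set B := 4 / Real.sqrt μ + 12 / μ with hB
    have hB0 : 0 ≤ B := by positivity
    refine ⟨B + (B + 1) * ((1 / Real.sqrt μ + |z| / μ) * (|z| + 1)), by positivity,
      fun y hy => ?_⟩
    rw [boundaryValue_one]
    refine (stageValue_le_of_affine (A := B) (B := B) hμ hy hB0 hB0 fun u hu =>
      (geomBound_le hμ hu ?_).trans_eq (by rw [← hB]; ring_nf)).trans (ENNReal.ofReal_le_ofReal ?_)
    · rw [boundaryGeom, neg_sq, Real.sq_sqrt (Real.log_nonneg (by linarith))]
      have := Real.log_le_sub_one_of_pos (show 0 < u + 1 by linarith)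
      linarith
    · have hw : critFun 1 (y + 3) = Real.sqrt (y + 3) := by
        rw [critFun_of_pos le_rfl, Real.sqrt_eq_rpow]
        norm_num
      have hw1 : 1 ≤ Real.sqrt (y + 3) := by
        rw [← hw]
        exact one_le_critFun le_rfl (by linarith)
      have hr : Real.sqrt (stageSize μ y z) ≤ (1 / Real.sqrt μ + |z| / μ) * Real.sqrt (y + 3) := by
        refine (sqrt_stageSize_le hμ hy z).trans ?_
        have h1 : Real.sqrt y / Real.sqrt μ ≤ 1 / Real.sqrt μ * Real.sqrt (y + 3) := by
          rw [one_div_mul_eq_div]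
          gcongr
          linarith
        have h2 : (|z| - z) / (2 * μ) ≤ |z| / μ * 1 := by
          rw [mul_one, ← mul_div_mul_left |z| μ two_ne_zero]
          gcongr
          linarith [neg_abs_le z]
        have h3 : |z| / μ * 1 ≤ |z| / μ * Real.sqrt (y + 3) := by gcongr
        linarith
      rw [hw]
      calc B + (B + 1) * (Real.sqrt (stageSize μ y z) * (|z| + 1))
          ≤ B * Real.sqrt (y + 3)
            + (B + 1) * ((1 / Real.sqrt μ + |z| / μ) * Real.sqrt (y + 3) * (|z| + 1)) := by
            gcongr
            exact le_mul_of_one_le_right hB0 hw1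
        _ = _ := by ring
  | succ m hm ih =>
    obtain ⟨C, hC, hle⟩ := ih
    set R := 1 / Real.sqrt μ with hR
    have hR0 : 0 < R := by positivity
    refine ⟨2 * R + 3 * C * (1 + R), by positivity, fun y hy => ?_⟩
    -- The shift by `3` keeps the logarithm at least one, so the bound holds at every positive
    -- distance, as the induction requires.
    have hw : 3 ≤ y + 3 := by linarith
    have hlw := one_le_log hw
    have hl : 0 ≤ Real.log (y + 1) := Real.log_nonneg (by linarith)
    have hlle : Real.log (y + 1) ≤ Real.log (y + 3) :=
      Real.log_le_log (by linarith) (by linarith)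
    have hα : 0 ≤ 1 - (1 / 2 : ℝ) ^ m := by linarith [half_pow_le_one m]
    rw [boundaryValue_succ μ z hm]
    set ζ := Real.sqrt ((1 - (1 / 2 : ℝ) ^ m) * Real.log (y + 1)) with hζ
    have hζ0 : 0 ≤ ζ := Real.sqrt_nonneg _
    have hζl : ζ ≤ Real.sqrt (Real.log (y + 3)) := by
      refine Real.sqrt_le_sqrt (le_trans ?_ hlle)
      exact mul_le_of_le_one_left hl (by linarith [half_pow_pos m])
    have hl1 : 1 ≤ Real.sqrt (Real.log (y + 3)) := Real.one_le_sqrt.2 hlw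
    -- The order of the distance left after the stage. Scaling bounds the continuation at distance
    -- `u` by `1 + u / s` times a multiple of `h_m s`, an affine majorant, so no tail has to be
    -- split off.
    set s := 3 * Real.sqrt ((y + 3) * Real.log (y + 3)) with hs
    have hs3 : 3 ≤ s := by linarith [one_le_sqrt_mul_log hw]
    have hs0 : 0 < s := by linarith
    have hcs : critFun m s ≤ 3 * critFun (m + 1) (y + 3) :=
      critFun_sqrt_mul_log_le hm (by norm_num) hw
    have hc0 := critFun_nonneg m (show 1 ≤ s by linarith)
    refine (stageValue_le_of_nonneg (A := C * critFun m s) (B := C * critFun m s / s) hμ hy hζ0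
      (by positivity) (by positivity) fun u hu => (hle u hu).trans
      (ENNReal.ofReal_le_ofReal ?_)).trans (ENNReal.ofReal_le_ofReal ?_)
    · have h1 : 1 ≤ 1 + u / s := by
        have : 0 < u / s := by positivity
        linarith
      have h2 : u + 3 ≤ (1 + u / s) * s := by
        have : (1 + u / s) * s = s + u := by field_simp
        linarith
      calc C * critFun m (u + 3) ≤ C * ((1 + u / s) * critFun m s) := by
            gcongr
            exact (critFun_mono hm (by linarith) h2).trans (critFun_mul_le hm h1 hs3)
        _ = _ := by ring
    · have e1 : 2 * (Real.sqrt y / Real.sqrt μ) * Real.exp (-(ζ ^ 2) / 2)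
          ≤ 2 * R * critFun (m + 1) (y + 3) := by
        rw [hζ, Real.sq_sqrt (by positivity)]
        have h2 := mul_le_mul_of_nonneg_left (sqrt_mul_exp_neg_le_critFun (m := m) hy)
          (show 0 ≤ 2 * R by positivity)
        refine le_trans (le_of_eq ?_) h2
        rw [hR]
        ring
      have e2 : Real.sqrt y / Real.sqrt μ * (ζ + 1) ≤ R * s := by
        have h1 : Real.sqrt y ≤ Real.sqrt (y + 3) := Real.sqrt_le_sqrt (by linarith)
        have h2 : ζ + 1 ≤ 3 * Real.sqrt (Real.log (y + 3)) := by linarith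
        rw [hs, Real.sqrt_mul (by linarith), hR]
        calc _ ≤ Real.sqrt (y + 3) / Real.sqrt μ * (3 * Real.sqrt (Real.log (y + 3))) := by gcongr
          _ = _ := by ring
      calc _ ≤ 2 * R * critFun (m + 1) (y + 3)
            + (C * critFun m s + C * critFun m s / s * (R * s)) := by gcongr
        _ = 2 * R * critFun (m + 1) (y + 3) + C * (1 + R) * critFun m s := by
            field_simp
        _ ≤ 2 * R * critFun (m + 1) (y + 3) + C * (1 + R) * (3 * critFun (m + 1) (y + 3)) := by
            gcongr
        _ = _ := by ring

end Values

/-! ### The risk of the samplers -/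

section OptimalRisk

variable {μ : ℝ}

/-- The value `0` chosen off `(0, ∞)` makes the sign unconditional; real powers of negative numbers
give no control of it. -/
theorem interiorGeom_nonpos (μ : ℝ) (m : ℕ) (h : ℝ → ℝ) (y : ℝ) : interiorGeom μ m h y ≤ 0 := by
  have key : ∀ h : ℝ → ℝ, (if 0 < y then
      -min (Real.sqrt (h y) / y ^ (1 / 4 : ℝ)) (y ^ (1 / 7 : ℝ)) else 0) ≤ 0 := by
    intro h
    split_ifs with hy
    · have : 0 ≤ min (Real.sqrt (h y) / y ^ (1 / 4 : ℝ)) (y ^ (1 / 7 : ℝ)) := by positivity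
      linarith
    · exact le_rfl
  induction m generalizing h with
  | zero => exact key h
  | succ m ih =>
    cases m with
    | zero => exact key h
    | succ m => exact ih _

theorem measurable_interiorGeom (hμ : 0 < μ) (m : ℕ) {h : ℝ → ℝ} (hh : Measurable h) :
    Measurable (interiorGeom μ m h) := by
  have key : ∀ h : ℝ → ℝ, Measurable h → Measurable fun y : ℝ => if 0 < y then
      -min (Real.sqrt (h y) / y ^ (1 / 4 : ℝ)) (y ^ (1 / 7 : ℝ)) else 0 := by
    intro h hh
    exact Measurable.ite measurableSet_Ioi (by fun_prop) measurable_const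
  induction m generalizing h with
  | zero => exact key h hh
  | succ m ih =>
    cases m with
    | zero => exact key h hh
    | succ m => exact ih (hh.comp (measurable_spreadInv hμ))

theorem measurable_of_mem_interiorStages (hμ : 0 < μ) {m : ℕ} {h : ℝ → ℝ} (hh : Measurable h) :
    ∀ z ∈ interiorStages μ m h, Measurable z := by
  induction m generalizing h with
  | zero => simp [interiorStages]
  | succ m ih =>
    cases m with
    | zero => simp [interiorStages]
    | succ m =>
      intro z hz
      rcases List.mem_cons.1 hz with rfl | hz
      · fun_prop
      · exact ih (hh.comp (measurable_spreadInv hμ)) z hz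

theorem measurable_of_mem_boundaryStages {z : ℝ} {m : ℕ} :
    ∀ w ∈ boundaryStages z m, Measurable w := by
  induction m with
  | zero => simp [boundaryStages]
  | succ m ih =>
    cases m with
    | zero => simp [boundaryStages]
    | succ m =>
      intro w hw
      rcases List.mem_cons.1 hw with rfl | hw
      · fun_prop
      · exact ih w hw

theorem measurable_boundaryGeom : Measurable boundaryGeom := by
  unfold boundaryGeom
  fun_prop

theorem boundaryGeom_nonpos (y : ℝ) : boundaryGeom y ≤ 0 := neg_nonpos.2 (Real.sqrt_nonneg _)

theorem OnBandBoundary.isTheta {m : ℕ} {h : ℝ → ℝ} (hB : OnBandBoundary m h) :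
    critFun m =Θ[atTop] h := by
  obtain ⟨-, Q, hQ, hlim⟩ := hB
  exact isTheta_of_div_tendsto_nhds_ne_zero hlim hQ.ne'

variable {Ω : Type*} [MeasurableSpace Ω] {X : ℝ≥0 → Ω → ℝ} {P : Measure Ω}
  [IsProbabilityMeasure P] {m : ℕ} {h : ℝ → ℝ}

theorem eventually_risk_samplerInterior_le (hX : IsDriftBrownian P μ X) (hμ : 0 < μ) (hm : 1 ≤ m)
    (hpos : ∀ x, 0 < x → 0 < h x) (hc : critFun m =O[atTop] h) (hh : Measurable h)
    (hreg : ∃ C x₀ : ℝ, ∀ x y, x₀ ≤ x → x ≤ y → h x ≤ C * h y) :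
    ∃ C : ℝ, ∀ᶠ a in atTop, risk P μ X (h a) a
      (fun k ω => samplerInterior μ m h a (fun t => X t ω) k) ≤ ((C * h a : ℝ) : EReal) := by
  obtain ⟨C, hC, hv⟩ := eventually_interiorValue_le hμ hm hpos hc hreg
  refine ⟨C / μ + 2 ^ ((interiorStages μ m h).length + 1), ?_⟩
  filter_upwards [hv, eventually_gt_atTop 0] with a hv ha
  have hh0 := (hpos a ha).le
  have hf : RuleFollows μ X (interiorStages μ m h).length
      (listPolicy (interiorStages μ m h) (interiorGeom μ m h)) a
      (fun k ω => samplerInterior μ m h a (fun t => X t ω) k) := fun ω =>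
    followsPolicy_samplerInterior μ hm h ha (hX.zero ω)
  refine (hf.risk_le hX hμ ha (measurable_of_mem_interiorStages hμ hh)
    (measurable_interiorGeom hμ m hh) (interiorGeom_nonpos μ m h) hh0 (mul_nonneg hC hh0) hv).trans
    (EReal.coe_le_coe_iff.2 (le_of_eq ?_))
  ring

theorem eventually_risk_samplerBoundary_le (hX : IsDriftBrownian P μ X) (hμ : 0 < μ) (hm : 1 ≤ m)
    (hpos : ∀ x, 0 < x → 0 < h x) (hc : critFun m =O[atTop] h) (z : ℝ) :
    ∃ C : ℝ, ∀ᶠ a in atTop, risk P μ X (h a) a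
      (fun k ω => samplerBoundary μ z m a (fun t => X t ω) k) ≤ ((C * h a : ℝ) : EReal) := by
  obtain ⟨C, hC, hv⟩ := boundaryValue_le hμ z hm
  obtain ⟨c, hc0, hb⟩ := hc.exists_pos
  refine ⟨2 * C * c / μ + 2 ^ ((boundaryStages z m).length + 1), ?_⟩
  filter_upwards [hb.bound, eventually_ge_atTop 3] with a hb ha3
  have ha : 0 < a := by linarith
  have hh0 := (hpos a ha).le
  rw [Real.norm_of_nonneg (critFun_nonneg _ (by linarith)), Real.norm_of_nonneg hh0] at hb
  have hf : RuleFollows μ X (boundaryStages z m).length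
      (listPolicy (boundaryStages z m) boundaryGeom) a
      (fun k ω => samplerBoundary μ z m a (fun t => X t ω) k) := fun ω =>
    followsPolicy_samplerBoundary μ z hm ha (hX.zero ω)
  refine (hf.risk_le hX hμ ha measurable_of_mem_boundaryStages measurable_boundaryGeom
    boundaryGeom_nonpos hh0 (v := C * (2 * (c * h a))) (by positivity)
    ((hv a ha).trans (ENNReal.ofReal_le_ofReal ?_))).trans
    (EReal.coe_le_coe_iff.2 (le_of_eq ?_))
  · gcongr
    exact (critFun_add_three_le hm ha3).trans (by gcongr)
  · ring

theorem eventually_risk_optSampler_le (hX : IsDriftBrownian P μ X) (hμ : 0 < μ) (hm : 1 ≤ m)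
    (hB : InBand m h ∨ OnBandBoundary m h)
    (hreg : InBand m h → Measurable h ∧
      ∃ C x₀ : ℝ, ∀ x y, x₀ ≤ x → x ≤ y → h x ≤ C * h y) (z : ℝ) :
    ∃ C : ℝ, ∀ᶠ a in atTop, risk P μ X (h a) a (optSampler μ X m h z a)
      ≤ ((C * h a : ℝ) : EReal) := by
  unfold optSampler
  by_cases hI : InBand m h
  · simp only [hI, if_true]
    exact eventually_risk_samplerInterior_le hX hμ hm hI.1 hI.2.1.isBigO (hreg hI).1 (hreg hI).2
  · simp only [hI, if_false]
    have hB' := hB.resolve_left hI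
    exact eventually_risk_samplerBoundary_le hX hμ hm hB'.1 hB'.isTheta.1 z

end OptimalRisk

/-! ### Rules that stop too early -/

section Comparison

theorem le_stageCount_iff {Ω : Type*} {X : ℝ≥0 → Ω → ℝ} {T : ℕ → Ω → ℝ≥0} {a : ℝ} {n : ℕ} {ω : Ω} :
    ((n + 1 : ℕ) : ℕ∞) ≤ stageCount X T a ω ↔ StillBelow X T a n ω := by
  rw [← lt_stageCount_iff, ← ENat.add_one_le_iff (ENat.natCast_ne_top n)]
  rfl

variable {Ω : Type*} [MeasurableSpace Ω] {X : ℝ≥0 → Ω → ℝ} {P : Measure Ω}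
  {μ : ℝ} {m : ℕ} {h : ℝ → ℝ}

theorem risk_ne_bot (P : Measure Ω) (μ : ℝ) (X : ℝ≥0 → Ω → ℝ) (c a : ℝ) (T : ℕ → Ω → ℝ≥0) :
    risk P μ X c a T ≠ ⊥ := by
  rw [risk, sub_eq_add_neg, ← EReal.coe_neg]
  exact EReal.add_ne_bot_iff.2 ⟨EReal.coe_ennreal_ne_bot _, EReal.coe_ne_bot _⟩

/-- If the rules whose risk is `O(h)` make the events `E` likely, then a rule under which these
events are not likely has a much larger risk than a sampler whose risk is `O(h)`. -/
theorem tendsto_excessRatio [IsProbabilityMeasure P] {z : ℝ} {T : ℝ → ℕ → Ω → ℝ≥0}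
    (h1 : ∀ᶠ a in atTop, 1 ≤ h a)
    (hδ : ∃ C : ℝ, ∀ᶠ a in atTop, risk P μ X (h a) a (optSampler μ X m h z a)
      ≤ ((C * h a : ℝ) : EReal)) {E : ℝ → Set Ω}
    (hE : ∀ η : ℝ, 0 < η → ∀ C : ℝ, ∀ᶠ a in atTop,
      risk P μ X (h a) a (T a) ≤ ((C * h a : ℝ) : EReal) → P (E a)ᶜ ≤ ENNReal.ofReal η)
    {a : ℕ → ℝ} (ha : Tendsto a atTop atTop)
    (hp : ∃ p : ℝ, p < 1 ∧ ∀ᶠ i in atTop, P.real (E (a i)) ≤ p) :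
    Tendsto (fun i => excessRatio P μ X m h z T (a i)) atTop (𝓝 ⊤) := by
  obtain ⟨C, hC⟩ := hδ
  obtain ⟨p, hp1, hp⟩ := hp
  rw [EReal.tendsto_nhds_top_iff_real]
  intro K
  -- An excess ratio of at most `K` forces the risk bound `(C + K) h`; the choice `η = (1 - p) / 2 <
  -- 1 - p` then contradicts `P(E) ≤ p`.
  filter_upwards [hp, ha.eventually h1, ha.eventually hC,
    ha.eventually (hE ((1 - p) / 2) (by linarith) (C + K))] with i hp h1 hC hE
  by_contra! hle
  have hh : 0 < h (a i) := by linarith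
  have hr : risk P μ X (h (a i)) (a i) (optSampler μ X m h z (a i)) ≠ ⊤ :=
    ne_top_of_le_ne_top (EReal.coe_ne_top _) hC
  rw [excessRatio, EReal.div_le_iff_le_mul (EReal.coe_pos.2 hh) (EReal.coe_ne_top _),
    EReal.sub_le_iff_le_add (Or.inl (risk_ne_bot _ _ _ _ _ _)) (Or.inl hr)] at hle
  have hrisk : risk P μ X (h (a i)) (a i) (T (a i)) ≤ (((C + K) * h (a i) : ℝ) : EReal) := by
    refine hle.trans ((add_le_add le_rfl hC).trans (le_of_eq ?_))
    rw [← EReal.coe_mul, ← EReal.coe_add]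
    congr 1
    ring
  have h2 : P.real (E (a i))ᶜ ≤ (1 - p) / 2 :=
    ENNReal.toReal_le_of_le_ofReal (by linarith) (hE hrisk)
  -- Subadditivity suffices, so measurability of `E` plays no role.
  have h3 := measureReal_union_le (μ := P) (E (a i)) (E (a i))ᶜ
  rw [Set.union_compl_self, probReal_univ] at h3
  linarith

theorem isLittleO_critFun_of_band {n : ℕ} (hB : InBand (n + 2) h ∨ OnBandBoundary (n + 2) h) :
    h =o[atTop] critFun (n + 1) := by
  rcases hB with hB | hB
  · exact hB.2.2
  · exact hB.isTheta.2.trans_isLittleO (isLittleO_critFun_succ (Nat.le_add_left 1 n))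

theorem eventually_one_le_of_band (hm : 1 ≤ m) (hB : InBand m h ∨ OnBandBoundary m h) :
    ∀ᶠ a in atTop, 1 ≤ h a := by
  rcases hB with hB | hB
  · exact eventually_one_le_of_isBigO hm hB.1 hB.2.1.isBigO
  · exact eventually_one_le_of_isBigO hm hB.1 hB.isTheta.1

theorem undershootIter_nonneg {k : ℕ} (hk : 1 ≤ k) (h : ℝ → ℝ) (a : ℝ) :
    0 ≤ undershootIter h k a := by
  obtain ⟨k, rfl⟩ : ∃ j, k = j + 1 := ⟨k - 1, by omega⟩
  rw [undershootIter, Function.iterate_succ_apply']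
  exact Real.sqrt_nonneg _

theorem tendsto_excessRatio_of_undershoot [IsProbabilityMeasure P] (hX : IsDriftBrownian P μ X)
    (hμ : 0 < μ) (hm : 1 ≤ m) (hB : InBand m h ∨ OnBandBoundary m h)
    (hreg : InBand m h → Measurable h ∧
      ∃ C x₀ : ℝ, ∀ x y, x₀ ≤ x → x ≤ y → h x ≤ C * h y) (z : ℝ)
    {T : ℝ → ℕ → Ω → ℝ≥0} (hT : ∀ a, 0 < a → IsSamplingRule X (T a))
    {a : ℕ → ℝ} (ha : Tendsto a atTop atTop) {k : ℕ} (hk : 1 ≤ k) (hkm : k < m) {ε : ℝ}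
    (hε : 0 < ε) (hp : ∃ p : ℝ, p < 1 ∧ ∀ᶠ i in atTop,
      P.real {ω | (1 - ε) * (1 / μ) ^ (1 - (1 / 2 : ℝ) ^ k) * undershootIter h k (a i)
        ≤ a i - stagePos X (T (a i)) k ω} ≤ p) :
    Tendsto (fun i => excessRatio P μ X m h z T (a i)) atTop (𝓝 ⊤) := by
  obtain ⟨n, rfl⟩ : ∃ n, m = n + 2 := ⟨m - 2, by omega⟩
  have h1 := eventually_one_le_of_band hm hB
  refine tendsto_excessRatio h1 (eventually_risk_optSampler_le hX hμ hm hB hreg z)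
    (E := fun a => {ω | (1 - ε) * (1 / μ) ^ (1 - (1 / 2 : ℝ) ^ k) * undershootIter h k a
        ≤ a - stagePos X (T a) k ω}) (fun η hη C => ?_) ha hp
  -- Shrinking `ε` below one only strengthens the bound, since the iterate is nonnegative.
  filter_upwards [hX.eventually_short hμ (isLittleO_critFun_of_band hB) h1 (k := k) (by omega)
    (ε := min ε (1 / 2)) (by positivity) (by linarith [min_le_right ε (1 / 2)]) hη C,
    eventually_gt_atTop 0] with a hs ha0 hrisk
  refine (measure_mono (Set.compl_subset_compl.2 fun ω hω => ?_)).trans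
    (hs (T a) (hT a ha0).isAdaptedRule hrisk)
  refine le_trans ?_ hω.2
  rw [mul_assoc]
  refine mul_le_mul_of_nonneg_right (by linarith [min_le_left ε (1 / 2)])
    (mul_nonneg (Real.rpow_nonneg (by positivity) _) (undershootIter_nonneg hk h a))

theorem tendsto_excessRatio_of_stageCount [IsProbabilityMeasure P] (hX : IsDriftBrownian P μ X)
    (hμ : 0 < μ) (hm : 1 ≤ m) (hB : InBand m h ∨ OnBandBoundary m h)
    (hreg : InBand m h → Measurable h ∧
      ∃ C x₀ : ℝ, ∀ x y, x₀ ≤ x → x ≤ y → h x ≤ C * h y) (z : ℝ)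
    {T : ℝ → ℕ → Ω → ℝ≥0} (hT : ∀ a, 0 < a → IsSamplingRule X (T a))
    {a : ℕ → ℝ} (ha : Tendsto a atTop atTop) (hp : ∃ p : ℝ, p < 1 ∧ ∀ᶠ i in atTop,
      P.real {ω | (m : ℕ∞) ≤ stageCount X (T (a i)) (a i) ω} ≤ p) :
    Tendsto (fun i => excessRatio P μ X m h z T (a i)) atTop (𝓝 ⊤) := by
  have h1 := eventually_one_le_of_band hm hB
  refine tendsto_excessRatio h1 (eventually_risk_optSampler_le hX hμ hm hB hreg z)
    (E := fun a => {ω | (m : ℕ∞) ≤ stageCount X (T a) a ω}) (fun η hη C => ?_) ha hp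
  -- For `m = 1` the event is certain: every rule takes at least one stage.
  rcases hm.eq_or_lt with rfl | hm2
  · refine .of_forall fun a _ => ?_
    have e : {ω | ((1 : ℕ) : ℕ∞) ≤ stageCount X (T a) a ω} = Set.univ :=
      Set.eq_univ_of_forall fun ω => (le_stageCount_iff (n := 0)).2 (stillBelow_zero ω)
    rw [e, Set.compl_univ, measure_empty]
    exact zero_le
  · obtain ⟨n, rfl⟩ : ∃ n, m = n + 2 := ⟨m - 2, by omega⟩
    -- Having at least `n + 2` stages means not having crossed through stage `n + 1`, so only that
    -- part of the event is needed, and `ε = 1 / 2` is arbitrary.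
    filter_upwards [hX.eventually_short hμ (isLittleO_critFun_of_band hB) h1 (k := n + 1) le_rfl
      (ε := 1 / 2) (by norm_num) (by norm_num) hη C, eventually_gt_atTop 0] with a hs ha0 hrisk
    refine (measure_mono (Set.compl_subset_compl.2 fun ω hω => ?_)).trans
      (hs (T a) (hT a ha0).isAdaptedRule hrisk)
    exact le_stageCount_iff.2 hω.1

theorem exists_frequently_le_of_not_tendsto_one [IsProbabilityMeasure P] {E : ℝ → Set Ω}
    (hE : ¬ Tendsto (fun a => P.real (E a)) atTop (𝓝 1)) :
    ∃ p : ℝ, p < 1 ∧ ∃ᶠ a in atTop, P.real (E a) ≤ p := by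
  by_contra! hc
  refine hE (tendsto_order.2 ⟨fun p hp => ?_, fun p hp =>
    .of_forall fun a => measureReal_le_one.trans_lt hp⟩)
  exact hc p hp

end Comparison

end

/-! ### The comparison theorem -/

theorem theorem2p5 {Ω : Type*} [MeasurableSpace Ω] (P : Measure Ω) [IsProbabilityMeasure P]
    (μ : ℝ) (hμ : 0 < μ) (X : ℝ≥0 → Ω → ℝ) (hX : IsDriftBrownian P μ X)
    (m : ℕ) (hm : 1 ≤ m) (h : ℝ → ℝ) (hB : InBand m h ∨ OnBandBoundary m h)
    -- inside the band, `h` is measurable and nondecreasing up to a constant factor near infinity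
    (hreg : InBand m h → Measurable h ∧
      ∃ C x₀ : ℝ, ∀ x y, x₀ ≤ x → x ≤ y → h x ≤ C * h y)
    -- on the boundary, `z` is the solution of `φ z / (1 - Φ z) = lim κ_m h_m / h`
    (z : ℝ) (hz : OnBandBoundary m h →
      Tendsto (fun x => kappaConst μ m * critFun m x / h x) atTop (𝓝 (normalHazard z)))
    (T : ℝ → ℕ → Ω → ℝ≥0) (hT : ∀ a, 0 < a → IsSamplingRule X (T a)) :
    (∀ a : ℕ → ℝ, Tendsto a atTop atTop →
      (∃ k, 1 ≤ k ∧ k < m ∧ ∃ ε : ℝ, 0 < ε ∧ ∃ p : ℝ, p < 1 ∧ ∀ᶠ i in atTop,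
        P.real {ω | (1 - ε) * (1 / μ) ^ (1 - (1 / 2 : ℝ) ^ k) * undershootIter h k (a i)
          ≤ a i - stagePos X (T (a i)) k ω} ≤ p) →
      Tendsto (fun i => excessRatio P μ X m h z T (a i)) atTop (𝓝 ⊤)) ∧
    (∀ a : ℕ → ℝ, Tendsto a atTop atTop →
      (∃ p : ℝ, p < 1 ∧ ∀ᶠ i in atTop,
        P.real {ω | (m : ℕ∞) ≤ stageCount X (T (a i)) (a i) ω} ≤ p) →
      Tendsto (fun i => excessRatio P μ X m h z T (a i)) atTop (𝓝 ⊤)) ∧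
    (¬ Tendsto (fun a : ℝ => P.real {ω | (m : ℕ∞) ≤ stageCount X (T a) a ω}) atTop (𝓝 1) →
      ∃ a : ℕ → ℝ, Tendsto a atTop atTop ∧
        Tendsto (fun i => excessRatio P μ X m h z T (a i)) atTop (𝓝 ⊤)) := by
  have hcount : ∀ a : ℕ → ℝ, Tendsto a atTop atTop →
      (∃ p : ℝ, p < 1 ∧ ∀ᶠ i in atTop,
        P.real {ω | (m : ℕ∞) ≤ stageCount X (T (a i)) (a i) ω} ≤ p) →
      Tendsto (fun i => excessRatio P μ X m h z T (a i)) atTop (𝓝 ⊤) := fun a ha hp =>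
    tendsto_excessRatio_of_stageCount hX hμ hm hB hreg z hT ha hp
  refine ⟨fun a ha ⟨k, hk, hkm, ε, hε, hp⟩ =>
    tendsto_excessRatio_of_undershoot hX hμ hm hB hreg z hT ha hk hkm hε hp, hcount, fun hlim => ?_⟩
  -- Probabilities never exceed one, so failure of convergence to one leaves them below a fixed `p <
  -- 1` for arbitrarily large `a`.
  obtain ⟨p, hp, hfreq⟩ := exists_frequently_le_of_not_tendsto_one hlim
  obtain ⟨a, ha, hle⟩ := exists_seq_forall_of_frequently hfreq
  exact ⟨a, ha, hcount a ha ⟨p, hp, .of_forall hle⟩⟩
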